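/- Let $n,p\ge 1$ be integers with $np\ge 3$, let $\omega=e^{2\pi i/n}$ and $M_\omega(z)=\omega z$. For $1\le r\le n$, $1\le s\le p$ let $C_{r,s}$ be the geodesic of the unit disk $\mathbb D$ whose endpoints have the angles $\frac{2\pi(r-1)}{n}+\frac{2\pi(s-1)}{np}$ and $\frac{2\pi(r-1)}{n}+\frac{2\pi s}{np}$, let $J_{r,s}\subset\mathbb S^1$ be the counter-clockwise arc between these endpoints, and let $\Pi$ be the closed ideal $np$-gon in $\mathbb D$ bounded by the $C_{r,s}$. Let $g_{1,s}$ be the reflection in $C_{1,s}$ followed by the reflection in the diameter with endpoints $\pm e^{\pi i/n}$, let $g_{r,s}=M_\omega^{r-1}\circ g_{1,s}\circ M_\omega^{-(r-1)}$, and let $\Gamma_{n,p}$ be the group generated by the $g_{r,s}$. The base Bowen–Series map $A^{\rm BS}_{\Gamma_{n,p}}:\overline{\mathbb D}\setminus{\rm int}\,\Pi\to\overline{\mathbb D}$ acts as $g_{r,s}$ on the closure of the hyperbolic half-plane enclosed by $C_{r,s}$ and $J_{r,s}$ (at a vertex of $\Pi$, the piece of the arc that starts there is used; the other choice leads to the same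 factor map below). Let $\psi$ be a homeomorphism of $\overline{\mathbb D}$ that is quasiconformal on $\mathbb D$, preserves $\mathbb D$, fixes $1$, commutes with $M_\omega$, and conjugates $\Gamma_{n,p}$ to a group $\Gamma=\psi\,\Gamma_{n,p}\,\psi^{-1}$ of Möbius automorphisms of $\mathbb D$. Put $A^{\rm BS}_\Gamma=\psi\circ A^{\rm BS}_{\Gamma_{n,p}}\circ\psi^{-1}$ on $\psi(\overline{\mathbb D}\setminus{\rm int}\,\Pi)$, let $\mathcal D_\Gamma$ be the image of this set under $z\mapsto z^n$, and let the factor Bowen–Series map $A=A^{\rm fBS}_\Gamma:\mathcal D_\Gamma\to\overline{\mathbb D}$ be given by $A(z^n)=\big(A^{\rm BS}_\Gamma(z)\big)^n$. Then $A$ is well defined, continuous on $\mathcal D_\Gamma\supset\mathbb S^1$ and holomorphic in the interior of $\mathcal D_\Gamma$, and the following hold. 1. $A$ restricts to a piecewise analytic, orientation-preserving, expansive covering map $\mathbb S^1\to\mathbb S^1$ of degree $np-1$, and this restriction is topologically conjugate to $z\mapsto z^{np-1}$ on $\mathbb S^1$. (Expansive: there is $\delta>0$ such that for all $a\ne b$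 in $\mathbb S^1$ some $k\ge 0$ satisfies $|A^{k}(a)-A^{k}(b)|>\delta$.) 2. The restriction $A:A^{-1}(\mathcal D_\Gamma)\to\mathcal D_\Gamma$ has degree $np-1$, in the following sense: every point of ${\rm int}\,\mathcal D_\Gamma$ has exactly $np-1$ preimages, counted with multiplicity; $A$ maps the boundary curves $\partial\mathcal D_\Gamma\cap\mathbb D$ bijectively onto themselves; and every point of $\mathcal D_\Gamma$ has exactly $np-1$ preimages in $\mathcal D_\Gamma$ off these curves. 3. The restriction $A:A^{-1}(\overline{\mathbb D}\setminus\mathcal D_\Gamma)\to\overline{\mathbb D}\setminus\mathcal D_\Gamma$ is holomorphic of degree $np$: every point has exactly $np$ preimages, counted with multiplicity. If $n\ge 2$, then $A$ has exactly $p$ critical points in the interior of $\mathcal D_\Gamma$; all of them lie in $A^{-1}(\overline{\mathbb D}\setminus\mathcal D_\Gamma)$, each has multiplicity $n-1$, and all are mapped to $0$, which is thus the unique critical value of $A$. -/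

import Mathlib

namespace FactorBS

noncomputable section

open Complex Set Filter Topology

/-- The closed unit disk. -/
abbrev Disk : Type := Metric.closedBall (0 : ℂ) 1

theorem Disk.norm_le (z : Disk) : ‖(z : ℂ)‖ ≤ 1 := by
  have h := z.2
  rwa [Metric.mem_closedBall, dist_zero_right] at h

/-- A point of the unit circle, seen in the closed disk. -/
def bdry (u : Circle) : Disk := ⟨(u : ℂ), by
  rw [Metric.mem_closedBall, dist_zero_right, Circle.norm_coe]⟩

/-! ### Rotations and reflections of the closed disk -/

/-- The rotation `z ↦ u z`. -/
def rot (u : Circle) : Disk ≃ₜ Disk where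
  toFun z := ⟨u * z, by
    rw [Metric.mem_closedBall, dist_zero_right, norm_mul, Circle.norm_coe, one_mul]
    exact z.norm_le⟩
  invFun z := ⟨(u⁻¹ : Circle) * z, by
    rw [Metric.mem_closedBall, dist_zero_right, norm_mul, Circle.norm_coe, one_mul]
    exact z.norm_le⟩
  left_inv z := by ext; simp
  right_inv z := by ext; simp
  continuous_toFun := by fun_prop
  continuous_invFun := by fun_prop

/-- The reflection `z ↦ u conj z` in the diameter with endpoints `± √u`. -/
def lineReflection (u : Circle) : Disk ≃ₜ Disk where
  toFun z := ⟨u * (starRingEnd ℂ) z, by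
    rw [Metric.mem_closedBall, dist_zero_right, norm_mul, Circle.norm_coe, one_mul, RCLike.norm_conj]
    exact z.norm_le⟩
  invFun z := ⟨u * (starRingEnd ℂ) z, by
    rw [Metric.mem_closedBall, dist_zero_right, norm_mul, Circle.norm_coe, one_mul, RCLike.norm_conj]
    exact z.norm_le⟩
  left_inv z := by
    ext
    simp [← mul_assoc, Complex.mul_conj, Circle.normSq_coe]
  right_inv z := by
    ext
    simp [← mul_assoc, Complex.mul_conj, Circle.normSq_coe]
  continuous_toFun := by fun_prop
  continuous_invFun := by fun_prop

/-- The radius of the circle centred at `c` that is orthogonal to the unit circle. -/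
def orthRadius (c : ℂ) : ℝ := Real.sqrt (‖c‖ ^ 2 - 1)

theorem orthRadius_sq {c : ℂ} (hc : 1 < ‖c‖) : orthRadius c ^ 2 = ‖c‖ ^ 2 - 1 :=
  Real.sq_sqrt (by nlinarith)

theorem orthRadius_ne {c : ℂ} (hc : 1 < ‖c‖) : orthRadius c ≠ 0 :=
  (Real.sqrt_pos.2 (by nlinarith)).ne'

theorem Disk.ne_center {c : ℂ} (hc : 1 < ‖c‖) (z : Disk) : (z : ℂ) ≠ c := by
  rintro rfl
  exact absurd z.norm_le (not_le.2 hc)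

theorem inversion_mem {c : ℂ} (hc : 1 < ‖c‖) (z : Disk) :
    EuclideanGeometry.inversion c (orthRadius c) (z : ℂ) ∈ Metric.closedBall (0 : ℂ) 1 := by
  have hz := z.norm_le
  have hne : ‖(z : ℂ) - c‖ ^ 2 ≠ 0 := by
    have := norm_ne_zero_iff.2 (sub_ne_zero.2 (Disk.ne_center hc z))
    positivity
  rw [Metric.mem_closedBall, dist_zero_right, ← sq_le_one_iff₀ (norm_nonneg _)]
  simp only [EuclideanGeometry.inversion, vsub_eq_sub, vadd_eq_add, div_pow, orthRadius_sq hc,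
    dist_eq_norm]
  have hpos : 0 < ‖(z : ℂ) - c‖ ^ 2 := lt_of_le_of_ne (by positivity) (Ne.symm hne)
  set N := ‖(z : ℂ) - c‖ ^ 2 with hN
  have hN' : N = ((z : ℂ).re - c.re) ^ 2 + ((z : ℂ).im - c.im) ^ 2 := by
    rw [hN, Complex.sq_norm, Complex.normSq_apply]; simp; ring
  have hc2 : ‖c‖ ^ 2 = c.re ^ 2 + c.im ^ 2 := by
    rw [Complex.sq_norm, Complex.normSq_apply]; ring
  have hz2 : (z : ℂ).re ^ 2 + (z : ℂ).im ^ 2 ≤ 1 := by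
    have : ‖(z : ℂ)‖ ^ 2 = (z : ℂ).re ^ 2 + (z : ℂ).im ^ 2 := by
      rw [Complex.sq_norm, Complex.normSq_apply]; ring
    nlinarith [norm_nonneg (z : ℂ)]
  have hC : 1 < c.re ^ 2 + c.im ^ 2 := by nlinarith
  rw [Complex.sq_norm, Complex.normSq_apply]
  simp only [add_re, add_im, smul_re, smul_im, sub_re, sub_im, smul_eq_mul, hc2]
  set x := (z : ℂ).re
  set y := (z : ℂ).im
  set a := c.re
  set b := c.im
  have key : ((a ^ 2 + b ^ 2 - 1) / N * (x - a) + a) * ((a ^ 2 + b ^ 2 - 1) / N * (x - a) + a) +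
      ((a ^ 2 + b ^ 2 - 1) / N * (y - b) + b) * ((a ^ 2 + b ^ 2 - 1) / N * (y - b) + b)
      = 1 - (a ^ 2 + b ^ 2 - 1) * (1 - (x ^ 2 + y ^ 2)) / N := by
    field_simp
    rw [hN']
    ring
  rw [key]
  have : 0 ≤ (a ^ 2 + b ^ 2 - 1) * (1 - (x ^ 2 + y ^ 2)) / N :=
    div_nonneg (mul_nonneg (by linarith) (by linarith)) hpos.le
  linarith

/-- The hyperbolic reflection of the closed disk in the geodesic that lies on the circle centred at
`c` and orthogonal to the unit circle: the inversion in this circle. -/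
def geodesicReflection (c : ℂ) (hc : 1 < ‖c‖) : Disk ≃ₜ Disk where
  toFun z := ⟨EuclideanGeometry.inversion c (orthRadius c) (z : ℂ), inversion_mem hc z⟩
  invFun z := ⟨EuclideanGeometry.inversion c (orthRadius c) (z : ℂ), inversion_mem hc z⟩
  left_inv z := by
    ext
    exact EuclideanGeometry.inversion_inversion c (orthRadius_ne hc) _
  right_inv z := by
    ext
    exact EuclideanGeometry.inversion_inversion c (orthRadius_ne hc) _
  continuous_toFun := by
    refine Continuous.subtype_mk ?_ _
    exact Continuous.inversion continuous_const continuous_const continuous_subtype_val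
      (fun z => Disk.ne_center hc z)
  continuous_invFun := by
    refine Continuous.subtype_mk ?_ _
    exact Continuous.inversion continuous_const continuous_const continuous_subtype_val
      (fun z => Disk.ne_center hc z)

/-- The Möbius automorphisms of the disk. -/
def IsDiskAut (g : Disk ≃ₜ Disk) : Prop :=
  ∃ a b : ℂ, ‖b‖ < ‖a‖ ∧ ∀ z : Disk,
    (g z : ℂ) = (a * z + b) / ((starRingEnd ℂ) b * z + (starRingEnd ℂ) a)

/-! ### The base polygon, its side pairings and the base group

The indices `r`, `s` start from `0`. -/

/-- `ω = exp (2πi/n)`. -/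
def omega (n : ℕ) : Circle := Circle.exp (2 * Real.pi / n)

/-- The centre of the circle orthogonal to the unit circle that carries the geodesic `C_{r,s}` with
endpoints at the angles `2πr/n + 2πs/(np)` and `2πr/n + 2π(s+1)/(np)`. -/
def center (n p : ℕ) (r : Fin n) (s : Fin p) : ℂ :=
  Circle.exp (2 * Real.pi * r / n + 2 * Real.pi * (s + 1 / 2) / (n * p)) /
    Real.cos (Real.pi / (n * p))

theorem one_lt_norm_center {n p : ℕ} (h : 3 ≤ n * p) (r : Fin n) (s : Fin p) :
    1 < ‖center n p r s‖ := by
  have h3 : (3 : ℝ) ≤ n * p := by exact_mod_cast h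
  have hx : 0 < Real.pi / (n * p) := div_pos Real.pi_pos (by linarith)
  have hx2 : Real.pi / (n * p) < Real.pi / 2 :=
    div_lt_div_of_pos_left Real.pi_pos (by norm_num) (by linarith)
  have hc : 0 < Real.cos (Real.pi / (n * p)) :=
    Real.cos_pos_of_mem_Ioo ⟨by linarith, hx2⟩
  have hc1 : Real.cos (Real.pi / (n * p)) < 1 := by
    have := Real.cos_lt_cos_of_nonneg_of_le_pi_div_two le_rfl hx2.le hx
    rwa [Real.cos_zero] at this
  rw [center, norm_div, Circle.norm_coe, Complex.norm_real, Real.norm_of_nonneg hc.le]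
  exact (one_lt_div hc).2 hc1

/-- The closure, in the closed disk, of the hyperbolic half-plane enclosed by the geodesic
`C_{r,s}` and the arc `J_{r,s}`. -/
def halfPlane (n p : ℕ) (r : Fin n) (s : Fin p) : Set Disk :=
  {z | ‖(z : ℂ) - center n p r s‖ ≤ orthRadius (center n p r s)}

/-- The ideal `np`-gon `Π` bounded by the geodesics `C_{r,s}`, closed in the open disk. -/
def polygon (n p : ℕ) : Set ℂ :=
  {z | ‖z‖ < 1 ∧ ∀ r s, orthRadius (center n p r s) ≤ ‖z - center n p r s‖}

theorem pos_of_three_le {n p : ℕ} (h : 3 ≤ n * p) : 0 < n :=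
  Nat.pos_of_ne_zero (by rintro rfl; omega)

/-- `g_{1,s}`: the reflection in `C_{1,s}` followed by the reflection in the diameter with
endpoints `± exp (πi/n)`. -/
def pairingOne {n p : ℕ} (h : 3 ≤ n * p) (s : Fin p) : Disk ≃ₜ Disk :=
  lineReflection (omega n) *
    geodesicReflection (center n p ⟨0, pos_of_three_le h⟩ s)
      (one_lt_norm_center h ⟨0, pos_of_three_le h⟩ s)

/-- The side pairings `g_{r,s} = M_ω^r ∘ g_{1,s} ∘ M_ω^{-r}`. -/
def pairing {n p : ℕ} (h : 3 ≤ n * p) (r : Fin n) (s : Fin p) : Disk ≃ₜ Disk :=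
  rot (omega n) ^ (r : ℕ) * pairingOne h s * (rot (omega n) ^ (r : ℕ))⁻¹

/-- The base group `Γ_{n,p}`, generated by the side pairings. -/
def baseGroup {n p : ℕ} (h : 3 ≤ n * p) : Subgroup (Disk ≃ₜ Disk) :=
  Subgroup.closure {g | ∃ r s, g = pairing h r s}

/-! ### Bowen-Series map of the base group -/

/-- The half-plane of `C_{r,s}` without the endpoint of `J_{r,s}` at its counter-clockwise end.
These sets partition the complement of the interior of `Π`; a vertex of `Π` belongs to the piece
of the arc that starts there. -/
def piece (n p : ℕ) (r : Fin n) (s : Fin p) : Set Disk :=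
  halfPlane n p r s \
    {bdry (Circle.exp (2 * Real.pi * r / n + 2 * Real.pi * (s + 1) / (n * p)))}

/-- The domain of the Bowen-Series map of the base group: the closed disk without the interior of
`Π`. -/
def baseDomain (n p : ℕ) : Set Disk := {z | (z : ℂ) ∉ interior (polygon n p)}

open Classical in
/-- The Bowen-Series map of the base group: it acts as `g_{r,s}` on the half-plane of `C_{r,s}`
(and is given the irrelevant value `z` at the points `z` outside of its domain). -/
def baseBowenSeries {n p : ℕ} (h : 3 ≤ n * p) (z : Disk) : Disk :=
  if hz : ∃ i : Fin n × Fin p, z ∈ piece n p i.1 i.2 then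
    pairing h hz.choose.1 hz.choose.2 z
  else z

/-! ### Maps of the circle -/

/-- `f` has a strictly increasing continuous lift to the real line. -/
def OrientationPreserving (f : Circle → ℂ) : Prop :=
  ∃ L : ℝ → ℝ, Continuous L ∧ StrictMono L ∧ ∀ t, f (Circle.exp t) = Circle.exp (L t)

/-- The circle can be cut into finitely many closed arcs such that, on each of them, `f` is the
restriction of a map that is complex analytic in a neighbourhood of the arc. -/
def PiecewiseAnalytic (f : Circle → Circle) : Prop :=
  ∃ (N : ℕ) (t : ℕ → ℝ), StrictMono t ∧ t N = t 0 + 2 * Real.pi ∧ ∀ k < N,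
    ∃ G : ℂ → ℂ, ∀ x ∈ Icc (t k) (t (k + 1)),
      AnalyticAt ℂ G (Circle.exp x) ∧ G (Circle.exp x) = f (Circle.exp x)

/-- There is `δ > 0` such that any two distinct points are eventually more than `δ` apart at some
time of their forward orbits. -/
def Expansive (f : Circle → Circle) : Prop :=
  ∃ δ : ℝ, 0 < δ ∧ ∀ a b : Circle, a ≠ b → ∃ k : ℕ, δ < dist (f^[k] a) (f^[k] b)

/-- `f` is a covering map, all of whose fibres have `d` points. -/
def IsCoveringOfDegree (f : Circle → Circle) (d : ℕ) : Prop :=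
  IsCoveringMap f ∧ ∀ z, (f ⁻¹' {z}).Finite ∧ (f ⁻¹' {z}).ncard = d

/-- `f` is topologically conjugate to `z ↦ z ^ d`. -/
def ConjugateToPower (f : Circle → Circle) (d : ℕ) : Prop :=
  ∃ H : Circle ≃ₜ Circle, ∀ z, H (z ^ d) = f (H z)

/-! ### Holomorphic maps of finite degree -/

/-- The holomorphic map `F : U → V` has degree `d`: each point of `V` has exactly `d` preimages in
`U`, counted with multiplicity. -/
def HasDegree (F : ℂ → ℂ) (U V : Set ℂ) (d : ℕ) : Prop :=
  AnalyticOnNhd ℂ F U ∧ MapsTo F U V ∧ ∀ w ∈ V, {z ∈ U | F z = w}.Finite ∧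
    ∑ᶠ z ∈ {z ∈ U | F z = w}, analyticOrderAt (fun x => F x - w) z = d

/-! ### Deformations of the base group and factor Bowen-Series maps -/

/-- Quasiconformality of a homeomorphism of the closed disk that preserves the open disk: it
preserves the orientation, and its linear dilatation
`limsup_{r → 0} max_{|x-z|=r} |ψ x - ψ z| / min_{|y-z|=r} |ψ y - ψ z|` is bounded on the open
disk. -/
def IsQuasiconformal (ψ : Disk ≃ₜ Disk) : Prop :=
  (∀ z : Disk, ‖(ψ z : ℂ)‖ < 1 ↔ ‖(z : ℂ)‖ < 1) ∧
  OrientationPreserving (fun u => (ψ (bdry u) : ℂ)) ∧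
  ∃ K : ℝ, ∀ z : Disk, ‖(z : ℂ)‖ < 1 → ∀ᶠ r : ℝ in 𝓝[>] 0, ∀ x y : Disk,
    dist x z = r → dist y z = r → dist (ψ x) (ψ z) ≤ K * dist (ψ y) (ψ z)

/-- `ψ` induces an element `ρ : Γ_{n,p} → Γ`, `ρ g = ψ ∘ g ∘ ψ⁻¹`, of `Teich^ω(Γ_{n,p})`: it is a
quasiconformal homeomorphism that preserves the disk, fixes `1`, commutes with `M_ω` and
conjugates the base group to a group of Möbius automorphisms of the disk. -/
structure InducesTeichOmega {n p : ℕ} (h : 3 ≤ n * p) (ψ : Disk ≃ₜ Disk) : Prop where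
  quasiconformal : IsQuasiconformal ψ
  map_one : ψ (bdry 1) = bdry 1
  map_omega : ∀ z, ψ (rot (omega n) z) = rot (omega n) (ψ z)
  conj_mem : ∀ g ∈ baseGroup h, IsDiskAut (ψ * g * ψ⁻¹)

/-- The Bowen-Series map of `Γ = ψ Γ_{n,p} ψ⁻¹` with fundamental domain `ψ(Π)`. -/
def bowenSeries {n p : ℕ} (h : 3 ≤ n * p) (ψ : Disk ≃ₜ Disk) (z : Disk) : Disk :=
  ψ (baseBowenSeries h (ψ.symm z))

/-- The domain of the Bowen-Series map of `Γ`. -/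
def bowenSeriesDomain (n p : ℕ) (ψ : Disk ≃ₜ Disk) : Set Disk := ψ '' baseDomain n p

/-- `𝒟_Γ`, the image of the domain of the Bowen-Series map under the quotient of the disk by
`M_ω`, which is identified with the disk by `z ↦ z ^ n`. -/
def factorDomain (n p : ℕ) (ψ : Disk ≃ₜ Disk) : Set ℂ :=
  (fun z : Disk => (z : ℂ) ^ n) '' bowenSeriesDomain n p ψ

open Classical in
/-- The factor Bowen-Series map `A_Γ^{fBS}`: it sends `z ^ n` to `(A_Γ^{BS} z) ^ n`. -/
def factorBowenSeries {n p : ℕ} (h : 3 ≤ n * p) (ψ : Disk ≃ₜ Disk) (w : ℂ) : ℂ :=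
  if hw : ∃ z : Disk, (z : ℂ) ^ n = w then (bowenSeries h ψ hw.choose : ℂ) ^ n else 0

/-- The boundary of `𝒟_Γ` in the open disk. -/
def boundaryCurves (n p : ℕ) (ψ : Disk ≃ₜ Disk) : Set ℂ :=
  frontier (factorDomain n p ψ) ∩ Metric.ball 0 1

/-- The critical points of `A_Γ^{fBS}`. -/
def criticalPoints {n p : ℕ} (h : 3 ≤ n * p) (ψ : Disk ≃ₜ Disk) : Set ℂ :=
  {z ∈ interior (factorDomain n p ψ) | deriv (factorBowenSeries h ψ) z = 0}

/-- `(A_Γ^{fBS})⁻¹(V)`, for a subset `V` of the closed disk. -/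
def factorPreimage {n p : ℕ} (h : 3 ≤ n * p) (ψ : Disk ≃ₜ Disk) (V : Set ℂ) : Set ℂ :=
  {z ∈ factorDomain n p ψ | factorBowenSeries h ψ z ∈ V}

end

end FactorBS

namespace FactorBS

noncomputable section

open Complex Set Filter Topology

/-! ### Expanding lifts of circle maps -/

section Lift

variable {F : ℝ → ℝ} {T : ℝ} {d : ℕ}

/-! Counting. Modulo `M_ω` only the `p` sides of the first sector matter. The pairing of side `s` is
an inversion followed by a reflection that exchanges `s` and `s.rev`, so it carries the half-plane
of `s` onto the complement of that of `s.rev`; `pairingOne_notMem_piece_iff` makes this exact on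
pieces, off the open geodesic. Hence the preimages of `w` off the boundary curves correspond to the
pairs of a side and a point of the fibre of `quo` over `w` outside the piece of that side
(`preimage_eq_image`, `injOn_preimage`). A fibre has `n` points, except that for `n ≥ 2` the fibre
over `0` is one point. Over the complement of the domain all pairs count, which gives `np`; over the
domain exactly one pair is lost, because the pieces of the first sector embed in the quotient
(`piece_quo_injective`), which leaves `np - 1`.

Multiplicities. At an interior point of the domain the factor map is the `n`-th power of a local
biholomorphism, namely a branch of the `n`-th root followed by a Möbius map (`exists_local_form`).
It is therefore unramified where its value is nonzero and of order `n` where its value is `0`. This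
turns the `p` preimages of `0` into `np` and identifies the critical points.

The circle. In half-angle tangent coordinates the inversion in a side becomes explicit and yields a
lift `baseLift` whose slope exceeds `1` except at the vertices, where it equals `1` from either
side. So it increases distances strictly but without a uniform factor. Compactness still makes the
limit of `F^[k] / d ^ k` injective, hence a conjugacy to multiplication by `d`
(`exists_strictMono_semiconj`). The boundary values of `ψ` commute with `M_ω`, descend to the
quotient circle and transport this conjugacy to the factor map. Covering, degree and expansiveness
are invariant under conjugacy and are read off from the power map. The formulas of adjacent sides
agree at the vertices, as values of one lift (`factorBowenSeries_halfPlane`), which gives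
continuity. -/

theorem iterate_add_period (hF : ∀ x, F (x + T) = F x + d * T) (k : ℕ) (x : ℝ) :
    F^[k] (x + T) = F^[k] x + d ^ k * T := by
  have hm : ∀ (m : ℕ) (x : ℝ), F (x + m * T) = F x + m * (d * T) := by
    intro m
    induction m with
    | zero => simp
    | succ m ih =>
      intro x
      have : x + ((m + 1 : ℕ) : ℝ) * T = (x + m * T) + T := by push_cast; ring
      rw [this, hF, ih]
      push_cast
      ring
  induction k with
  | zero => simp
  | succ k ih =>
    rw [Function.iterate_succ_apply', ih, Function.iterate_succ_apply']
    have := hm (d ^ k) (F^[k] x)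
    push_cast at this
    rw [this]
    ring

theorem exists_bound_of_periodic {G : ℝ → ℝ} (hT : 0 < T) (hG : Continuous G)
    (hp : Function.Periodic G T) : ∃ C, ∀ x, |G x| ≤ C := by
  obtain ⟨C, hC⟩ := (isCompact_Icc (a := (0 : ℝ)) (b := T)).exists_bound_of_continuousOn
    hG.continuousOn
  refine ⟨C, fun x => ?_⟩
  obtain ⟨y, hy, hxy⟩ := hp.exists_mem_Ico₀ hT x
  rw [hxy]
  exact hC y ⟨hy.1, hy.2.le⟩

/-- A strictly expanding lift of degree `d ≥ 2` is conjugate to the multiplication by `d`. -/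
theorem exists_strictMono_semiconj (hT : 0 < T) (hd : 2 ≤ d) (hc : Continuous F)
    (hF : ∀ x, F (x + T) = F x + d * T) (he : ∀ x y, x < y → y - x < F y - F x) :
    ∃ h : ℝ → ℝ, Continuous h ∧ StrictMono h ∧ (∀ x, h (x + T) = h x + T) ∧
      ∀ x, h (F x) = d * h x := by
  have hd0 : (0 : ℝ) < d := by exact_mod_cast (by omega : 0 < d)
  have hd2 : (2 : ℝ) ≤ d := by exact_mod_cast hd
  -- The conjugacy is the limit of `F^[k] x / d ^ k`. It is written as a telescoping series in the
  -- deviation `G` of `F` from the linear map, which is periodic and hence bounded, so that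
  -- convergence is uniform.
  set G : ℝ → ℝ := fun x => F x - d * x with hG
  have hGp : Function.Periodic G T := by
    intro x
    simp only [hG, hF]
    ring
  have hGc : Continuous G := by fun_prop
  obtain ⟨C, hC⟩ := exists_bound_of_periodic hT hGc hGp
  set a : ℕ → ℝ → ℝ := fun k x => G (F^[k] x) / d ^ (k + 1) with ha
  have hbound : ∀ k x, ‖a k x‖ ≤ C * (1 / 2) ^ (k + 1) := by
    intro k x
    have hC0 : 0 ≤ C := (abs_nonneg _).trans (hC 0)
    simp only [ha, norm_div, Real.norm_eq_abs, norm_pow]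
    rw [div_eq_mul_inv, ← inv_pow, abs_of_pos hd0, one_div]
    have : ((d : ℝ)⁻¹) ^ (k + 1) ≤ (2⁻¹ : ℝ) ^ (k + 1) := by gcongr
    exact mul_le_mul (hC _) this (by positivity) hC0
  have hsumm : Summable fun k : ℕ => C * (1 / 2 : ℝ) ^ (k + 1) := by
    have := (summable_geometric_two).mul_left (C * (1 / 2))
    refine this.congr fun k => ?_
    ring
  have hs : ∀ x, Summable fun k => a k x := fun x =>
    Summable.of_norm_bounded hsumm fun k => hbound k x
  set h : ℝ → ℝ := fun x => x + ∑' k, a k x with hh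
  have hit : ∀ k, Continuous (F^[k]) := fun k => hc.iterate k
  have hcont : Continuous h := by
    refine continuous_id.add (continuous_tsum (fun k => ?_) hsumm hbound)
    exact (hGc.comp (hit k)).div_const _
  have hmF : StrictMono F := fun x y hxy => by linarith [he x y hxy]
  have hpartial : ∀ K x, x + ∑ k ∈ Finset.range K, a k x = F^[K] x / d ^ K := by
    intro K x
    induction K with
    | zero => simp
    | succ K ih =>
      rw [Finset.sum_range_succ, ← add_assoc, ih, Function.iterate_succ_apply']
      simp only [ha, hG]
      field_simp
      ring
  have hmono : Monotone h := by
    intro x y hxy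
    have hx : Tendsto (fun K => F^[K] x / (d : ℝ) ^ K) atTop (𝓝 (h x)) := by
      simp_rw [← hpartial]
      exact (hs x).hasSum.tendsto_sum_nat.const_add x
    have hy : Tendsto (fun K => F^[K] y / (d : ℝ) ^ K) atTop (𝓝 (h y)) := by
      simp_rw [← hpartial]
      exact (hs y).hasSum.tendsto_sum_nat.const_add y
    refine le_of_tendsto_of_tendsto' hx hy fun K => ?_
    exact div_le_div_of_nonneg_right ((hmF.monotone.iterate K) hxy) (by positivity)
  have hper : ∀ x, h (x + T) = h x + T := by
    intro x
    have : ∀ k, a k (x + T) = a k x := by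
      intro k
      simp only [ha]
      rw [iterate_add_period hF]
      have := hGp.nat_mul (d ^ k) (F^[k] x)
      push_cast at this
      rw [this]
    simp only [hh, this]
    ring
  have hsemi : ∀ x, h (F x) = d * h x := by
    intro x
    have h1 : ∑' k, a k x = a 0 x + ∑' k, a (k + 1) x := (hs x).tsum_eq_zero_add
    have h2 : ∀ k, a k (F x) = d * a (k + 1) x := by
      intro k
      simp only [ha, Function.iterate_succ_apply]
      rw [pow_succ _ (k + 1)]
      field_simp
    have h3 : ∑' k, a k (F x) = d * ∑' k, a (k + 1) x := by
      simp_rw [h2]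
      exact tsum_mul_left
    have h4 : a 0 x = (F x - d * x) / d := by simp [ha, hG]
    simp only [hh]
    rw [h3, h1, h4]
    field_simp
    ring
  refine ⟨h, hcont, ?_, hper, hsemi⟩
  refine hmono.strictMono_of_injective ?_
  -- If `h x = h y`, the orbits never separate by more than one period, since `h` would then gain
  -- `T`. The gaps stay in the compact interval from `y - x` to `T`, on which the gain `e` of one
  -- step has a positive minimum over a period of base points. The gaps would thus grow linearly, a
  -- contradiction.
  have key : ∀ x y, x < y → h x ≠ h y := by
    intro x y hxy heq
    have hiter : ∀ k, h (F^[k] x) = h (F^[k] y) := by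
      intro k
      induction k with
      | zero => exact heq
      | succ k ih => rw [Function.iterate_succ_apply', Function.iterate_succ_apply', hsemi, hsemi, ih]
    have hlt : ∀ k, F^[k] y - F^[k] x ≤ T := by
      intro k
      by_contra hcon
      have h1 := hmono (show F^[k] x + T ≤ F^[k] y by linarith)
      rw [hper, hiter] at h1
      linarith
    have hmonoi : ∀ k, y - x ≤ F^[k] y - F^[k] x := by
      intro k
      induction k with
      | zero => simp
      | succ k ih =>
        rw [Function.iterate_succ_apply', Function.iterate_succ_apply']
        have := he (F^[k] x) (F^[k] y) (by linarith)
        linarith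
    set e : ℝ × ℝ → ℝ := fun q => F (q.1 + q.2) - F q.1 - q.2 with hedef
    have hec : Continuous e := by fun_prop
    have hK : IsCompact (Icc (0 : ℝ) T ×ˢ Icc (y - x) T) := isCompact_Icc.prod isCompact_Icc
    have hne : (Icc (0 : ℝ) T ×ˢ Icc (y - x) T).Nonempty :=
      ⟨(0, y - x), ⟨le_rfl, hT.le⟩, le_rfl, by simpa using hlt 0⟩
    obtain ⟨q, hq, hqmin⟩ := hK.exists_isMinOn hne hec.continuousOn
    have hqpos : 0 < e q := by
      have := he q.1 (q.1 + q.2) (by linarith [hq.2.1])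
      simp only [hedef]
      linarith
    have hstep : ∀ k, e q + (F^[k] y - F^[k] x) ≤ F^[k + 1] y - F^[k + 1] x := by
      intro k
      have hp : Function.Periodic (fun u => e (u, F^[k] y - F^[k] x)) T := by
        intro u
        have : u + T + (F^[k] y - F^[k] x) = (u + (F^[k] y - F^[k] x)) + T := by ring
        simp only [hedef, this, hF]
        ring
      obtain ⟨u, hu, hux⟩ := hp.exists_mem_Ico₀ hT (F^[k] x)
      have h1 : e q ≤ e (u, F^[k] y - F^[k] x) :=
        hqmin (show (u, F^[k] y - F^[k] x) ∈ _ from ⟨⟨hu.1, hu.2.le⟩, hmonoi k, hlt k⟩)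
      rw [← hux] at h1
      simp only [hedef, add_sub_cancel] at h1
      rw [Function.iterate_succ_apply', Function.iterate_succ_apply']
      simp only [hedef]
      linarith
    have hgrow : ∀ k : ℕ, k * e q ≤ F^[k] y - F^[k] x := by
      intro k
      induction k with
      | zero => simp; linarith
      | succ k ih =>
        have := hstep k
        push_cast
        linarith
    obtain ⟨k, hk⟩ := exists_nat_gt (T / e q)
    have h1 := hgrow k
    have h2 := hlt k
    rw [div_lt_iff₀ hqpos] at hk
    linarith
  intro x y hxy
  rcases lt_trichotomy x y with hlt | heq | hgt
  · exact absurd hxy (key x y hlt)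
  · exact heq
  · exact absurd hxy.symm (key y x hgt)

theorem add_int_mul_period {h : ℝ → ℝ} (hp : ∀ x, h (x + T) = h x + T) (m : ℤ) (x : ℝ) :
    h (x + m * T) = h x + m * T := by
  have hq : Function.Periodic (fun x => h x - x) T := by
    intro x
    simp only [hp]
    ring
  have := hq.int_mul m x
  linarith

theorem surjective_of_lift {h : ℝ → ℝ} (hT : 0 < T) (hc : Continuous h)
    (hp : ∀ x, h (x + T) = h x + T) : Function.Surjective h := by
  intro y
  obtain ⟨m, hm⟩ := exists_int_gt ((y - h 0) / T)
  obtain ⟨k, hk⟩ := exists_int_lt ((y - h 0) / T)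
  rw [div_lt_iff₀ hT] at hm
  rw [lt_div_iff₀ hT] at hk
  have h1 := add_int_mul_period hp m 0
  have h2 := add_int_mul_period hp k 0
  exact mem_range_of_exists_le_of_exists_ge hc ⟨0 + k * T, by linarith⟩ ⟨0 + m * T, by linarith⟩

end Lift

/-! ### Homeomorphisms of the circle from their lifts -/

theorem isQuotientMap_circleExp : IsQuotientMap Circle.exp :=
  Circle.isCoveringMap_exp.isQuotientMap Circle.exp_surjective

theorem exists_circleHomeomorph_of_lift {h : ℝ → ℝ} (hc : Continuous h) (hm : StrictMono h)
    (hp : ∀ x, h (x + 2 * Real.pi) = h x + 2 * Real.pi) :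
    ∃ H : Circle ≃ₜ Circle, ∀ x, H (Circle.exp x) = Circle.exp (h x) := by
  set H : Circle → Circle := fun u => Circle.exp (h (arg u)) with hH
  have hexp : ∀ x, H (Circle.exp x) = Circle.exp (h x) := by
    intro x
    obtain ⟨m, hm⟩ := Circle.exp_eq_exp.1 (Circle.exp_arg (Circle.exp x))
    simp only [hH]
    rw [hm, add_int_mul_period hp]
    exact Circle.exp_eq_exp.2 ⟨m, rfl⟩
  have hcont : Continuous H := by
    rw [isQuotientMap_circleExp.continuous_iff]
    have : H ∘ Circle.exp = Circle.exp ∘ h := funext hexp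
    rw [this]
    exact Circle.exp.continuous.comp hc
  have hinj : Function.Injective H := by
    intro u v huv
    obtain ⟨x, rfl⟩ := Circle.exp_surjective u
    obtain ⟨y, rfl⟩ := Circle.exp_surjective v
    rw [hexp, hexp] at huv
    obtain ⟨m, hm'⟩ := Circle.exp_eq_exp.1 huv
    rw [← add_int_mul_period hp] at hm'
    exact Circle.exp_eq_exp.2 ⟨m, hm.injective hm'⟩
  have hsurj : Function.Surjective H := by
    intro u
    obtain ⟨y, rfl⟩ := Circle.exp_surjective u
    obtain ⟨x, rfl⟩ := surjective_of_lift Real.two_pi_pos hc hp y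
    exact ⟨Circle.exp x, hexp x⟩
  exact ⟨Continuous.homeoOfEquivCompactToT2 (f := Equiv.ofBijective H ⟨hinj, hsurj⟩) hcont, hexp⟩

/-! ### Consequences of a conjugacy to a power map -/

/-- The quotient of `c ^ d - 1` by `c - 1` is a geometric sum of `d` terms, each within `d * δ` of
`1`. -/
theorem norm_pow_sub_one_ge {c : ℂ} {d : ℕ} {δ : ℝ} (hc : ‖c‖ = 1) (h : ‖c - 1‖ ≤ δ) :
    (d - d * d * δ) * ‖c - 1‖ ≤ ‖c ^ d - 1‖ := by
  have hpow : ∀ j : ℕ, ‖c ^ j - 1‖ ≤ j * ‖c - 1‖ := by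
    intro j
    induction j with
    | zero => simp
    | succ j ih =>
      have : c ^ (j + 1) - 1 = c ^ j * (c - 1) + (c ^ j - 1) := by ring
      rw [this]
      refine (norm_add_le _ _).trans ?_
      rw [norm_mul, norm_pow, hc, one_pow]
      push_cast
      linarith
  have hsum : (d : ℝ) - d * d * δ ≤ ‖∑ j ∈ Finset.range d, c ^ j‖ := by
    have h1 : ∑ j ∈ Finset.range d, c ^ j = d + ∑ j ∈ Finset.range d, (c ^ j - 1) := by
      rw [Finset.sum_sub_distrib]
      simp
    have h2 : ‖∑ j ∈ Finset.range d, (c ^ j - 1)‖ ≤ d * (d * δ) := by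
      refine (norm_sum_le _ _).trans ?_
      refine (Finset.sum_le_card_nsmul _ _ (d * δ) fun j hj => ?_).trans ?_
      · refine (hpow j).trans ?_
        have : (j : ℝ) ≤ d := by exact_mod_cast (Finset.mem_range.1 hj).le
        exact mul_le_mul this h (norm_nonneg _) (by positivity)
      · simp
    rw [h1]
    have h3 := norm_sub_le_norm_add (d : ℂ) (∑ j ∈ Finset.range d, (c ^ j - 1))
    rw [Complex.norm_natCast] at h3
    linarith
  rw [← geom_sum_mul, norm_mul]
  exact mul_le_mul_of_nonneg_right hsum (norm_nonneg _)

/-- As long as the distance stays at most `1 / (4 * d)`, each application of the power map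
multiplies it by at least `d - d / 4`, which is at least `3 / 2`. This cannot go on forever. -/
theorem exists_lt_dist_pow {d : ℕ} (hd : 2 ≤ d) {a b : Circle} (hab : a ≠ b) :
    ∃ k : ℕ, 1 / (4 * d : ℝ) < dist (a ^ d ^ k) (b ^ d ^ k) := by
  have hd2 : (2 : ℝ) ≤ d := by exact_mod_cast hd
  by_contra! hcon
  set c : ℂ := ((a / b : Circle) : ℂ) with hcdef
  have hdist : ∀ k : ℕ, dist (a ^ k) (b ^ k) = ‖c ^ k - 1‖ := by
    intro k
    have : c ^ k - 1 = ((a : ℂ) ^ k - b ^ k) / b ^ k := by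
      rw [hcdef, Circle.coe_div, div_pow, sub_div, div_self (pow_ne_zero _ b.coe_ne_zero)]
    rw [this, norm_div, norm_pow, Circle.norm_coe, one_pow, div_one]
    exact dist_eq_norm (a ^ k : ℂ) (b ^ k : ℂ)
  have hgrow : ∀ k : ℕ, (3 / 2) ^ k * ‖c - 1‖ ≤ ‖c ^ d ^ k - 1‖ := by
    intro k
    induction k with
    | zero => simp
    | succ k ih =>
      have h1 : ‖c ^ d ^ k‖ = 1 := by rw [norm_pow, Circle.norm_coe, one_pow]
      have h2 := hcon k
      rw [hdist] at h2
      have h3 := norm_pow_sub_one_ge (d := d) h1 h2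
      rw [← pow_mul, ← pow_succ] at h3
      have h4 : (3 / 2 : ℝ) ≤ d - d * d * (1 / (4 * d)) := by
        field_simp
        linarith
      have h5 := mul_le_mul_of_nonneg_right h4 (norm_nonneg (c ^ d ^ k - 1))
      rw [pow_succ]
      linarith
  have hpos : 0 < ‖c - 1‖ := by
    rw [norm_pos_iff, sub_ne_zero, hcdef, Ne, Circle.coe_eq_one, div_eq_one]
    exact hab
  obtain ⟨k, hk⟩ := pow_unbounded_of_one_lt (1 / ‖c - 1‖) (by norm_num : (1 : ℝ) < 3 / 2)
  rw [div_lt_iff₀ hpos] at hk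
  have h1 := hgrow k
  have h2 := hcon k
  rw [hdist] at h2
  have h3 : 1 / (4 * d : ℝ) ≤ 1 := by
    rw [div_le_one (by linarith)]
    linarith
  linarith

section Conjugate

variable {f : Circle → Circle} {d : ℕ}

/-- Uniform continuity of the inverse conjugacy, by compactness of the circle, turns the separation
constant of the power map into one for `f`. -/
theorem ConjugateToPower.expansive (hd : 2 ≤ d) (hf : ConjugateToPower f d) : Expansive f := by
  obtain ⟨H, hH⟩ := hf
  have hsemi : ∀ k u, H.symm (f^[k] u) = H.symm u ^ d ^ k := by
    intro k u
    induction k with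
    | zero => simp
    | succ k ih =>
      rw [Function.iterate_succ_apply', pow_succ, pow_mul, ← ih, Homeomorph.symm_apply_eq, hH,
        Homeomorph.apply_symm_apply]
  have hu : UniformContinuous H.symm :=
    CompactSpace.uniformContinuous_of_continuous H.symm.continuous
  have hd0 : (0 : ℝ) < 1 / (4 * d) := by
    have : (2 : ℝ) ≤ d := by exact_mod_cast hd
    exact one_div_pos.2 (by linarith)
  obtain ⟨δ, hδ, hδ'⟩ := Metric.uniformContinuous_iff.1 hu _ hd0
  refine ⟨δ / 2, by linarith, fun a b hab => ?_⟩
  obtain ⟨k, hk⟩ := exists_lt_dist_pow hd (H.symm.injective.ne hab)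
  refine ⟨k, ?_⟩
  by_contra! hcon
  have := hδ' (show dist (f^[k] a) (f^[k] b) < δ by linarith)
  rw [hsemi, hsemi] at this
  linarith

theorem ncard_circle_pow_eq (hd : d ≠ 0) (u : Circle) :
    {v : Circle | v ^ d = u}.Finite ∧ {v : Circle | v ^ d = u}.ncard = d := by
  obtain ⟨x, rfl⟩ := Circle.exp_surjective u
  have hd' : (d : ℝ) ≠ 0 := by exact_mod_cast hd
  have hpi := Real.pi_pos
  set e : ℕ → Circle := fun j => Circle.exp ((x + j * (2 * Real.pi)) / d) with he
  have hinj : InjOn e (Finset.range d) := by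
    intro j hj k hk hjk
    obtain ⟨m, hm⟩ := Circle.exp_eq_exp.1 hjk
    field_simp at hm
    have h1 : (j : ℝ) - k = d * m := by nlinarith
    have h2 : (j : ℤ) - k = d * m := by exact_mod_cast h1
    simp only [Finset.coe_range, mem_Iio] at hj hk
    have h3 : (d : ℤ) ∣ (j : ℤ) - k := ⟨m, h2⟩
    have h4 := Int.eq_zero_of_abs_lt_dvd h3 (by rw [abs_lt]; constructor <;> omega)
    omega
  have hset : {v : Circle | v ^ d = Circle.exp x} = e '' (Finset.range d : Set ℕ) := by
    ext v
    simp only [mem_ofPred_eq, mem_image, Finset.coe_range, mem_Iio]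
    constructor
    · intro hv
      obtain ⟨y, rfl⟩ := Circle.exp_surjective v
      rw [← Circle.exp_natCast_mul] at hv
      obtain ⟨m, hm⟩ := Circle.exp_eq_exp.1 hv
      have hdpos : (0 : ℤ) < d := by omega
      refine ⟨(m % d).toNat, by have := Int.emod_lt_of_pos m hdpos; omega, ?_⟩
      have h1 : (((m % d).toNat : ℕ) : ℝ) = (m : ℝ) - d * (m / d : ℤ) := by
        have h2 : (((m % d).toNat : ℕ) : ℤ) = m - d * (m / d) := by
          rw [Int.toNat_of_nonneg (Int.emod_nonneg _ hdpos.ne'), Int.emod_def]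
        exact_mod_cast h2
      refine Circle.exp_eq_exp.2 ⟨-(m / d : ℤ), ?_⟩
      rw [h1]
      push_cast
      field_simp
      linarith
    · rintro ⟨j, -, rfl⟩
      simp only [he]
      rw [← Circle.exp_natCast_mul]
      refine Circle.exp_eq_exp.2 ⟨j, ?_⟩
      push_cast
      field_simp
  rw [hset]
  exact ⟨(Finset.finite_toSet _).image _, by rw [hinj.ncard_image, Set.ncard_coe_finset]; simp⟩

theorem ConjugateToPower.isCoveringOfDegree (hd : d ≠ 0) (hf : ConjugateToPower f d) :
    IsCoveringOfDegree f d := by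
  obtain ⟨H, hH⟩ := hf
  have : NeZero d := ⟨hd⟩
  have hfe : f = H ∘ (fun u : Circle => u ^ d) ∘ H.symm := by
    funext u
    simp [hH]
  constructor
  · rw [hfe]
    exact ((Circle.isQuotientCoveringMap_npow d).isCoveringMap.comp_homeomorph
      H.symm).homeomorph_comp H
  · intro z
    have : f ⁻¹' {z} = H '' {v | v ^ d = H.symm z} := by
      ext u
      rw [hfe]
      simp only [mem_preimage, Function.comp_apply, mem_singleton_iff, mem_image, mem_ofPred_eq,
        ← Homeomorph.symm_apply_eq, Homeomorph.symm_symm]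
      constructor
      · intro h
        exact ⟨H.symm u, h, H.apply_symm_apply u⟩
      · rintro ⟨v, hv, rfl⟩
        rw [H.symm_apply_apply, hv]
    rw [this, Set.ncard_image_of_injective _ H.injective]
    exact ⟨(ncard_circle_pow_eq hd _).1.image _, (ncard_circle_pow_eq hd _).2⟩

end Conjugate

/-! ### The lift of the base map to the real line -/

/-- The Cayley transform: with the half-angle tangent as coordinate, circle inversions become
rational maps of the line. -/
theorem coe_circleExp_two_mul_arctan (x : ℝ) :
    (Circle.exp (2 * Real.arctan x) : ℂ) = (1 + x * I) / (1 - x * I) := by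
  have hx : (1 : ℂ) - x * I ≠ 0 := by
    intro h
    have := congrArg Complex.re h
    simp at this
  have hx' : (1 : ℂ) + (x : ℂ) ^ 2 ≠ 0 := by
    have : (1 : ℝ) + x ^ 2 ≠ 0 := by positivity
    exact_mod_cast this
  have hs : (0 : ℝ) < 1 + x ^ 2 := by positivity
  have hcos : Real.cos (2 * Real.arctan x) = (1 - x ^ 2) / (1 + x ^ 2) := by
    rw [Real.cos_two_mul, Real.cos_sq_arctan]
    field_simp
    ring
  have hsin : Real.sin (2 * Real.arctan x) = 2 * x / (1 + x ^ 2) := by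
    rw [Real.sin_two_mul, Real.sin_arctan, Real.cos_arctan]
    have := Real.sq_sqrt hs.le
    field_simp
    rw [this]
  rw [Circle.coe_exp, Complex.exp_mul_I, ← Complex.ofReal_cos, ← Complex.ofReal_sin, hcos, hsin,
    eq_div_iff hx]
  push_cast
  field_simp
  linear_combination (-2 * (x : ℂ) ^ 2) * I_sq

/-- The angle of the reflection of `exp (i t)` in the geodesic with endpoints `exp (± i α)`, up to
its sign. -/
def reflectAngle (α t : ℝ) : ℝ :=
  Real.pi + 2 * Real.arctan (Real.tan (t / 2) / Real.tan (α / 2) ^ 2)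

section

variable {α : ℝ}

theorem tan_half_pos (h0 : 0 < α) (h1 : α < Real.pi / 2) : 0 < Real.tan (α / 2) :=
  Real.tan_pos_of_pos_of_lt_pi_div_two (by linarith) (by linarith [Real.pi_pos])

theorem reflectAngle_right (h0 : 0 < α) (h1 : α < Real.pi / 2) :
    reflectAngle α α = 2 * Real.pi - α := by
  have ht := tan_half_pos h0 h1
  have : Real.tan (α / 2) / Real.tan (α / 2) ^ 2 = (Real.tan (α / 2))⁻¹ := by field_simp
  rw [reflectAngle, this, Real.arctan_inv_of_pos ht,
    Real.arctan_tan (by linarith) (by linarith)]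
  ring

theorem reflectAngle_left (h0 : 0 < α) (h1 : α < Real.pi / 2) : reflectAngle α (-α) = α := by
  have h := reflectAngle_right h0 h1
  rw [reflectAngle] at h ⊢
  rw [neg_div, Real.tan_neg, neg_div, Real.arctan_neg]
  linarith

theorem hasDerivAt_reflectAngle (h1 : α < Real.pi / 2) {t : ℝ} (ht : t ∈ Icc (-α) α) :
    HasDerivAt (reflectAngle α)
      (2 * (1 / (1 + (Real.tan (t / 2) / Real.tan (α / 2) ^ 2) ^ 2) *
        (1 / Real.cos (t / 2) ^ 2 * (1 / 2) / Real.tan (α / 2) ^ 2))) t := by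
  have hc : Real.cos (t / 2) ≠ 0 :=
    (Real.cos_pos_of_mem_Ioo ⟨by linarith [ht.1, Real.pi_pos],
      by linarith [ht.2, Real.pi_pos]⟩).ne'
  have hd := (Real.hasDerivAt_tan hc).comp t ((hasDerivAt_id t).div_const 2)
  exact (((hd.div_const (Real.tan (α / 2) ^ 2)).arctan).const_mul 2).const_add Real.pi

/-- With `τ = tan (α / 2)` and `u = tan (t / 2)`, the slope `τ² (1 + u²) / (τ⁴ + u²)` exceeds `1`
exactly when `(τ² - u²) (1 - τ²) > 0`. At the ends `u = ± τ` it equals `1`: the vertices are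
neutral, and no uniform expansion factor exists. -/
theorem reflectAngle_expanding (h0 : 0 < α) (h1 : α < Real.pi / 2) :
    StrictMonoOn (fun t => reflectAngle α t - t) (Icc (-α) α) := by
  have hderiv : ∀ t ∈ Icc (-α) α, HasDerivAt (fun t => reflectAngle α t - t) _ t := fun t ht =>
    (hasDerivAt_reflectAngle h1 ht).sub (hasDerivAt_id t)
  refine strictMonoOn_of_deriv_pos (convex_Icc _ _)
    (fun t ht => (hderiv t ht).continuousAt.continuousWithinAt) fun t ht => ?_
  rw [interior_Icc] at ht
  rw [(hderiv t ⟨ht.1.le, ht.2.le⟩).deriv]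
  have hτ := tan_half_pos h0 h1
  set τ := Real.tan (α / 2) with hτdef
  set u := Real.tan (t / 2) with hu
  have hτ1 : τ < 1 := by
    have := Real.tan_lt_tan_of_lt_of_lt_pi_div_two (x := α / 2) (y := Real.pi / 4)
      (by linarith) (by linarith) (by linarith)
    rwa [Real.tan_pi_div_four] at this
  have hu1 : u < τ := Real.tan_lt_tan_of_lt_of_lt_pi_div_two (by linarith [ht.1])
    (by linarith) (by linarith [ht.2])
  have hu2 : -τ < u := by
    rw [hτdef, ← Real.tan_neg]
    exact Real.tan_lt_tan_of_lt_of_lt_pi_div_two (by linarith) (by linarith [ht.2])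
      (by linarith [ht.1])
  have hc : Real.cos (t / 2) ≠ 0 :=
    (Real.cos_pos_of_mem_Ioo ⟨by linarith [ht.1], by linarith [ht.2]⟩).ne'
  have hcos : 1 / Real.cos (t / 2) ^ 2 = 1 + u ^ 2 := by
    rw [hu, one_div, ← Real.inv_one_add_tan_sq hc, inv_inv]
  rw [hcos]
  have hpos : 0 < τ ^ 4 + u ^ 2 := by positivity
  have hval : 2 * (1 / (1 + (u / τ ^ 2) ^ 2) * ((1 + u ^ 2) * (1 / 2) / τ ^ 2))
      = τ ^ 2 * (1 + u ^ 2) / (τ ^ 4 + u ^ 2) := by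
    field_simp
  rw [hval, sub_pos, lt_div_iff₀ hpos]
  have h3 : u ^ 2 < τ ^ 2 := sq_lt_sq' hu2 hu1
  have h4 : τ ^ 2 < 1 := by nlinarith
  nlinarith [mul_pos (sub_pos.2 h3) (sub_pos.2 h4)]

theorem strictMono_of_strictMonoOn_Icc {g : ℝ → ℝ} {T : ℝ} (hT : 0 < T)
    (hg : ∀ k : ℤ, StrictMonoOn g (Icc (k * T) ((k + 1) * T))) : StrictMono g := by
  have key : ∀ (k : ℤ) (m : ℕ), StrictMonoOn g (Icc (k * T) ((k + m + 1) * T)) := by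
    intro k m
    induction m with
    | zero => simpa using hg k
    | succ m ih =>
      have h1 := hg (k + m + 1)
      push_cast at h1 ⊢
      have hle : (k : ℝ) * T ≤ (k + m + 1) * T := by
        have : (0 : ℝ) ≤ m := m.cast_nonneg
        nlinarith
      have hle' : ((k : ℝ) + m + 1) * T ≤ (k + m + 1 + 1) * T := by nlinarith
      have := ih.union h1 (isGreatest_Icc hle) (isLeast_Icc hle')
      rw [Icc_union_Icc_eq_Icc hle hle'] at this
      rwa [← add_assoc]
  intro x y hxy
  obtain ⟨m, hm⟩ := exists_nat_gt ((y - x) / T)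
  rw [div_lt_iff₀ hT] at hm
  have h1 : (⌊x / T⌋ : ℝ) * T ≤ x := by
    rw [← le_div_iff₀ hT]
    exact Int.floor_le _
  have h2 : x < (⌊x / T⌋ + 1) * T := by
    rw [← div_lt_iff₀ hT]
    exact Int.lt_floor_add_one _
  have hm0 : (0 : ℝ) ≤ m := m.cast_nonneg
  exact key ⌊x / T⌋ m ⟨h1, by nlinarith⟩ ⟨by linarith, by nlinarith⟩ hxy

/-- Crossing one side, of angular width `2 * α`, the map sweeps out the complementary arc, of length
`2 * π - 2 * α`. Translates of this one branch therefore fit together into a map of the whole line.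
-/
theorem exists_baseLift (h0 : 0 < α) (h1 : α < Real.pi / 2) :
    ∃ F : ℝ → ℝ, Continuous F ∧ (∀ x, F (x + 2 * α) = F x + (2 * Real.pi - 2 * α)) ∧
      (∀ t ∈ Icc (-α) α, F (t + α) = reflectAngle α t - α) ∧
      ∀ x y, x < y → y - x < F y - F x := by
  have hT : 0 < 2 * α := by linarith
  have : Fact (0 < 2 * α) := ⟨hT⟩
  -- The mean slope of the lift. Subtracting `c * t` makes the branch vanish at both ends of a
  -- period, so the remainder descends to a continuous function on the circle of length `2 * α`.
  set c : ℝ := Real.pi / α - 1 with hc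
  have hcα : c * (2 * α) = 2 * Real.pi - 2 * α := by
    rw [hc]
    field_simp
  set g : ℝ → ℝ := fun t => reflectAngle α (t - α) - α - c * t with hg
  have hg0 : g 0 = 0 := by
    simp only [hg, zero_sub, reflectAngle_left h0 h1]
    ring
  have hg1 : g (2 * α) = 0 := by
    simp only [hg]
    rw [show 2 * α - α = α by ring, reflectAngle_right h0 h1, hcα]
    ring
  have hgc : ContinuousOn g (Icc 0 (2 * α)) := by
    intro t ht
    have h2 : ContinuousAt (reflectAngle α) (t - α) :=
      (hasDerivAt_reflectAngle h1 ⟨by linarith [ht.1], by linarith [ht.2]⟩).continuousAt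
    have h3 : ContinuousAt (fun t => reflectAngle α (t - α)) t :=
      ContinuousAt.comp (f := fun t => t - α) h2 (by fun_prop)
    exact ((h3.sub continuousAt_const).sub (by fun_prop)).continuousWithinAt
  set G : AddCircle (2 * α) → ℝ := AddCircle.liftIco (2 * α) 0 g with hG
  have hGc : Continuous G := AddCircle.liftIco_zero_continuous (hg0.trans hg1.symm) hgc
  set F : ℝ → ℝ := fun x => c * x + G x with hF
  have hper : ∀ x, F (x + 2 * α) = F x + (2 * Real.pi - 2 * α) := by
    intro x
    simp only [hF, AddCircle.coe_add_period, mul_add, hcα]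
    ring
  have hform : ∀ t ∈ Icc (-α) α, F (t + α) = reflectAngle α t - α := by
    intro t ht
    have : G ((t + α : ℝ) : AddCircle (2 * α)) = g (t + α) := by
      rcases ht.2.lt_or_eq with hlt | heq
      · exact AddCircle.liftIco_zero_coe_apply ⟨by linarith [ht.1], by linarith⟩
      · rw [heq, ← two_mul, hg1, AddCircle.coe_period, ← hg0]
        exact AddCircle.liftIco_zero_coe_apply ⟨le_rfl, hT⟩
    simp only [hF]
    rw [this]
    simp only [hg, add_sub_cancel_right]
    ring
  refine ⟨F, by fun_prop, hper, hform, ?_⟩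
  have hmono : StrictMono fun x => F x - x := by
    refine strictMono_of_strictMonoOn_Icc hT fun k => ?_
    have hk : ∀ x, F (x + k * (2 * α)) = F x + k * (2 * Real.pi - 2 * α) := by
      have hp : Function.Periodic (fun x => F x - c * x) (2 * α) := by
        intro x
        simp only [hper, mul_add, hcα]
        ring
      intro x
      have := hp.int_mul k x
      have h4 : c * (x + k * (2 * α)) = c * x + k * (2 * Real.pi - 2 * α) := by
        rw [← hcα]; ring
      linarith
    have hval : ∀ x ∈ Icc (k * (2 * α)) ((k + 1) * (2 * α)),
        F x - x = (reflectAngle α (x - k * (2 * α) - α) - (x - k * (2 * α) - α)) - α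
          + k * (2 * Real.pi - 2 * α) - (k * (2 * α) + α) := by
      intro x hx
      have h2 := hk (x - k * (2 * α))
      have h3 := hform (x - k * (2 * α) - α) ⟨by linarith [hx.1], by linarith [hx.2]⟩
      rw [sub_add_cancel] at h2 h3
      rw [h2, h3]
      ring
    intro x hx y hy hxy
    have h2 := reflectAngle_expanding h0 h1
      (show x - k * (2 * α) - α ∈ _ from ⟨by linarith [hx.1], by linarith [hx.2]⟩)
      (show y - k * (2 * α) - α ∈ _ from ⟨by linarith [hy.1], by linarith [hy.2]⟩)
      (by linarith)
    simp only at h2 ⊢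
    rw [hval x hx, hval y hy]
    linarith
  intro x y hxy
  have := hmono hxy
  simp only at this
  linarith

/-- Reflection of a point of the circle in the geodesic with midpoint angle `m` and half-width
`α`. -/
theorem inversion_circleExp (h0 : 0 < α) (h1 : α < Real.pi / 2) (m : ℝ) {t : ℝ}
    (ht : t ∈ Icc (-α) α) {c : ℂ} (hc : c = Circle.exp m / Real.cos α) :
    EuclideanGeometry.inversion c (orthRadius c) (Circle.exp (m + t) : ℂ) =
      Circle.exp (m - reflectAngle α t) := by
  have hτ := tan_half_pos h0 h1
  have hcα : 0 < Real.cos α := Real.cos_pos_of_mem_Ioo ⟨by linarith, h1⟩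
  have hcα1 : Real.cos α < 1 := by
    have := Real.cos_lt_cos_of_nonneg_of_le_pi_div_two le_rfl h1.le h0
    rwa [Real.cos_zero] at this
  have hn : ‖c‖ = 1 / Real.cos α := by
    rw [hc, norm_div, Circle.norm_coe, Complex.norm_real, Real.norm_of_nonneg hcα.le]
  have hc1 : 1 < ‖c‖ := by
    rw [hn]
    exact (one_lt_div hcα).2 hcα1
  have hconj : ∀ u : Circle, (starRingEnd ℂ) (u : ℂ) = (u : ℂ)⁻¹ := fun u => by
    rw [← Circle.coe_inv_eq_conj, Circle.coe_inv]
  set U : ℂ := ((Circle.exp m : Circle) : ℂ) with hU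
  have hU0 : U ≠ 0 := Circle.coe_ne_zero _
  set k : ℂ := ((Real.cos α : ℝ) : ℂ) with hk
  have hk0 : k ≠ 0 := by
    rw [hk]
    exact_mod_cast hcα.ne'
  have hzc : (Circle.exp (m + t) : ℂ) ≠ c := by
    intro h
    rw [← h, Circle.norm_coe] at hc1
    exact lt_irrefl _ hc1
  -- the inversion as an antiholomorphic map
  have hinv : EuclideanGeometry.inversion c (orthRadius c) (Circle.exp (m + t) : ℂ) =
      c + ((‖c‖ ^ 2 - 1 : ℝ) : ℂ) / (starRingEnd ℂ) ((Circle.exp (m + t) : ℂ) - c) := by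
    simp only [EuclideanGeometry.inversion, vsub_eq_sub, vadd_eq_add, div_pow, orthRadius_sq hc1,
      dist_eq_norm]
    have hw : (Circle.exp (m + t) : ℂ) - c ≠ 0 := sub_ne_zero.2 hzc
    set w := (Circle.exp (m + t) : ℂ) - c
    have hw' : (starRingEnd ℂ) w ≠ 0 := (map_ne_zero _).2 hw
    have h2 : ((‖w‖ : ℝ) : ℂ) ^ 2 = w * (starRingEnd ℂ) w := by
      rw [Complex.mul_conj, Complex.normSq_eq_norm_sq]
      push_cast
      rfl
    rw [add_comm, Complex.real_smul]
    push_cast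
    rw [h2]
    field_simp
  set τ : ℝ := Real.tan (α / 2) with hτd
  set T : ℝ := Real.tan (t / 2) with hTd
  have hz : (Circle.exp t : ℂ) = (1 + T * I) / (1 - T * I) := by
    rw [← coe_circleExp_two_mul_arctan, hTd,
      Real.arctan_tan (by linarith [ht.1]) (by linarith [ht.2])]
    congr 2
    ring
  have hkτ : k = (1 - τ ^ 2) / (1 + τ ^ 2) := by
    have h2 : Real.cos α = (1 - τ ^ 2) / (1 + τ ^ 2) := by
      have h3 : Real.cos (α / 2) ≠ 0 :=
        (Real.cos_pos_of_mem_Ioo ⟨by linarith, by linarith⟩).ne'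
      have h4 : Real.cos α = 2 * Real.cos (α / 2) ^ 2 - 1 := by
        rw [← Real.cos_two_mul]
        congr 1
        ring
      rw [h4, ← Real.inv_one_add_tan_sq h3]
      field_simp
      ring
    rw [hk, h2]
    push_cast
    ring
  -- The reflection sends the half-angle tangent `T` to `τ² / T`. The summand `π` in `reflectAngle`
  -- selects the branch of the angle that remains continuous through `T = 0`.
  have hr : (Circle.exp (-reflectAngle α t) : ℂ) = -((τ ^ 2 - T * I) / (τ ^ 2 + T * I)) := by
    have h2 : -reflectAngle α t = 2 * Real.arctan (-(T / τ ^ 2)) + -Real.pi := by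
      rw [reflectAngle, Real.arctan_neg]
      ring
    have h3 : (Circle.exp (-Real.pi) : ℂ) = -1 := by
      rw [Circle.exp_neg, Circle.coe_inv, Circle.coe_exp, Complex.exp_pi_mul_I]
      norm_num
    have hτc : (τ : ℂ) ≠ 0 := by exact_mod_cast hτ.ne'
    rw [h2, Circle.exp_add, Circle.coe_mul, h3, coe_circleExp_two_mul_arctan]
    push_cast
    have h5 : (1 : ℂ) + -(T / (τ : ℂ) ^ 2) * I = (τ ^ 2 - T * I) / τ ^ 2 := by
      field_simp
      ring
    have h6 : (1 : ℂ) - -(T / (τ : ℂ) ^ 2) * I = (τ ^ 2 + T * I) / τ ^ 2 := by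
      field_simp
      ring
    rw [h5, h6, div_div_div_cancel_right₀ (pow_ne_zero 2 hτc)]
    ring
  have hden1 : (1 : ℂ) - T * I ≠ 0 := by
    intro h
    have := congrArg Complex.re h
    simp at this
  have hden1' : (1 : ℂ) + T * I ≠ 0 := by
    intro h
    have := congrArg Complex.re h
    simp at this
  have hden2 : (τ : ℂ) ^ 2 + T * I ≠ 0 := by
    intro h
    have h2 := congrArg Complex.re h
    simp [← Complex.ofReal_pow] at h2
    exact hτ.ne' h2
  have hden3 : (1 : ℂ) + τ ^ 2 ≠ 0 := by
    have : (1 : ℝ) + τ ^ 2 ≠ 0 := by positivity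
    exact_mod_cast this
  have hnum : (1 : ℂ) - τ ^ 2 ≠ 0 := by
    intro h
    rw [h, zero_div] at hkτ
    exact hk0 hkτ
  have hnc : ((‖c‖ ^ 2 - 1 : ℝ) : ℂ) = 1 / k ^ 2 - 1 := by
    rw [hn, ofReal_sub, ofReal_pow, ofReal_div, ofReal_one, ← hk, div_pow, one_pow]
  have hzk : (Circle.exp t : ℂ)⁻¹ - 1 / k ≠ 0 := by
    intro h
    apply hzc
    have h2 : (Circle.exp (-t) : ℂ) = 1 / k := by
      rw [Circle.exp_neg, Circle.coe_inv]
      exact sub_eq_zero.1 h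
    have h3 := congrArg (fun x : ℂ => ‖x‖) h2
    simp only [Circle.norm_coe] at h3
    have : ‖c‖ = 1 := by
      rw [hc, norm_div, hU, Circle.norm_coe, ← norm_one (α := ℂ), ← norm_div, ← h3, norm_one]
    linarith
  have hconjsub : (starRingEnd ℂ) ((Circle.exp (m + t) : ℂ) - c)
      = U⁻¹ * ((Circle.exp t : ℂ)⁻¹ - 1 / k) := by
    rw [map_sub, hconj, hc, map_div₀, hconj, Complex.conj_ofReal, Circle.exp_add, Circle.coe_mul,
      mul_inv]
    ring
  rw [hinv, hconjsub, hnc, sub_eq_add_neg m, Circle.exp_add, Circle.coe_mul, hr, hc]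
  have hmain : 1 / k + (1 / k ^ 2 - 1) / ((Circle.exp t : ℂ)⁻¹ - 1 / k)
      = -((τ ^ 2 - T * I) / (τ ^ 2 + T * I)) := by
    have h2 : (Circle.exp t : ℂ)⁻¹ - 1 / k =
        (-2) * (τ ^ 2 + T * I) / ((1 - τ ^ 2) * (1 + T * I)) := by
      rw [hz, hkτ]
      field_simp
      ring
    rw [h2, hkτ]
    field_simp
    ring_nf
  rw [← hmain, ← hU, mul_add, div_mul_eq_div_div, div_inv_eq_mul]
  ring

end

/-! ### Geometry of the base polygon -/

/-- Half of the angle that a side of `Π` subtends at the origin. -/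
def halfAngle (n p : ℕ) : ℝ := Real.pi / (n * p)

/-- The angle of the midpoint of the `k`-th arc. -/
def midAngle (n p k : ℕ) : ℝ := (2 * k + 1) * halfAngle n p

/-- A function that is negative on the open half-plane of the `k`-th side, and vanishes on this
side. -/
def sideFun (n p k : ℕ) (z : ℂ) : ℝ :=
  Real.cos (halfAngle n p) * (1 + ‖z‖ ^ 2) -
    2 * (z * (starRingEnd ℂ) (Circle.exp (midAngle n p k) : ℂ)).re

section

variable {n p : ℕ}

theorem halfAngle_pos (h : 3 ≤ n * p) : 0 < halfAngle n p := by
  have h3 : (3 : ℝ) ≤ n * p := by exact_mod_cast h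
  exact div_pos Real.pi_pos (by linarith)

theorem halfAngle_lt (h : 3 ≤ n * p) : halfAngle n p < Real.pi / 2 := by
  have h3 : (3 : ℝ) ≤ n * p := by exact_mod_cast h
  exact div_lt_div_of_pos_left Real.pi_pos (by norm_num) (by linarith)

theorem cos_halfAngle_pos (h : 3 ≤ n * p) : 0 < Real.cos (halfAngle n p) :=
  Real.cos_pos_of_mem_Ioo ⟨by linarith [halfAngle_pos h, Real.pi_pos], halfAngle_lt h⟩

theorem natCast_left_ne_zero (h : 3 ≤ n * p) : (n : ℝ) ≠ 0 := by
  rintro h0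
  have : n = 0 := by exact_mod_cast h0
  subst this
  omega

theorem natCast_right_ne_zero (h : 3 ≤ n * p) : (p : ℝ) ≠ 0 := by
  rintro h0
  have : p = 0 := by exact_mod_cast h0
  subst this
  omega

theorem halfAngle_mul (h : 3 ≤ n * p) : halfAngle n p * (n * p) = Real.pi := by
  have := natCast_left_ne_zero h
  have := natCast_right_ne_zero h
  rw [halfAngle]
  field_simp

theorem two_pi_div_eq (h : 3 ≤ n * p) : 2 * Real.pi / n = 2 * halfAngle n p * p := by
  have := natCast_left_ne_zero h
  have := natCast_right_ne_zero h
  rw [halfAngle]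
  field_simp

theorem center_eq (h : 3 ≤ n * p) (r : Fin n) (s : Fin p) :
    center n p r s = Circle.exp (midAngle n p (r * p + s)) / Real.cos (halfAngle n p) := by
  have := natCast_left_ne_zero h
  have := natCast_right_ne_zero h
  rw [center, midAngle, halfAngle]
  congr 3
  push_cast
  field_simp
  ring

theorem norm_center (h : 3 ≤ n * p) (r : Fin n) (s : Fin p) :
    ‖center n p r s‖ = 1 / Real.cos (halfAngle n p) := by
  rw [center_eq h, norm_div, Circle.norm_coe, Complex.norm_real,
    Real.norm_of_nonneg (cos_halfAngle_pos h).le]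

theorem orthRadius_center_eq (h : 3 ≤ n * p) (r r' : Fin n) (s s' : Fin p) :
    orthRadius (center n p r s) = orthRadius (center n p r' s') := by
  rw [orthRadius, orthRadius, norm_center h, norm_center h]

theorem orthRadius_center_pos (h : 3 ≤ n * p) (r : Fin n) (s : Fin p) :
    0 < orthRadius (center n p r s) :=
  lt_of_le_of_ne (Real.sqrt_nonneg _) (orthRadius_ne (one_lt_norm_center h r s)).symm

/-- The power of `z` with respect to the circle: orthogonality gives `R² = ‖c‖² - 1`, and the factor
`cos` clears the denominator of the centre. -/
theorem norm_sub_center_sq (h : 3 ≤ n * p) (r : Fin n) (s : Fin p) (z : ℂ) :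
    ‖z - center n p r s‖ ^ 2 = orthRadius (center n p r s) ^ 2 +
      sideFun n p (r * p + s) z / Real.cos (halfAngle n p) := by
  have hc := (cos_halfAngle_pos h).ne'
  have h1 : ‖z - center n p r s‖ ^ 2 =
      ‖z‖ ^ 2 + ‖center n p r s‖ ^ 2 - 2 * (z * (starRingEnd ℂ) (center n p r s)).re := by
    simp only [Complex.sq_norm, Complex.normSq_sub]
  rw [h1, orthRadius_sq (one_lt_norm_center h r s), sideFun]
  nth_rewrite 2 [center_eq h]
  rw [map_div₀, Complex.conj_ofReal, mul_div_assoc', Complex.div_ofReal_re]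
  field_simp
  ring

theorem norm_sub_center_le_iff (h : 3 ≤ n * p) (r : Fin n) (s : Fin p) (z : ℂ) :
    ‖z - center n p r s‖ ≤ orthRadius (center n p r s) ↔ sideFun n p (r * p + s) z ≤ 0 := by
  rw [← sq_le_sq₀ (norm_nonneg _) (orthRadius_center_pos h r s).le, norm_sub_center_sq h,
    add_le_iff_nonpos_right]
  rw [div_le_iff₀ (cos_halfAngle_pos h), zero_mul]

theorem norm_sub_center_lt_iff (h : 3 ≤ n * p) (r : Fin n) (s : Fin p) (z : ℂ) :
    ‖z - center n p r s‖ < orthRadius (center n p r s) ↔ sideFun n p (r * p + s) z < 0 := by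
  rw [← sq_lt_sq₀ (norm_nonneg _) (orthRadius_center_pos h r s).le, norm_sub_center_sq h,
    add_lt_iff_neg_left]
  rw [div_lt_iff₀ (cos_halfAngle_pos h), zero_mul]

theorem sideFun_circle (k : ℕ) (t : ℝ) :
    sideFun n p k (Circle.exp (midAngle n p k + t)) =
      2 * (Real.cos (halfAngle n p) - Real.cos t) := by
  have : ((Circle.exp (midAngle n p k + t) : Circle) : ℂ) *
      (starRingEnd ℂ) (Circle.exp (midAngle n p k) : ℂ) = Circle.exp t := by
    rw [← Circle.coe_inv_eq_conj, Circle.coe_inv, Circle.exp_add, Circle.coe_mul]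
    field_simp [Circle.coe_ne_zero]
  rw [sideFun, this, Circle.norm_coe, Circle.coe_exp, Complex.exp_ofReal_mul_I_re]
  ring

/-- A point of a closed half-plane lies in the sector of the arc, and in its interior unless it
lies on the circle. -/
theorem exists_angle_of_sideFun_nonpos (h : 3 ≤ n * p) {k : ℕ} {z : ℂ}
    (hz : sideFun n p k z ≤ 0) :
    ∃ t, |t| ≤ halfAngle n p ∧ z = ‖z‖ * Circle.exp (midAngle n p k + t) ∧ 0 < ‖z‖ ∧
      (|t| = halfAngle n p → ‖z‖ = 1) := by
  have hcα := cos_halfAngle_pos h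
  set v : ℂ := z * (starRingEnd ℂ) (Circle.exp (midAngle n p k) : ℂ) with hv
  have hvn : ‖v‖ = ‖z‖ := by
    rw [hv, norm_mul, RCLike.norm_conj, Circle.norm_coe, mul_one]
  have hzv : z = v * Circle.exp (midAngle n p k) := by
    rw [hv, mul_assoc, mul_comm ((starRingEnd ℂ) _), Complex.mul_conj, Circle.normSq_coe]
    simp
  have hre : v.re = ‖z‖ * Real.cos (arg v) := by
    rw [← hvn, Complex.norm_mul_cos_arg]
  rw [sideFun, ← hv, hre] at hz
  have hpos : 0 < ‖z‖ := by
    rcases (norm_nonneg z).lt_or_eq with h1 | h1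
    · exact h1
    · rw [← h1] at hz
      norm_num at hz
      linarith
  -- From `1 + ‖z‖² ≥ 2 ‖z‖`, a point of the half-plane has `cos (arg v)` at least `cos α`. In the
  -- boundary case the inequality becomes an equality, which forces `‖z‖ = 1`.
  have hcos : Real.cos (halfAngle n p) ≤ Real.cos |arg v| := by
    rw [Real.cos_abs]
    by_contra! hcon
    nlinarith [sq_nonneg (‖z‖ - 1)]
  refine ⟨arg v, ?_, ?_, hpos, fun heq => ?_⟩
  · by_contra! hcon
    exact absurd hcos (not_le.2 (Real.cos_lt_cos_of_nonneg_of_le_pi (halfAngle_pos h).le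
      (Complex.abs_arg_le_pi v) hcon))
  · conv_lhs => rw [hzv, ← Complex.norm_mul_exp_arg_mul_I v, hvn]
    rw [Circle.exp_add, Circle.coe_mul, Circle.coe_exp (arg v)]
    ring
  · rw [← Real.cos_abs (arg v), heq] at hz
    have : (1 - ‖z‖) ^ 2 ≤ 0 := by nlinarith
    have := pow_eq_zero_iff (two_ne_zero) |>.1 (le_antisymm this (sq_nonneg _))
    linarith

theorem Fin.eq_of_mul_add_eq {r r' : Fin n} {s s' : Fin p}
    (he : (r : ℕ) * p + s = r' * p + s') : r = r' ∧ s = s' := by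
  have hp : 0 < p := s.pos
  have h1 : (r : ℕ) = r' := by
    have := congrArg (· / p) he
    simpa [Nat.add_div_of_dvd_right, Nat.mul_div_cancel _ hp, Nat.div_eq_of_lt s.2,
      Nat.div_eq_of_lt s'.2] using this
  refine ⟨Fin.ext h1, Fin.ext ?_⟩
  rw [h1] at he
  omega

theorem mul_add_lt (r : Fin n) (s : Fin p) : (r : ℕ) * p + s < n * p := by
  have h1 := r.2
  have h2 := s.2
  calc (r : ℕ) * p + s < r * p + p := by omega
    _ = (r + 1) * p := by ring
    _ ≤ n * p := Nat.mul_le_mul_right p h1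

theorem mem_halfPlane_iff (h : 3 ≤ n * p) (r : Fin n) (s : Fin p) (z : Disk) :
    z ∈ halfPlane n p r s ↔ sideFun n p (r * p + s) z ≤ 0 :=
  norm_sub_center_le_iff h r s z

theorem endAngle_eq (h : 3 ≤ n * p) (r : Fin n) (s : Fin p) :
    2 * Real.pi * r / n + 2 * Real.pi * (s + 1) / (n * p) =
      midAngle n p (r * p + s) + halfAngle n p := by
  have := natCast_left_ne_zero h
  have := natCast_right_ne_zero h
  rw [midAngle, halfAngle]
  push_cast
  field_simp
  ring

theorem exists_angle_of_mem_piece (h : 3 ≤ n * p) {r : Fin n} {s : Fin p} {z : Disk}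
    (hz : z ∈ piece n p r s) :
    ∃ θ ∈ Ico (2 * halfAngle n p * ((r : ℕ) * p + s : ℕ))
      (2 * halfAngle n p * (((r : ℕ) * p + s : ℕ) + 1)),
      (z : ℂ) = ‖(z : ℂ)‖ * Circle.exp θ ∧ 0 < ‖(z : ℂ)‖ := by
  obtain ⟨t, ht, hzt, hpos, hone⟩ :=
    exists_angle_of_sideFun_nonpos h ((mem_halfPlane_iff h r s z).1 hz.1)
  rw [abs_le] at ht
  refine ⟨midAngle n p (r * p + s) + t, ⟨?_, ?_⟩, hzt, hpos⟩
  · rw [midAngle]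
    linarith
  · have hne : t ≠ halfAngle n p := by
      intro heq
      apply hz.2
      rw [mem_singleton_iff, endAngle_eq h, ← heq]
      have h1 := hone (by rw [heq, abs_of_pos (halfAngle_pos h)])
      rw [h1] at hzt
      ext
      rw [hzt, bdry]
      simp
    have := lt_of_le_of_ne ht.2 hne
    rw [midAngle]
    linarith

/-- Dropping the counter-clockwise endpoint puts each piece into a half-open sector, and these
sectors are disjoint. -/
theorem index_eq_of_mem_piece (h : 3 ≤ n * p) {r r' : Fin n} {s s' : Fin p} {z : Disk}
    (hz : z ∈ piece n p r s) (hz' : z ∈ piece n p r' s') : r = r' ∧ s = s' := by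
  obtain ⟨θ, hθ, hzθ, hpos⟩ := exists_angle_of_mem_piece h hz
  obtain ⟨θ', hθ', hzθ', -⟩ := exists_angle_of_mem_piece h hz'
  have hα := halfAngle_pos h
  have hsub : ∀ (r : Fin n) (s : Fin p), Ico (2 * halfAngle n p * ((r : ℕ) * p + s : ℕ))
      (2 * halfAngle n p * (((r : ℕ) * p + s : ℕ) + 1)) ⊆ Ico 0 (2 * Real.pi) := by
    intro r s x hx
    have h1 : (((r : ℕ) * p + s : ℕ) : ℝ) + 1 ≤ n * p := by exact_mod_cast mul_add_lt r s
    have h2 := halfAngle_mul h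
    have h3 := mul_le_mul_of_nonneg_left h1 (by linarith : 0 ≤ 2 * halfAngle n p)
    exact ⟨le_trans (by positivity) hx.1, by linarith [hx.2]⟩
  have heq : θ = θ' := by
    have h1 : (Circle.exp θ : ℂ) = Circle.exp θ' := by
      have h2 : ((‖(z : ℂ)‖ : ℝ) : ℂ) ≠ 0 := by exact_mod_cast hpos.ne'
      exact mul_left_cancel₀ h2 (hzθ.symm.trans hzθ')
    exact Circle.exp_injOn_Ico (by linarith) (hsub _ _ hθ) (hsub _ _ hθ') (Circle.ext h1)
  subst heq
  apply Fin.eq_of_mul_add_eq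
  have h1 : (((r : ℕ) * p + s : ℕ) : ℝ) < ((r' : ℕ) * p + s' : ℕ) + 1 :=
    lt_of_mul_lt_mul_left (hθ.1.trans_lt hθ'.2) (by linarith)
  have h2 : (((r' : ℕ) * p + s' : ℕ) : ℝ) < ((r : ℕ) * p + s : ℕ) + 1 :=
    lt_of_mul_lt_mul_left (hθ'.1.trans_lt hθ.2) (by linarith)
  have h3 : (r : ℕ) * p + s < (r' : ℕ) * p + s' + 1 := by exact_mod_cast h1
  have h4 : (r' : ℕ) * p + s' < (r : ℕ) * p + s + 1 := by exact_mod_cast h2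
  omega

theorem bdry_mem_halfPlane (h : 3 ≤ n * p) {r : Fin n} {s : Fin p} {θ : ℝ}
    (hθ : θ ∈ Icc (2 * halfAngle n p * ((r : ℕ) * p + s : ℕ))
      (2 * halfAngle n p * (((r : ℕ) * p + s : ℕ) + 1))) :
    bdry (Circle.exp θ) ∈ halfPlane n p r s := by
  rw [mem_halfPlane_iff h]
  have h1 := sideFun_circle (n := n) (p := p) (r * p + s) (θ - midAngle n p (r * p + s))
  rw [add_sub_cancel] at h1
  change sideFun n p (r * p + s) (Circle.exp θ : ℂ) ≤ 0
  rw [h1]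
  have h2 : |θ - midAngle n p (r * p + s)| ≤ halfAngle n p := by
    rw [abs_le, midAngle]
    constructor <;> linarith [hθ.1, hθ.2]
  rw [← Real.cos_abs (θ - _)]
  have := Real.cos_le_cos_of_nonneg_of_le_pi (abs_nonneg _)
    (by linarith [halfAngle_lt h, Real.pi_pos]) h2
  linarith

theorem bdry_mem_piece (h : 3 ≤ n * p) {r : Fin n} {s : Fin p} {θ : ℝ}
    (hθ : θ ∈ Ico (2 * halfAngle n p * ((r : ℕ) * p + s : ℕ))
      (2 * halfAngle n p * (((r : ℕ) * p + s : ℕ) + 1))) :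
    bdry (Circle.exp θ) ∈ piece n p r s := by
  refine ⟨bdry_mem_halfPlane h ⟨hθ.1, hθ.2.le⟩, fun heq => ?_⟩
  rw [mem_singleton_iff, endAngle_eq h] at heq
  have h1 : Circle.exp θ = Circle.exp (midAngle n p (r * p + s) + halfAngle n p) :=
    Circle.ext (congrArg (fun x : Disk => (x : ℂ)) heq)
  have hα := halfAngle_pos h
  have hα' := halfAngle_lt h
  have h2 := Circle.exp_injOn_Icc (a := 2 * halfAngle n p * ((r : ℕ) * p + s : ℕ))
    (b := 2 * halfAngle n p * (((r : ℕ) * p + s : ℕ) + 1)) (by linarith) ⟨hθ.1, hθ.2.le⟩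
    (by rw [midAngle]; constructor <;> linarith) h1
  have h3 := hθ.2
  rw [h2, midAngle] at h3
  linarith

theorem exists_piece_of_norm_eq_one (h : 3 ≤ n * p) {z : Disk} (hz : ‖(z : ℂ)‖ = 1) :
    ∃ r s, z ∈ piece n p r s := by
  have hα := halfAngle_pos h
  obtain ⟨θ₀, hθ₀⟩ := Circle.exp_surjective ⟨(z : ℂ), mem_sphere_zero_iff_norm.2 hz⟩
  obtain ⟨θ, hθ, hθθ⟩ := Circle.periodic_exp.exists_mem_Ico₀ Real.two_pi_pos θ₀
  have hzθ : z = bdry (Circle.exp θ) := by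
    rw [← hθθ, hθ₀]
    rfl
  set k := ⌊θ / (2 * halfAngle n p)⌋₊ with hk
  have h0 : 0 ≤ θ / (2 * halfAngle n p) := div_nonneg hθ.1 (by linarith)
  have h1 : 2 * halfAngle n p * k ≤ θ := by
    rw [mul_comm, ← le_div_iff₀ (by linarith)]
    exact Nat.floor_le h0
  have h2 : θ < 2 * halfAngle n p * (k + 1) := by
    rw [mul_comm, ← div_lt_iff₀ (by linarith)]
    exact Nat.lt_floor_add_one _
  have h3 : k < n * p := by
    have h4 : 2 * halfAngle n p * k < 2 * halfAngle n p * (n * p) := by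
      linarith [halfAngle_mul h, hθ.2]
    have := lt_of_mul_lt_mul_left h4 (by linarith)
    exact_mod_cast this
  have hp : 0 < p := Nat.pos_of_ne_zero (by rintro rfl; omega)
  refine ⟨⟨k / p, (Nat.div_lt_iff_lt_mul hp).2 h3⟩, ⟨k % p, Nat.mod_lt _ hp⟩, ?_⟩
  rw [hzθ]
  apply bdry_mem_piece h
  rw [show k / p * p + k % p = k by rw [mul_comm]; exact Nat.div_add_mod k p]
  exact ⟨h1, h2⟩

theorem mem_piece_of_norm_lt {r : Fin n} {s : Fin p} {z : Disk}
    (hz : z ∈ halfPlane n p r s) (hz1 : ‖(z : ℂ)‖ < 1) : z ∈ piece n p r s := by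
  refine ⟨hz, fun heq => ?_⟩
  rw [mem_singleton_iff] at heq
  rw [heq, bdry, Circle.norm_coe] at hz1
  exact lt_irrefl _ hz1

theorem exists_piece_of_mem_halfPlane (h : 3 ≤ n * p) {r : Fin n} {s : Fin p} {z : Disk}
    (hz : z ∈ halfPlane n p r s) : ∃ r s, z ∈ piece n p r s := by
  rcases z.norm_le.lt_or_eq with h1 | h1
  · exact ⟨r, s, mem_piece_of_norm_lt hz h1⟩
  · exact exists_piece_of_norm_eq_one h h1

theorem isOpen_polygonInterior :
    IsOpen {z : ℂ | ‖z‖ < 1 ∧ ∀ r s, orthRadius (center n p r s) < ‖z - center n p r s‖} := by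
  have : {z : ℂ | ‖z‖ < 1 ∧ ∀ r s, orthRadius (center n p r s) < ‖z - center n p r s‖} =
      {z : ℂ | ‖z‖ < 1} ∩ ⋂ r, ⋂ s, {z | orthRadius (center n p r s) < ‖z - center n p r s‖} := by
    ext z
    simp
  rw [this]
  refine (isOpen_lt (by fun_prop) (by fun_prop)).inter ?_
  exact isOpen_iInter_of_finite fun r => isOpen_iInter_of_finite fun s =>
    isOpen_lt (by fun_prop) (by fun_prop)

theorem interior_polygon (h : 3 ≤ n * p) :
    interior (polygon n p) =
      {z : ℂ | ‖z‖ < 1 ∧ ∀ r s, orthRadius (center n p r s) < ‖z - center n p r s‖} := by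
  apply Subset.antisymm
  · intro z hz
    refine ⟨(interior_subset hz).1, fun r s => ?_⟩
    set c := center n p r s with hc
    have hRpos := orthRadius_center_pos h r s
    have hle : orthRadius c ≤ ‖z - c‖ := (interior_subset hz).2 r s
    refine lt_of_le_of_ne hle fun heq => ?_
    -- points moved towards the centre leave the polygon
    have hcont : Tendsto (fun t : ℝ => c + t * (z - c)) (𝓝[<] 1) (𝓝 z) := by
      have : Tendsto (fun t : ℝ => c + t * (z - c)) (𝓝 1) (𝓝 (c + (1 : ℝ) * (z - c))) :=
        Continuous.tendsto (by fun_prop) 1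
      rw [ofReal_one, one_mul, add_sub_cancel] at this
      exact this.mono_left nhdsWithin_le_nhds
    have hev := hcont.eventually (mem_interior_iff_mem_nhds.1 hz)
    have hev2 : ∀ᶠ t : ℝ in 𝓝[<] 1, t ∈ Ioo 0 1 := Ioo_mem_nhdsLT one_pos
    obtain ⟨t, ht, ht'⟩ := (hev.and hev2).exists
    have h1 := ht.2 r s
    rw [← hc, add_sub_cancel_left, norm_mul, Complex.norm_real, Real.norm_of_nonneg ht'.1.le,
      ← heq] at h1
    nlinarith [ht'.2]
  · refine interior_maximal (fun z hz => ⟨hz.1, fun r s => (hz.2 r s).le⟩) isOpen_polygonInterior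

theorem mem_baseDomain_iff (h : 3 ≤ n * p) (z : Disk) :
    z ∈ baseDomain n p ↔ ∃ r s, z ∈ piece n p r s := by
  have hiff : z ∈ baseDomain n p ↔ ¬ (‖(z : ℂ)‖ < 1 ∧
      ∀ r s, orthRadius (center n p r s) < ‖(z : ℂ) - center n p r s‖) := by
    rw [← mem_ofPred_eq (p := fun z : ℂ => ‖z‖ < 1 ∧
      ∀ r s, orthRadius (center n p r s) < ‖z - center n p r s‖), ← interior_polygon h]
    rfl
  rw [hiff]
  constructor
  · intro hz
    by_cases h1 : ‖(z : ℂ)‖ < 1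
    · by_contra hcon
      refine hz ⟨h1, fun r s => ?_⟩
      by_contra! h2
      exact hcon ⟨r, s, mem_piece_of_norm_lt h2 h1⟩
    · exact exists_piece_of_norm_eq_one h (le_antisymm z.norm_le (not_lt.1 h1))
  · rintro ⟨r, s, hz⟩ hcon
    exact absurd (hcon.2 r s) (not_lt.2 hz.1)

theorem sideFun_real_mul (k : ℕ) (t : ℝ) (z : ℂ) :
    sideFun n p k (t * z) = Real.cos (halfAngle n p) * (1 + t ^ 2 * ‖z‖ ^ 2) -
      2 * t * (z * (starRingEnd ℂ) (Circle.exp (midAngle n p k) : ℂ)).re := by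
  rw [sideFun, norm_mul, Complex.norm_real, mul_assoc, Complex.re_ofReal_mul, mul_pow,
    Real.norm_eq_abs, sq_abs]
  ring

/-- A point on a side of `Π` is a limit of points of the interior of `Π`. -/
theorem real_mul_mem_interior_polygon (h : 3 ≤ n * p) {r : Fin n} {s : Fin p} {z : Disk}
    (hz1 : ‖(z : ℂ)‖ < 1)
    (hz : ‖(z : ℂ) - center n p r s‖ = orthRadius (center n p r s)) {t : ℝ} (ht : t ∈ Ioo 0 1) :
    (t * z : ℂ) ∈ interior (polygon n p) := by
  rw [interior_polygon h]
  refine ⟨?_, fun r' s' => ?_⟩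
  · rw [norm_mul, Complex.norm_real, Real.norm_of_nonneg ht.1.le]
    nlinarith [ht.1, ht.2, norm_nonneg (z : ℂ)]
  by_contra! hcon
  rw [norm_sub_center_le_iff h, sideFun_real_mul] at hcon
  -- A half-plane that contains `t * z` contains `z` strictly, because `(1 - t) (1 - t ‖z‖²) > 0`.
  -- By disjointness of the pieces it is the half-plane of the side carrying `z`, where `sideFun`
  -- vanishes.
  have hlt : sideFun n p (r' * p + s') (z : ℂ) < 0 := by
    rw [sideFun]
    set x := ((z : ℂ) * (starRingEnd ℂ) (Circle.exp (midAngle n p (r' * p + s')) : ℂ)).re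
    have hc := cos_halfAngle_pos h
    have h1 : t * ‖(z : ℂ)‖ ^ 2 < 1 := by nlinarith [ht.1, ht.2, norm_nonneg (z : ℂ)]
    have h2 : t * (1 + ‖(z : ℂ)‖ ^ 2) < 1 + t ^ 2 * ‖(z : ℂ)‖ ^ 2 := by nlinarith [ht.1, ht.2]
    have h3 : t * (Real.cos (halfAngle n p) * (1 + ‖(z : ℂ)‖ ^ 2) - 2 * x) < 0 := by
      nlinarith
    by_contra! h4
    nlinarith [mul_nonneg ht.1.le h4]
  have hle' : ‖(z : ℂ) - center n p r' s'‖ < orthRadius (center n p r' s') :=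
    (norm_sub_center_lt_iff h r' s' z).2 hlt
  obtain ⟨rfl, rfl⟩ := index_eq_of_mem_piece h (mem_piece_of_norm_lt (z := z) hz.le hz1)
    (mem_piece_of_norm_lt hle'.le hz1)
  exact hle'.ne hz

/-! ### Rotations -/

theorem rot_pow_coe (u : Circle) (j : ℕ) (z : Disk) :
    (((rot u ^ j) z : Disk) : ℂ) = (u : ℂ) ^ j * z := by
  induction j with
  | zero => simp
  | succ j ih =>
    rw [pow_succ', pow_succ', Homeomorph.mul_apply, mul_assoc, ← ih]
    rfl

theorem norm_rot_pow (u : Circle) (j : ℕ) (z : Disk) : ‖(((rot u ^ j) z : Disk) : ℂ)‖ = ‖(z : ℂ)‖ := by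
  rw [rot_pow_coe, norm_mul, norm_pow, Circle.norm_coe, one_pow, one_mul]

theorem omega_pow (hn : (n : ℝ) ≠ 0) : omega n ^ n = 1 := by
  rw [omega, ← Circle.exp_natCast_mul, mul_div_cancel₀ _ hn, Circle.exp_two_pi]

theorem rot_omega_pow (hn : (n : ℝ) ≠ 0) : rot (omega n) ^ n = 1 := by
  ext z
  rw [rot_pow_coe, ← Circle.coe_pow, omega_pow hn]
  simp

theorem rot_omega_pow_mod (hn : (n : ℝ) ≠ 0) (j : ℕ) :
    rot (omega n) ^ j = rot (omega n) ^ (j % n) := by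
  conv_lhs => rw [← Nat.div_add_mod j n, pow_add, pow_mul, rot_omega_pow hn, one_pow, one_mul]

theorem center_rot (r : Fin n) (i : Fin n) (hi : (i : ℕ) = 0) (s : Fin p) :
    center n p r s = (omega n : ℂ) ^ (r : ℕ) * center n p i s := by
  rw [center, center, hi, omega, ← Circle.coe_pow, ← Circle.exp_natCast_mul, mul_div_assoc',
    ← Circle.coe_mul, ← Circle.exp_add]
  congr 3
  push_cast
  ring_nf

theorem rot_pow_mem_piece (r i : Fin n) (hi : (i : ℕ) = 0) (s : Fin p) (y : Disk) :
    (rot (omega n) ^ (r : ℕ)) y ∈ piece n p r s ↔ y ∈ piece n p i s := by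
  have h1 : ‖(((rot (omega n) ^ (r : ℕ)) y : Disk) : ℂ) - center n p r s‖ =
      ‖(y : ℂ) - center n p i s‖ := by
    rw [rot_pow_coe, center_rot r i hi, ← mul_sub, norm_mul, norm_pow, Circle.norm_coe, one_pow,
      one_mul]
  have h2 : orthRadius (center n p r s) = orthRadius (center n p i s) := by
    rw [orthRadius, center_rot r i hi, norm_mul, norm_pow, Circle.norm_coe, one_pow,
      one_mul, orthRadius]
  have h3 : bdry (Circle.exp (2 * Real.pi * r / n + 2 * Real.pi * (s + 1) / (n * p))) =
      (rot (omega n) ^ (r : ℕ))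
        (bdry (Circle.exp (2 * Real.pi * i / n + 2 * Real.pi * (s + 1) / (n * p)))) := by
    ext
    rw [rot_pow_coe, bdry, bdry, hi]
    simp only
    rw [omega, ← Circle.coe_pow, ← Circle.exp_natCast_mul, ← Circle.coe_mul, ← Circle.exp_add]
    congr 2
    push_cast
    ring
  rw [piece, piece, Set.mem_sdiff, Set.mem_sdiff, mem_singleton_iff, mem_singleton_iff, h3,
    (rot (omega n) ^ (r : ℕ)).injective.eq_iff]
  have h4 : (rot (omega n) ^ (r : ℕ)) y ∈ halfPlane n p r s ↔ y ∈ halfPlane n p i s := by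
    change ‖_‖ ≤ _ ↔ ‖_‖ ≤ _
    rw [h1, h2]
  rw [h4]

end

/-! ### The side pairings -/

section

variable {n p : ℕ}

/-- The index of the first sector. -/
abbrev zeroIndex (h : 3 ≤ n * p) : Fin n := ⟨0, pos_of_three_le h⟩

/-- The bisector of the first sector is the axis of the second reflection, so the sides of this
sector are exchanged in reverse order. -/
theorem center_rev (h : 3 ≤ n * p) (s : Fin p) :
    center n p (zeroIndex h) s.rev =
      (omega n : ℂ) * (starRingEnd ℂ) (center n p (zeroIndex h) s) := by
  have h1 := natCast_left_ne_zero h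
  have h2 := natCast_right_ne_zero h
  have h3 : ((s.rev : ℕ) : ℝ) = p - (s + 1) := by
    rw [Fin.val_rev, Nat.cast_sub s.2]
    push_cast
    ring
  rw [center, center, map_div₀, Complex.conj_ofReal, ← Circle.coe_inv_eq_conj, ← Circle.exp_neg,
    omega, mul_div_assoc', ← Circle.coe_mul, ← Circle.exp_add, h3]
  congr 3
  simp only [Nat.cast_zero]
  field_simp
  ring

theorem pairingOne_coe (h : 3 ≤ n * p) (s : Fin p) (z : Disk) :
    (pairingOne h s z : ℂ) = (omega n : ℂ) * (starRingEnd ℂ)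
      (EuclideanGeometry.inversion (center n p (zeroIndex h) s)
        (orthRadius (center n p (zeroIndex h) s)) (z : ℂ)) := rfl

/-- Inversion inverts distances to its centre and the second reflection is an isometry. Consequently
the pairing exchanges the inside of the circle of `s` with the outside of that of `s.rev`, and
conversely. -/
theorem norm_pairingOne_sub_mul (h : 3 ≤ n * p) (s : Fin p) (z : Disk) :
    ‖(pairingOne h s z : ℂ) - center n p (zeroIndex h) s.rev‖ *
      ‖(z : ℂ) - center n p (zeroIndex h) s‖ = orthRadius (center n p (zeroIndex h) s) ^ 2 := by
  have hne := Disk.ne_center (one_lt_norm_center h (zeroIndex h) s) z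
  rw [pairingOne_coe, center_rev h s, ← mul_sub, ← map_sub, norm_mul, Circle.norm_coe, one_mul,
    RCLike.norm_conj, ← dist_eq_norm, EuclideanGeometry.dist_inversion_center, dist_eq_norm]
  have : ‖(z : ℂ) - center n p (zeroIndex h) s‖ ≠ 0 := norm_ne_zero_iff.2 (sub_ne_zero.2 hne)
  field_simp

theorem norm_sub_center_pos (h : 3 ≤ n * p) (r : Fin n) (s : Fin p) (z : Disk) :
    0 < ‖(z : ℂ) - center n p r s‖ :=
  norm_pos_iff.2 (sub_ne_zero.2 (Disk.ne_center (one_lt_norm_center h r s) z))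

theorem pairingOne_lt_iff (h : 3 ≤ n * p) (s : Fin p) (z : Disk) :
    orthRadius (center n p (zeroIndex h) s.rev) <
        ‖(pairingOne h s z : ℂ) - center n p (zeroIndex h) s.rev‖ ↔
      ‖(z : ℂ) - center n p (zeroIndex h) s‖ < orthRadius (center n p (zeroIndex h) s) := by
  have h1 := norm_pairingOne_sub_mul h s z
  have h2 := norm_sub_center_pos h (zeroIndex h) s z
  have h3 := orthRadius_center_pos h (zeroIndex h) s
  rw [orthRadius_center_eq h (zeroIndex h) (zeroIndex h) s.rev s]
  constructor <;> intro h4 <;> by_contra! h5 <;> nlinarith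

theorem pairingOne_eq_iff (h : 3 ≤ n * p) (s : Fin p) (z : Disk) :
    ‖(pairingOne h s z : ℂ) - center n p (zeroIndex h) s.rev‖ =
        orthRadius (center n p (zeroIndex h) s.rev) ↔
      ‖(z : ℂ) - center n p (zeroIndex h) s‖ = orthRadius (center n p (zeroIndex h) s) := by
  have h1 := norm_pairingOne_sub_mul h s z
  have h3 := (orthRadius_center_pos h (zeroIndex h) s).ne'
  rw [orthRadius_center_eq h (zeroIndex h) (zeroIndex h) s.rev s]
  constructor
  · intro h4
    rw [h4, sq] at h1
    exact mul_left_cancel₀ h3 h1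
  · intro h4
    rw [h4, sq] at h1
    exact mul_right_cancel₀ h3 h1

theorem norm_inversion_eq_one {c : ℂ} (hc : 1 < ‖c‖) {z : ℂ} (hz : ‖z‖ = 1) :
    ‖EuclideanGeometry.inversion c (orthRadius c) z‖ = 1 := by
  have hw : z - c ≠ 0 := by
    intro h
    rw [sub_eq_zero] at h
    rw [← h, hz] at hc
    exact lt_irrefl _ hc
  have hN : 0 < ‖z - c‖ ^ 2 := by
    have := norm_pos_iff.2 hw
    positivity
  have h1 : ‖EuclideanGeometry.inversion c (orthRadius c) z‖ ^ 2 = 1 := by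
    simp only [EuclideanGeometry.inversion, vsub_eq_sub, vadd_eq_add, div_pow, orthRadius_sq hc,
      dist_eq_norm]
    have h2 : ‖z - c‖ ^ 2 = 1 + ‖c‖ ^ 2 - 2 * (z * (starRingEnd ℂ) c).re := by
      rw [← one_pow 2, ← hz]
      simp only [Complex.sq_norm, Complex.normSq_sub]
    have h3 : ((z - c) * (starRingEnd ℂ) c).re = (z * (starRingEnd ℂ) c).re - ‖c‖ ^ 2 := by
      rw [sub_mul, Complex.sub_re, Complex.mul_conj, Complex.normSq_eq_norm_sq, Complex.ofReal_re]
    set k := (‖c‖ ^ 2 - 1) / ‖z - c‖ ^ 2 with hk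
    have h4 : ‖k • (z - c) + c‖ ^ 2 =
        k ^ 2 * ‖z - c‖ ^ 2 + ‖c‖ ^ 2 + 2 * (k * ((z - c) * (starRingEnd ℂ) c).re) := by
      rw [Complex.sq_norm, Complex.normSq_add, Complex.normSq_eq_norm_sq, norm_smul,
        Complex.normSq_eq_norm_sq, mul_pow, Real.norm_eq_abs, sq_abs, smul_mul_assoc,
        Complex.smul_re, smul_eq_mul]
    have h5 : k * ‖z - c‖ ^ 2 = ‖c‖ ^ 2 - 1 := by
      rw [hk]
      field_simp
    rw [h4, h3]
    have h6 : (z * (starRingEnd ℂ) c).re = (1 + ‖c‖ ^ 2 - ‖z - c‖ ^ 2) / 2 := by linarith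
    rw [h6]
    linear_combination (k - 1) * h5
  have h2 := norm_nonneg (EuclideanGeometry.inversion c (orthRadius c) z)
  nlinarith

theorem norm_pairingOne_eq_one_iff (h : 3 ≤ n * p) (s : Fin p) (z : Disk) :
    ‖(pairingOne h s z : ℂ)‖ = 1 ↔ ‖(z : ℂ)‖ = 1 := by
  have hc := one_lt_norm_center h (zeroIndex h) s
  rw [pairingOne_coe, norm_mul, Circle.norm_coe, one_mul, RCLike.norm_conj]
  constructor
  · intro h1
    have h2 := norm_inversion_eq_one hc h1
    rwa [EuclideanGeometry.inversion_inversion _ (orthRadius_ne hc)] at h2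
  · exact norm_inversion_eq_one hc

theorem norm_pairingOne_lt_one_iff (h : 3 ≤ n * p) (s : Fin p) (z : Disk) :
    ‖(pairingOne h s z : ℂ)‖ < 1 ↔ ‖(z : ℂ)‖ < 1 := by
  rw [(pairingOne h s z).norm_le.lt_iff_ne, z.norm_le.lt_iff_ne, Ne, Ne,
    norm_pairingOne_eq_one_iff]

/-! ### Action on the circle -/

/-- A lift of the Bowen-Series map of the base group, modulo rotations, to the real line. -/
def baseLift (h : 3 ≤ n * p) : ℝ → ℝ := (exists_baseLift (halfAngle_pos h) (halfAngle_lt h)).choose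

theorem continuous_baseLift (h : 3 ≤ n * p) : Continuous (baseLift h) :=
  (exists_baseLift (halfAngle_pos h) (halfAngle_lt h)).choose_spec.1

theorem baseLift_add (h : 3 ≤ n * p) (x : ℝ) :
    baseLift h (x + 2 * halfAngle n p) = baseLift h x + (2 * Real.pi - 2 * halfAngle n p) :=
  (exists_baseLift (halfAngle_pos h) (halfAngle_lt h)).choose_spec.2.1 x

theorem baseLift_eq (h : 3 ≤ n * p) {t : ℝ} (ht : t ∈ Icc (-halfAngle n p) (halfAngle n p)) :
    baseLift h (t + halfAngle n p) = reflectAngle (halfAngle n p) t - halfAngle n p :=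
  (exists_baseLift (halfAngle_pos h) (halfAngle_lt h)).choose_spec.2.2.1 t ht

theorem baseLift_expanding (h : 3 ≤ n * p) {x y : ℝ} (hxy : x < y) :
    y - x < baseLift h y - baseLift h x :=
  (exists_baseLift (halfAngle_pos h) (halfAngle_lt h)).choose_spec.2.2.2 x y hxy

theorem baseLift_add_nat_mul (h : 3 ≤ n * p) (k : ℕ) (x : ℝ) :
    baseLift h (x + k * (2 * halfAngle n p)) =
      baseLift h x + k * (2 * Real.pi - 2 * halfAngle n p) := by
  induction k with
  | zero => simp
  | succ k ih =>
    have : x + ((k + 1 : ℕ) : ℝ) * (2 * halfAngle n p) =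
      x + k * (2 * halfAngle n p) + 2 * halfAngle n p := by push_cast; ring
    rw [this, baseLift_add, ih]
    push_cast
    ring

theorem baseLift_zero (h : 3 ≤ n * p) : baseLift h 0 = 0 := by
  have hα := halfAngle_pos h
  have := baseLift_eq h (t := -halfAngle n p) ⟨le_rfl, by linarith⟩
  rwa [neg_add_cancel, reflectAngle_left hα (halfAngle_lt h), sub_self] at this

theorem bdry_coe (u : Circle) : (bdry u : ℂ) = u := rfl

theorem bdry_injective : Function.Injective bdry := fun _ _ huv =>
  Circle.ext (congrArg (fun x : Disk => (x : ℂ)) huv)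

/-- The side `s` enters the lift only through a shift by `2 * π * s`, and `omega n` disappears in
the quotient. Hence a single lift describes all `p` pairings. -/
theorem pairingOne_bdry (h : 3 ≤ n * p) (s : Fin p) {θ : ℝ}
    (hθ : θ ∈ Icc (2 * halfAngle n p * s) (2 * halfAngle n p * (s + 1))) :
    pairingOne h s (bdry (Circle.exp θ)) = bdry (omega n * Circle.exp (baseLift h θ)) := by
  set α := halfAngle n p with hα
  set m := midAngle n p s with hm
  have hm' : m = (2 * s + 1) * α := rfl
  have ht : θ - m ∈ Icc (-α) α := by
    rw [hm']
    constructor <;> linarith [hθ.1, hθ.2]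
  have hcen : center n p (zeroIndex h) s = Circle.exp m / Real.cos α := by
    rw [center_eq h]
    simp [hm, hα]
  have h1 := inversion_circleExp (halfAngle_pos h) (halfAngle_lt h) m ht hcen
  rw [add_sub_cancel] at h1
  have h2 : baseLift h θ = reflectAngle α (θ - m) - α + s * (2 * Real.pi - 2 * α) := by
    have h3 := baseLift_eq h ht
    have h4 := baseLift_add_nat_mul h s (θ - m + α)
    rw [← hα, h3] at h4
    rw [← h4]
    congr 1
    rw [hm']
    ring
  ext
  rw [pairingOne_coe, bdry_coe, bdry_coe, h1, ← Circle.coe_inv_eq_conj, ← Circle.exp_neg,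
    ← Circle.coe_mul, h2, omega, ← Circle.exp_add, ← Circle.exp_add]
  congr 1
  refine Circle.exp_eq_exp.2 ⟨-s, ?_⟩
  rw [hm']
  push_cast
  ring

/-- The vertex of `Π` with the angle `2 k α`. -/
def vertex (n p k : ℕ) : Disk := bdry (Circle.exp (k * (2 * halfAngle n p)))

/-- The lift fixes `0` and advances by `-2 * α` modulo `2 * π` from one vertex to the next, so the
pairing reverses the order of the vertices in the sector. -/
theorem pairingOne_vertex (h : 3 ≤ n * p) (s : Fin p) {k k' : ℕ} (hk : k = s ∨ k = s + 1)
    (hkk : k + k' = p) : pairingOne h s (vertex n p k) = vertex n p k' := by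
  have hα := halfAngle_pos h
  have hmem : (k : ℝ) * (2 * halfAngle n p) ∈
      Icc (2 * halfAngle n p * s) (2 * halfAngle n p * (s + 1)) := by
    rcases hk with rfl | rfl
    · constructor <;> linarith
    · push_cast
      constructor <;> linarith
  have h1 := baseLift_add_nat_mul h k 0
  rw [zero_add, baseLift_zero, zero_add] at h1
  rw [vertex, pairingOne_bdry h s hmem, vertex, h1, omega, ← Circle.exp_add, two_pi_div_eq h]
  congr 1
  refine Circle.exp_eq_exp.2 ⟨k, ?_⟩
  rw [← hkk]
  push_cast
  ring

theorem piece_zero_eq (h : 3 ≤ n * p) (s : Fin p) (z : Disk) :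
    z ∈ piece n p (zeroIndex h) s ↔
      ‖(z : ℂ) - center n p (zeroIndex h) s‖ ≤ orthRadius (center n p (zeroIndex h) s) ∧
        z ≠ vertex n p (s + 1) := by
  have : vertex n p (s + 1) = bdry (Circle.exp (2 * Real.pi * ((zeroIndex h : Fin n) : ℕ) / n +
      2 * Real.pi * (s + 1) / (n * p))) := by
    rw [vertex, endAngle_eq h, midAngle]
    congr 2
    push_cast
    ring
  rw [piece, Set.mem_sdiff, mem_singleton_iff, this]
  rfl

theorem eq_vertex_of_norm_eq_one (h : 3 ≤ n * p) {s : Fin p} {z : Disk} (hz : ‖(z : ℂ)‖ = 1)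
    (hs : ‖(z : ℂ) - center n p (zeroIndex h) s‖ = orthRadius (center n p (zeroIndex h) s)) :
    z = vertex n p s ∨ z = vertex n p (s + 1) := by
  have h1 := (norm_sub_center_le_iff h (zeroIndex h) s z).1 hs.le
  have h2 : ¬ sideFun n p ((zeroIndex h : Fin n) * p + s) (z : ℂ) < 0 := by
    rw [← norm_sub_center_lt_iff h, hs]
    exact lt_irrefl _
  simp only [zero_mul, zero_add] at h1 h2
  obtain ⟨t, ht, hzt, -, -⟩ := exists_angle_of_sideFun_nonpos h h1
  have hα := halfAngle_pos h
  have hz' : z = bdry (Circle.exp (midAngle n p s + t)) := by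
    ext
    rw [hzt, hz, ofReal_one, one_mul]
    rfl
  have habs : |t| = halfAngle n p := by
    rw [hz', bdry_coe, sideFun_circle] at h2
    by_contra hne
    apply h2
    rw [← Real.cos_abs t]
    have := Real.cos_lt_cos_of_nonneg_of_le_pi (abs_nonneg t)
      (by linarith [halfAngle_lt h, Real.pi_pos]) (lt_of_le_of_ne ht hne)
    linarith
  rcases (abs_eq hα.le).1 habs with h3 | h3
  · right
    rw [hz', h3, vertex, midAngle]
    congr 2
    push_cast
    ring
  · left
    rw [hz', h3, vertex, midAngle]
    congr 2
    ring

theorem norm_vertex_sub_center (h : 3 ≤ n * p) {s : Fin p} {k : ℕ} (hk : k = s ∨ k = s + 1) :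
    ‖(vertex n p k : ℂ) - center n p (zeroIndex h) s‖ =
      orthRadius (center n p (zeroIndex h) s) := by
  have hz : sideFun n p ((zeroIndex h : Fin n) * p + s) (vertex n p k : ℂ) = 0 := by
    simp only [zero_mul, zero_add]
    rcases hk with rfl | rfl
    · have := sideFun_circle (n := n) (p := p) s (-halfAngle n p)
      rw [Real.cos_neg, sub_self, mul_zero, midAngle] at this
      rw [vertex, bdry_coe, ← this]
      congr 3
      ring
    · have := sideFun_circle (n := n) (p := p) s (halfAngle n p)
      rw [sub_self, mul_zero, midAngle] at this
      rw [vertex, bdry_coe, ← this]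
      congr 3
      push_cast
      ring
  have h1 := norm_sub_center_sq h (zeroIndex h) s (vertex n p k : ℂ)
  rw [hz, zero_div, add_zero] at h1
  exact (sq_eq_sq₀ (norm_nonneg _) (orthRadius_center_pos h _ _).le).1 h1

theorem norm_vertex (k : ℕ) : ‖(vertex n p k : ℂ)‖ = 1 := Circle.norm_coe _

theorem vertex_ne_vertex_succ (h : 3 ≤ n * p) (k : ℕ) : vertex n p k ≠ vertex n p (k + 1) := by
  intro heq
  have hα := halfAngle_pos h
  have := Circle.exp_injOn_Icc (a := k * (2 * halfAngle n p))
    (b := ((k + 1 : ℕ) : ℝ) * (2 * halfAngle n p))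
    (by push_cast; linarith [halfAngle_lt h]) ⟨le_rfl, by push_cast; linarith⟩
    ⟨by push_cast; linarith, le_rfl⟩ (bdry_injective heq)
  push_cast at this
  linarith

/-- The part of a piece off the open geodesic is mapped onto the complement of the paired piece. -/
theorem pairingOne_notMem_piece_iff (h : 3 ≤ n * p) (s : Fin p) (z : Disk) :
    pairingOne h s z ∉ piece n p (zeroIndex h) s.rev ↔
      z ∈ piece n p (zeroIndex h) s ∧ ¬ (‖(z : ℂ)‖ < 1 ∧
        ‖(z : ℂ) - center n p (zeroIndex h) s‖ = orthRadius (center n p (zeroIndex h) s)) := by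
  have hrev : (s.rev : ℕ) + 1 + s = p := by
    rw [Fin.val_rev]
    omega
  -- The vertex where side `s` starts, kept in its piece, goes to the vertex where side `s.rev`
  -- ends, removed from its piece. The two half-open conventions therefore match.
  have hv : pairingOne h s z = vertex n p (s.rev + 1) ↔ z = vertex n p s := by
    rw [← pairingOne_vertex h s (Or.inl rfl) (by omega : (s : ℕ) + (s.rev + 1) = p),
      (pairingOne h s).injective.eq_iff]
  rw [piece_zero_eq, piece_zero_eq, not_and_or, not_le, not_not, pairingOne_lt_iff, hv]
  constructor
  · rintro (hlt | rfl)
    · refine ⟨⟨hlt.le, ?_⟩, fun hc => hlt.ne hc.2⟩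
      rintro rfl
      exact hlt.ne (norm_vertex_sub_center h (Or.inr rfl))
    · exact ⟨⟨(norm_vertex_sub_center h (Or.inl rfl)).le, vertex_ne_vertex_succ h _⟩,
        fun hc => hc.1.ne (norm_vertex _)⟩
  · rintro ⟨⟨hle, hne⟩, hn⟩
    rcases hle.lt_or_eq with hlt | heq
    · exact Or.inl hlt
    · have hz1 : ‖(z : ℂ)‖ = 1 := by
        by_contra hz1
        exact hn ⟨lt_of_le_of_ne z.norm_le hz1, heq⟩
      exact Or.inr ((eq_vertex_of_norm_eq_one h hz1 heq).resolve_right hne)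

/-! ### The Bowen-Series map of the base group -/

theorem baseBowenSeries_eq (h : 3 ≤ n * p) {r : Fin n} {s : Fin p} {z : Disk}
    (hz : z ∈ piece n p r s) : baseBowenSeries h z = pairing h r s z := by
  have hex : ∃ i : Fin n × Fin p, z ∈ piece n p i.1 i.2 := ⟨(r, s), hz⟩
  obtain ⟨h1, h2⟩ := index_eq_of_mem_piece h hz hex.choose_spec
  rw [baseBowenSeries, dif_pos hex, ← h1, ← h2]

/-- Equivariance under `M_ω`: the pairings of the other sectors are conjugates of those of the first
by rotations. This is what lets the map pass to the quotient. -/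
theorem baseBowenSeries_rot (h : 3 ≤ n * p) {s : Fin p} {y : Disk}
    (hy : y ∈ piece n p (zeroIndex h) s) (j : ℕ) :
    (rot (omega n) ^ j) y ∈ baseDomain n p ∧
      baseBowenSeries h ((rot (omega n) ^ j) y) = (rot (omega n) ^ j) (pairingOne h s y) := by
  have hn := natCast_left_ne_zero h
  rw [rot_omega_pow_mod hn]
  set r : Fin n := ⟨j % n, Nat.mod_lt _ (pos_of_three_le h)⟩ with hr
  have hmem := (rot_pow_mem_piece r (zeroIndex h) rfl s y).2 hy
  refine ⟨(mem_baseDomain_iff h _).2 ⟨r, s, hmem⟩, ?_⟩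
  rw [baseBowenSeries_eq h hmem, pairing, Homeomorph.mul_apply, Homeomorph.mul_apply]
  change _ = (rot (omega n) ^ (r : ℕ)) _
  congr 2
  exact (rot (omega n) ^ (r : ℕ)).symm_apply_apply y

theorem exists_rot_of_mem_baseDomain (h : 3 ≤ n * p) {z : Disk} (hz : z ∈ baseDomain n p) :
    ∃ (j : ℕ) (s : Fin p) (y : Disk), y ∈ piece n p (zeroIndex h) s ∧
      z = (rot (omega n) ^ j) y := by
  obtain ⟨r, s, hrs⟩ := (mem_baseDomain_iff h z).1 hz
  have hz' : (rot (omega n) ^ (r : ℕ)) ((rot (omega n) ^ (r : ℕ)).symm z) = z :=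
    Homeomorph.apply_symm_apply _ z
  refine ⟨r, s, (rot (omega n) ^ (r : ℕ)).symm z, ?_, hz'.symm⟩
  rw [← rot_pow_mem_piece r (zeroIndex h) rfl, hz']
  exact hrs

theorem rot_pow_mem_baseDomain (h : 3 ≤ n * p) {z : Disk} (hz : z ∈ baseDomain n p) (j : ℕ) :
    (rot (omega n) ^ j) z ∈ baseDomain n p := by
  obtain ⟨i, s, y, hy, rfl⟩ := exists_rot_of_mem_baseDomain h hz
  rw [← Homeomorph.mul_apply, ← pow_add]
  exact (baseBowenSeries_rot h hy _).1

/-- A rotation by `j` sectors moves the piece to sector `j % n`, and distinct pieces are disjoint,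
so `j % n = 0`. -/
theorem eq_of_rot_pow_mem_piece (h : 3 ≤ n * p) {s s' : Fin p} {y : Disk} {j : ℕ}
    (hy : y ∈ piece n p (zeroIndex h) s)
    (hy' : (rot (omega n) ^ j) y ∈ piece n p (zeroIndex h) s') :
    s = s' ∧ (rot (omega n) ^ j) y = y := by
  have hn := natCast_left_ne_zero h
  rw [rot_omega_pow_mod hn] at hy' ⊢
  have hmem := (rot_pow_mem_piece ⟨j % n, Nat.mod_lt _ (pos_of_three_le h)⟩ (zeroIndex h) rfl s
    y).2 hy
  obtain ⟨h1, h2⟩ := index_eq_of_mem_piece h hmem hy'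
  have h3 : j % n = 0 := congrArg Fin.val h1
  exact ⟨h2, by rw [h3, pow_zero]; rfl⟩

end

/-! ### The factor map and its domain -/

section

variable {n p : ℕ} {h : 3 ≤ n * p} {ψ : Disk ≃ₜ Disk}

/-- The quotient map of the disk by the rotation, after `ψ`. -/
def quo (n : ℕ) (ψ : Disk ≃ₜ Disk) (z : Disk) : ℂ := (ψ z : ℂ) ^ n

theorem continuous_quo : Continuous (quo n ψ) := by
  unfold quo
  fun_prop

theorem norm_quo_le (z : Disk) : ‖quo n ψ z‖ ≤ 1 := by
  rw [quo, norm_pow]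
  exact pow_le_one₀ (norm_nonneg _) (ψ z).norm_le

theorem coe_omega (n : ℕ) : (omega n : ℂ) = Complex.exp (2 * Real.pi * I / n) := by
  rw [omega, Circle.coe_exp]
  congr 1
  push_cast
  ring

theorem isPrimitiveRoot_omega (hn : n ≠ 0) : IsPrimitiveRoot (omega n : ℂ) n := by
  rw [coe_omega]
  exact Complex.isPrimitiveRoot_exp n hn

theorem ne_zero_of_three_le (h : 3 ≤ n * p) : n ≠ 0 := (pos_of_three_le h).ne'

theorem exists_quo_eq (hn : n ≠ 0) {w : ℂ} (hw : ‖w‖ ≤ 1) : ∃ z, quo n ψ z = w := by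
  obtain ⟨x, rfl⟩ := IsAlgClosed.exists_pow_nat_eq w (Nat.pos_of_ne_zero hn)
  have hx : ‖x‖ ≤ 1 := by
    rw [norm_pow] at hw
    exact (pow_le_one_iff_of_nonneg (norm_nonneg _) hn).1 hw
  exact ⟨ψ.symm ⟨x, by simpa using hx⟩, by rw [quo, ψ.apply_symm_apply]⟩

namespace InducesTeichOmega

variable (hψ : InducesTeichOmega h ψ)
include hψ

theorem norm_lt_one_iff (z : Disk) : ‖(ψ z : ℂ)‖ < 1 ↔ ‖(z : ℂ)‖ < 1 := hψ.quasiconformal.1 z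

theorem norm_quo_lt_one_iff (z : Disk) : ‖quo n ψ z‖ < 1 ↔ ‖(z : ℂ)‖ < 1 := by
  rw [quo, norm_pow, pow_lt_one_iff_of_nonneg (norm_nonneg _) (ne_zero_of_three_le h),
    hψ.norm_lt_one_iff]

theorem map_rot_pow (j : ℕ) (z : Disk) :
    ψ ((rot (omega n) ^ j) z) = (rot (omega n) ^ j) (ψ z) := by
  induction j with
  | zero => simp
  | succ j ih =>
    rw [pow_succ', Homeomorph.mul_apply, Homeomorph.mul_apply, hψ.map_omega, ih]

theorem quo_rot_pow (j : ℕ) (z : Disk) : quo n ψ ((rot (omega n) ^ j) z) = quo n ψ z := by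
  rw [quo, quo, hψ.map_rot_pow, rot_pow_coe, mul_pow, ← pow_mul, mul_comm j, pow_mul,
    ← Circle.coe_pow, omega_pow (natCast_left_ne_zero h)]
  simp

theorem exists_rot_of_quo_eq {z z' : Disk} (he : quo n ψ z = quo n ψ z') :
    ∃ j < n, z' = (rot (omega n) ^ j) z := by
  have hn := ne_zero_of_three_le h
  rw [quo, quo] at he
  -- Over `0` the fibre is a single point and the quotient of the two values is not available.
  by_cases h0 : (ψ z : ℂ) = 0
  · refine ⟨0, pos_of_three_le h, ?_⟩
    rw [h0, zero_pow hn, eq_comm, pow_eq_zero_iff hn] at he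
    rw [pow_zero, Homeomorph.one_apply]
    exact ψ.injective (Subtype.ext (he.trans h0.symm))
  · have : NeZero n := ⟨hn⟩
    have h1 : ((ψ z' : ℂ) / ψ z) ^ n = 1 := by
      rw [div_pow, ← he, div_self (pow_ne_zero n h0)]
    obtain ⟨j, hj, hj'⟩ := (isPrimitiveRoot_omega hn).eq_pow_of_pow_eq_one h1
    refine ⟨j, hj, ψ.injective (Subtype.ext ?_)⟩
    rw [hψ.map_rot_pow, rot_pow_coe, hj', div_mul_cancel₀ _ h0]

omit hψ in
theorem factorDomain_eq_image : factorDomain n p ψ = quo n ψ '' baseDomain n p := by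
  rw [factorDomain, bowenSeriesDomain, image_image]
  rfl

theorem mem_factorDomain_iff {w : ℂ} :
    w ∈ factorDomain n p ψ ↔ ∃ s y, y ∈ piece n p (zeroIndex h) s ∧ quo n ψ y = w := by
  rw [factorDomain_eq_image]
  constructor
  · rintro ⟨z, hz, rfl⟩
    obtain ⟨j, s, y, hy, rfl⟩ := exists_rot_of_mem_baseDomain h hz
    exact ⟨s, y, hy, (hψ.quo_rot_pow j y).symm⟩
  · rintro ⟨s, y, hy, rfl⟩
    exact ⟨y, (mem_baseDomain_iff h y).2 ⟨_, s, hy⟩, rfl⟩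

theorem mem_baseDomain_of_quo_mem {z : Disk} (hz : quo n ψ z ∈ factorDomain n p ψ) :
    z ∈ baseDomain n p := by
  rw [factorDomain_eq_image] at hz
  obtain ⟨z', hz', he⟩ := hz
  obtain ⟨j, -, rfl⟩ := hψ.exists_rot_of_quo_eq he
  exact rot_pow_mem_baseDomain h hz' j

/-- The pieces of the first sector form a fundamental set for `M_ω` on the base domain: a point of
the factor domain has one representative in exactly one of them. -/
theorem piece_quo_injective {s s' : Fin p} {y y' : Disk} (hy : y ∈ piece n p (zeroIndex h) s)
    (hy' : y' ∈ piece n p (zeroIndex h) s') (he : quo n ψ y = quo n ψ y') : s = s' ∧ y = y' := by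
  obtain ⟨j, -, rfl⟩ := hψ.exists_rot_of_quo_eq he
  obtain ⟨h1, h2⟩ := eq_of_rot_pow_mem_piece h hy hy'
  exact ⟨h1, h2.symm⟩

/-- Well-definedness: the chosen root differs from `ψ z` by a rotation, with which the Bowen-Series
map commutes. -/
theorem factorBowenSeries_quo {z : Disk} (hz : z ∈ baseDomain n p) :
    factorBowenSeries h ψ (quo n ψ z) = quo n ψ (baseBowenSeries h z) := by
  have hex : ∃ x : Disk, (x : ℂ) ^ n = quo n ψ z := ⟨ψ z, rfl⟩
  rw [factorBowenSeries, dif_pos hex]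
  set x := hex.choose with hx
  have hx' : quo n ψ (ψ.symm x) = quo n ψ z := by
    rw [quo, ψ.apply_symm_apply]
    exact hex.choose_spec
  rw [bowenSeries]
  change quo n ψ (baseBowenSeries h (ψ.symm x)) = _
  obtain ⟨i, s, y, hy, rfl⟩ := exists_rot_of_mem_baseDomain h hz
  rw [hψ.quo_rot_pow] at hx'
  obtain ⟨j, -, hj⟩ := hψ.exists_rot_of_quo_eq hx'.symm
  rw [hj, (baseBowenSeries_rot h hy j).2, (baseBowenSeries_rot h hy i).2, hψ.quo_rot_pow,
    hψ.quo_rot_pow]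

theorem factorBowenSeries_piece {s : Fin p} {y : Disk} (hy : y ∈ piece n p (zeroIndex h) s) :
    factorBowenSeries h ψ (quo n ψ y) = quo n ψ (pairingOne h s y) := by
  have h1 := baseBowenSeries_rot h hy 0
  rw [pow_zero, Homeomorph.one_apply, Homeomorph.one_apply] at h1
  rw [hψ.factorBowenSeries_quo h1.1, h1.2]

theorem periodic_quo_bdry :
    Function.Periodic (fun x => quo n ψ (bdry (Circle.exp x))) (2 * Real.pi / n) := by
  intro x
  have : bdry (Circle.exp (x + 2 * Real.pi / n)) =
      (rot (omega n) ^ 1) (bdry (Circle.exp x)) := by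
    ext
    rw [rot_pow_coe, pow_one, bdry_coe, bdry_coe, Circle.exp_add, Circle.coe_mul, mul_comm]
    rfl
  simp only [this, hψ.quo_rot_pow]

theorem quo_bdry_omega_mul (u : Circle) : quo n ψ (bdry (omega n * u)) = quo n ψ (bdry u) := by
  have : bdry (omega n * u) = (rot (omega n) ^ 1) (bdry u) := by
    ext
    rw [rot_pow_coe, pow_one, bdry_coe, bdry_coe, Circle.coe_mul]
  rw [this, hψ.quo_rot_pow]

/-- The action of the factor map on the circle, in terms of the lift. -/
theorem factorBowenSeries_quo_bdry (θ : ℝ) :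
    factorBowenSeries h ψ (quo n ψ (bdry (Circle.exp θ))) =
      quo n ψ (bdry (Circle.exp (baseLift h θ))) := by
  have hn := natCast_left_ne_zero h
  have hmem : bdry (Circle.exp θ) ∈ baseDomain n p :=
    (mem_baseDomain_iff h _).2 (exists_piece_of_norm_eq_one h (Circle.norm_coe _))
  obtain ⟨j, s, y, hy, hjy⟩ := exists_rot_of_mem_baseDomain h hmem
  have hnorm : ‖(y : ℂ)‖ = 1 := by
    rw [← norm_rot_pow (omega n) j, ← hjy]
    exact Circle.norm_coe _
  obtain ⟨θ', hθ', hyθ, -⟩ := exists_angle_of_mem_piece h hy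
  simp only [zero_mul, zero_add] at hθ'
  rw [hnorm, ofReal_one, one_mul] at hyθ
  have hyb : y = bdry (Circle.exp θ') := Subtype.ext hyθ
  rw [hjy, hψ.quo_rot_pow, hψ.factorBowenSeries_piece hy, hyb,
    pairingOne_bdry h s ⟨hθ'.1, hθ'.2.le⟩, hψ.quo_bdry_omega_mul]
  have h1 : Circle.exp θ = Circle.exp (j * (2 * Real.pi / n) + θ') := by
    apply Circle.ext
    have h2 := congrArg (fun x : Disk => (x : ℂ)) hjy
    simp only [rot_pow_coe, bdry_coe, hyθ] at h2
    rw [h2, Circle.exp_add, Circle.coe_mul, Circle.exp_natCast_mul, Circle.coe_pow, omega]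
  obtain ⟨m, hm⟩ := Circle.exp_eq_exp.1 h1
  have hθM : θ = θ' + ((p * (j + n * m) : ℤ) : ℝ) * (2 * halfAngle n p) := by
    rw [hm, two_pi_div_eq h]
    have := halfAngle_mul h
    push_cast
    linear_combination (-2 * (m : ℝ)) * this
  -- Since `2 * π - 2 * α = (n * p - 1) * (2 * α)`, moving the argument by whole sectors moves the
  -- lift by whole sectors, which the quotient does not see.
  have hper : Function.Periodic (fun x => baseLift h x - (n * p - 1) * x) (2 * halfAngle n p) := by
    intro x
    simp only [baseLift_add]
    linear_combination (-2 : ℝ) * halfAngle_mul h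
  have h3 := hper.int_mul (p * (j + n * m)) θ'
  simp only [← hθM] at h3
  have h4 : baseLift h θ = baseLift h θ' + ((n * p - 1) * (j + n * m) : ℤ) * (2 * Real.pi / n) := by
    have h5 : baseLift h θ = baseLift h θ' + (n * p - 1) * (θ - θ') := by linarith
    rw [h5, two_pi_div_eq h, hθM]
    push_cast
    ring
  rw [h4]
  exact (hψ.periodic_quo_bdry.int_mul _ (baseLift h θ')).symm

/-- Only the removed end vertex needs an argument: there the factor map uses the formula of the next
piece, and both formulas are values of the same lift. -/
theorem factorBowenSeries_halfPlane {s : Fin p} {y : Disk}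
    (hy : y ∈ halfPlane n p (zeroIndex h) s) :
    factorBowenSeries h ψ (quo n ψ y) = quo n ψ (pairingOne h s y) := by
  by_cases hv : y = vertex n p (s + 1)
  · have hα := halfAngle_pos h
    rw [hv, vertex, hψ.factorBowenSeries_quo_bdry, pairingOne_bdry h s, hψ.quo_bdry_omega_mul]
    push_cast
    constructor <;> linarith
  · exact hψ.factorBowenSeries_piece ((piece_zero_eq h s y).2 ⟨hy, hv⟩)

/-! ### Topology of the factor domain and its boundary curves -/

omit hψ in
theorem isClosed_halfPlane (r : Fin n) (s : Fin p) : IsClosed (halfPlane n p r s) :=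
  isClosed_le (by fun_prop) continuous_const

theorem factorDomain_eq_iUnion :
    factorDomain n p ψ = ⋃ s, quo n ψ '' halfPlane n p (zeroIndex h) s := by
  ext w
  rw [hψ.mem_factorDomain_iff, mem_iUnion]
  constructor
  · rintro ⟨s, y, hy, rfl⟩
    exact ⟨s, y, hy.1, rfl⟩
  · rintro ⟨s, y, hy, rfl⟩
    obtain ⟨r', s', hrs⟩ := exists_piece_of_mem_halfPlane h hy
    rw [← hψ.mem_factorDomain_iff, factorDomain_eq_image]
    exact ⟨y, (mem_baseDomain_iff h y).2 ⟨r', s', hrs⟩, rfl⟩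

theorem isCompact_factorDomain : IsCompact (factorDomain n p ψ) := by
  rw [hψ.factorDomain_eq_iUnion]
  exact isCompact_iUnion fun s => (isClosed_halfPlane _ s).isCompact.image continuous_quo

/-- The domain is a finite union of closed images of half-planes. Each half-plane is compact, so it
maps to its image by a quotient map, and continuity can be tested upstairs on the pairing. -/
theorem continuousOn_factorBowenSeries :
    ContinuousOn (factorBowenSeries h ψ) (factorDomain n p ψ) := by
  rw [hψ.factorDomain_eq_iUnion]
  refine (locallyFinite_of_finite _).continuousOn_iUnion
    (fun s => ((isClosed_halfPlane _ s).isCompact.image continuous_quo).isClosed) fun s => ?_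
  set K := halfPlane n p (zeroIndex h) s with hK
  have : CompactSpace K := isCompact_iff_compactSpace.1 (isClosed_halfPlane _ s).isCompact
  set f : K → quo n ψ '' K := fun z => ⟨quo n ψ z, z, z.2, rfl⟩ with hf
  have hfc : Continuous f := (continuous_quo.comp continuous_subtype_val).subtype_mk _
  have hfs : Function.Surjective f := by
    rintro ⟨w, z, hz, rfl⟩
    exact ⟨⟨z, hz⟩, rfl⟩
  have hq : IsQuotientMap f := hfc.isClosedMap.isQuotientMap hfc hfs
  rw [continuousOn_iff_continuous_domRestrict, hq.continuous_iff]
  have : (quo n ψ '' K).domRestrict (factorBowenSeries h ψ) ∘ f =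
      fun z : K => quo n ψ (pairingOne h s z) :=
    funext fun z => hψ.factorBowenSeries_halfPlane z.2
  rw [this]
  exact continuous_quo.comp ((pairingOne h s).continuous.comp continuous_subtype_val)

theorem isOpen_quo_image {S : Set Disk} (hS : IsOpen S) (hS1 : ∀ z ∈ S, ‖(z : ℂ)‖ < 1) :
    IsOpen (quo n ψ '' S) := by
  have : NeZero n := ⟨ne_zero_of_three_le h⟩
  have h1 : IsOpen (ψ '' S) := ψ.isOpenMap S hS
  obtain ⟨U, hU, hUS⟩ := isOpen_induced_iff.1 h1
  have h2 : (Subtype.val '' (ψ '' S) : Set ℂ) = U ∩ Metric.ball 0 1 := by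
    ext x
    constructor
    · rintro ⟨y, hy, rfl⟩
      refine ⟨?_, ?_⟩
      · rw [← hUS] at hy
        exact hy
      · obtain ⟨z, hz, rfl⟩ := hy
        rw [mem_ball_zero_iff]
        exact (hψ.norm_lt_one_iff z).2 (hS1 z hz)
    · rintro ⟨hxU, hx⟩
      refine ⟨⟨x, Metric.ball_subset_closedBall hx⟩, ?_, rfl⟩
      rw [← hUS]
      exact hxU
  have h3 : quo n ψ '' S = (fun x : ℂ => x ^ n) '' (Subtype.val '' (ψ '' S)) := by
    rw [image_image, image_image]
    rfl
  rw [h3, h2]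
  exact (isOpenQuotientMap_pow n).isOpenMap _ (hU.inter Metric.isOpen_ball)

omit hψ in
theorem factorDomain_subset : factorDomain n p ψ ⊆ Metric.closedBall 0 1 := by
  rw [factorDomain_eq_image]
  rintro w ⟨z, -, rfl⟩
  rw [mem_closedBall_zero_iff]
  exact norm_quo_le z

theorem mem_interior_factorDomain_iff {w : ℂ} :
    w ∈ interior (factorDomain n p ψ) ↔ ∃ (s : Fin p) (y : Disk), ‖(y : ℂ)‖ < 1 ∧
      ‖(y : ℂ) - center n p (zeroIndex h) s‖ < orthRadius (center n p (zeroIndex h) s) ∧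
      quo n ψ y = w := by
  constructor
  · intro hw
    obtain ⟨s, y, hy, rfl⟩ := hψ.mem_factorDomain_iff.1 (interior_subset hw)
    have hy1 : ‖(y : ℂ)‖ < 1 := by
      rw [← hψ.norm_quo_lt_one_iff, ← mem_ball_zero_iff, ← interior_closedBall _ one_ne_zero]
      exact interior_mono factorDomain_subset hw
    refine ⟨s, y, hy1, lt_of_le_of_ne hy.1 fun heq => ?_, rfl⟩
    -- A point on an open side is approached radially from the interior of `Π`, whose image misses
    -- the factor domain; it cannot map to an interior point.
    have hcl : y ∈ closure {z : Disk | (z : ℂ) ∈ interior (polygon n p)} := by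
      rw [closure_subtype]
      have ht : Tendsto (fun t : ℝ => (t * y : ℂ)) (𝓝[<] 1) (𝓝 (y : ℂ)) := by
        have : Tendsto (fun t : ℝ => (t * y : ℂ)) (𝓝 1) (𝓝 ((1 : ℝ) * y : ℂ)) :=
          Continuous.tendsto (by fun_prop) 1
        rw [ofReal_one, one_mul] at this
        exact this.mono_left nhdsWithin_le_nhds
      refine mem_closure_of_tendsto ht ?_
      filter_upwards [Ioo_mem_nhdsLT (one_pos : (0 : ℝ) < 1)] with t ht
      have h1 := real_mul_mem_interior_polygon h hy1 heq ht
      refine ⟨⟨t * y, ?_⟩, h1, rfl⟩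
      rw [mem_closedBall_zero_iff]
      exact (interior_subset h1).1.le
    have hopen : IsOpen (quo n ψ ⁻¹' interior (factorDomain n p ψ)) :=
      isOpen_interior.preimage continuous_quo
    obtain ⟨z, hz1, hz2⟩ := mem_closure_iff.1 hcl _ hopen hw
    exact hψ.mem_baseDomain_of_quo_mem (interior_subset hz1) hz2
  · rintro ⟨s, y, hy1, hy, rfl⟩
    set S : Set Disk := {z | ‖(z : ℂ)‖ < 1 ∧
      ‖(z : ℂ) - center n p (zeroIndex h) s‖ < orthRadius (center n p (zeroIndex h) s)} with hS
    have h1 : IsOpen {z : Disk | ‖(z : ℂ)‖ < 1} := isOpen_lt (by fun_prop) continuous_const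
    have h2 : IsOpen {z : Disk | ‖(z : ℂ) - center n p (zeroIndex h) s‖ <
        orthRadius (center n p (zeroIndex h) s)} := isOpen_lt (by fun_prop) continuous_const
    have hSo : IsOpen S := h1.inter h2
    have hsub : quo n ψ '' S ⊆ factorDomain n p ψ := by
      rintro w ⟨z, hz, rfl⟩
      exact hψ.mem_factorDomain_iff.2 ⟨s, z, mem_piece_of_norm_lt hz.2.le hz.1, rfl⟩
    exact interior_maximal hsub (hψ.isOpen_quo_image hSo fun z hz => hz.1) ⟨y, ⟨hy1, hy⟩, rfl⟩

theorem mem_boundaryCurves_iff {w : ℂ} :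
    w ∈ boundaryCurves n p ψ ↔ ∃ (s : Fin p) (y : Disk), ‖(y : ℂ)‖ < 1 ∧
      ‖(y : ℂ) - center n p (zeroIndex h) s‖ = orthRadius (center n p (zeroIndex h) s) ∧
      quo n ψ y = w := by
  rw [boundaryCurves, hψ.isCompact_factorDomain.isClosed.frontier_eq]
  constructor
  · rintro ⟨⟨hw, hwi⟩, hw1⟩
    obtain ⟨s, y, hy, rfl⟩ := hψ.mem_factorDomain_iff.1 hw
    have hy1 : ‖(y : ℂ)‖ < 1 := by
      rw [← hψ.norm_quo_lt_one_iff]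
      exact mem_ball_zero_iff.1 hw1
    refine ⟨s, y, hy1, le_antisymm hy.1 ?_, rfl⟩
    by_contra! hlt
    exact hwi (hψ.mem_interior_factorDomain_iff.2 ⟨s, y, hy1, hlt, rfl⟩)
  · rintro ⟨s, y, hy1, hy, rfl⟩
    have hyp : y ∈ piece n p (zeroIndex h) s := mem_piece_of_norm_lt hy.le hy1
    refine ⟨⟨hψ.mem_factorDomain_iff.2 ⟨s, y, hyp, rfl⟩, fun hi => ?_⟩,
      mem_ball_zero_iff.2 ((hψ.norm_quo_lt_one_iff y).2 hy1)⟩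
    obtain ⟨s', y', hy1', hlt, he⟩ := hψ.mem_interior_factorDomain_iff.1 hi
    obtain ⟨rfl, rfl⟩ := hψ.piece_quo_injective (mem_piece_of_norm_lt hlt.le hy1') hyp he
    exact hlt.ne hy

theorem quo_mem_boundaryCurves_iff {s : Fin p} {y : Disk}
    (hy : y ∈ piece n p (zeroIndex h) s) :
    quo n ψ y ∈ boundaryCurves n p ψ ↔ ‖(y : ℂ)‖ < 1 ∧
      ‖(y : ℂ) - center n p (zeroIndex h) s‖ = orthRadius (center n p (zeroIndex h) s) := by
  rw [hψ.mem_boundaryCurves_iff]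
  constructor
  · rintro ⟨s', y', hy1', heq, he⟩
    obtain ⟨rfl, rfl⟩ := hψ.piece_quo_injective (mem_piece_of_norm_lt heq.le hy1') hy he
    exact ⟨hy1', heq⟩
  · rintro ⟨h1, h2⟩
    exact ⟨s, y, h1, h2, rfl⟩

/-- The pairing maps the open side `s` bijectively to the open side `s.rev`; reversal permutes the
sides, and the open sides embed in the quotient. -/
theorem bijOn_boundaryCurves :
    BijOn (factorBowenSeries h ψ) (boundaryCurves n p ψ) (boundaryCurves n p ψ) := by
  have hmap : ∀ (s : Fin p) (y : Disk), ‖(y : ℂ)‖ < 1 →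
      ‖(y : ℂ) - center n p (zeroIndex h) s‖ = orthRadius (center n p (zeroIndex h) s) →
      y ∈ piece n p (zeroIndex h) s ∧ pairingOne h s y ∈ piece n p (zeroIndex h) s.rev ∧
      ‖(pairingOne h s y : ℂ)‖ < 1 ∧
      ‖(pairingOne h s y : ℂ) - center n p (zeroIndex h) s.rev‖ =
        orthRadius (center n p (zeroIndex h) s.rev) := by
    intro s y hy1 hy
    have h1 := (norm_pairingOne_lt_one_iff h s y).2 hy1
    have h2 := (pairingOne_eq_iff h s y).2 hy
    exact ⟨mem_piece_of_norm_lt hy.le hy1, mem_piece_of_norm_lt h2.le h1, h1, h2⟩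
  refine ⟨?_, ?_, ?_⟩
  · intro w hw
    obtain ⟨s, y, hy1, hy, rfl⟩ := hψ.mem_boundaryCurves_iff.1 hw
    obtain ⟨h1, h2, h3, h4⟩ := hmap s y hy1 hy
    rw [hψ.factorBowenSeries_piece h1]
    exact hψ.mem_boundaryCurves_iff.2 ⟨_, _, h3, h4, rfl⟩
  · intro w hw w' hw' he
    obtain ⟨s, y, hy1, hy, rfl⟩ := hψ.mem_boundaryCurves_iff.1 hw
    obtain ⟨s', y', hy1', hy', rfl⟩ := hψ.mem_boundaryCurves_iff.1 hw'
    obtain ⟨h1, h2, -, -⟩ := hmap s y hy1 hy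
    obtain ⟨h1', h2', -, -⟩ := hmap s' y' hy1' hy'
    rw [hψ.factorBowenSeries_piece h1, hψ.factorBowenSeries_piece h1'] at he
    obtain ⟨h3, h4⟩ := hψ.piece_quo_injective h2 h2' he
    obtain rfl := Fin.rev_injective h3
    rw [(pairingOne h s).injective h4]
  · intro w hw
    obtain ⟨s, y, hy1, hy, rfl⟩ := hψ.mem_boundaryCurves_iff.1 hw
    set z := (pairingOne h s.rev).symm y with hz
    have hzy : pairingOne h s.rev z = y := Homeomorph.apply_symm_apply _ y
    have h1 : ‖(z : ℂ)‖ < 1 := by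
      rw [← norm_pairingOne_lt_one_iff h s.rev, hzy]
      exact hy1
    have h2 : ‖(z : ℂ) - center n p (zeroIndex h) s.rev‖ =
        orthRadius (center n p (zeroIndex h) s.rev) := by
      rw [← pairingOne_eq_iff, hzy, Fin.rev_rev]
      exact hy
    refine ⟨quo n ψ z, hψ.mem_boundaryCurves_iff.2 ⟨_, _, h1, h2, rfl⟩, ?_⟩
    rw [hψ.factorBowenSeries_piece (hmap _ z h1 h2).1, hzy]

theorem sphere_subset_factorDomain : Metric.sphere 0 1 ⊆ factorDomain n p ψ := by
  intro w hw
  rw [mem_sphere_zero_iff_norm] at hw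
  obtain ⟨z, rfl⟩ := exists_quo_eq (ψ := ψ) (ne_zero_of_three_le h) hw.le
  have hz : ‖(z : ℂ)‖ = 1 := by
    refine le_antisymm z.norm_le ?_
    by_contra! hlt
    exact ((hψ.norm_quo_lt_one_iff z).2 hlt).ne hw
  rw [factorDomain_eq_image]
  exact ⟨z, (mem_baseDomain_iff h z).2 (exists_piece_of_norm_eq_one h hz), rfl⟩

theorem norm_factorBowenSeries_eq_one {w : ℂ} (hw : ‖w‖ = 1) :
    ‖factorBowenSeries h ψ w‖ = 1 := by
  obtain ⟨s, y, hy, rfl⟩ := hψ.mem_factorDomain_iff.1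
    (hψ.sphere_subset_factorDomain (mem_sphere_zero_iff_norm.2 hw))
  rw [hψ.factorBowenSeries_piece hy]
  refine le_antisymm (norm_quo_le _) ?_
  by_contra! hlt
  rw [hψ.norm_quo_lt_one_iff, norm_pairingOne_lt_one_iff, ← hψ.norm_quo_lt_one_iff] at hlt
  exact hlt.ne hw

theorem mapsTo_factorBowenSeries :
    MapsTo (factorBowenSeries h ψ) (factorDomain n p ψ) (Metric.closedBall 0 1) := by
  intro w hw
  obtain ⟨s, y, hy, rfl⟩ := hψ.mem_factorDomain_iff.1 hw
  rw [hψ.factorBowenSeries_piece hy, mem_closedBall_zero_iff]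
  exact norm_quo_le _

/-- A point of the domain whose image is neither on the circle nor on the boundary curves is an
interior point. -/
theorem mem_interior_of_factorBowenSeries {w : ℂ} (hw : w ∈ factorDomain n p ψ)
    (h1 : ‖factorBowenSeries h ψ w‖ < 1) (h2 : factorBowenSeries h ψ w ∉ boundaryCurves n p ψ) :
    w ∈ interior (factorDomain n p ψ) := by
  have h3 : ‖w‖ < 1 := by
    refine lt_of_le_of_ne (mem_closedBall_zero_iff.1 (factorDomain_subset hw)) fun heq => ?_
    exact h1.ne (hψ.norm_factorBowenSeries_eq_one heq)
  by_contra h4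
  refine h2 (hψ.bijOn_boundaryCurves.mapsTo ?_)
  rw [boundaryCurves, hψ.isCompact_factorDomain.isClosed.frontier_eq]
  exact ⟨⟨hw, h4⟩, mem_ball_zero_iff.2 h3⟩

/-- `0` is the only fixed point of the nontrivial rotation `M_ω`, and `ψ` commutes with this
rotation. -/
theorem map_zero (hn : 2 ≤ n) (z : Disk) : (ψ z : ℂ) = 0 ↔ (z : ℂ) = 0 := by
  have key : ∀ z : Disk, (z : ℂ) = 0 → (ψ z : ℂ) = 0 := by
    intro z hz
    have h1 : rot (omega n) z = z := by
      ext
      change (omega n : ℂ) * z = z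
      rw [hz, mul_zero]
    have h2 := congrArg (fun x : Disk => (x : ℂ)) (hψ.map_omega z)
    rw [h1] at h2
    change (ψ z : ℂ) = (omega n : ℂ) * ψ z at h2
    by_contra h0
    have h3 : (omega n : ℂ) = 1 := by
      have : (omega n : ℂ) * ψ z = 1 * ψ z := by rw [← h2, one_mul]
      exact mul_right_cancel₀ h0 this
    exact (isPrimitiveRoot_omega (by omega)).ne_one (by omega) h3
  refine ⟨fun hz => ?_, key z⟩
  have h1 := key ⟨0, by simp⟩ rfl
  have h2 : ψ z = ψ ⟨0, by simp⟩ := Subtype.ext (hz.trans h1.symm)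
  rw [ψ.injective h2]

theorem quo_eq_zero_iff (hn : 2 ≤ n) (z : Disk) : quo n ψ z = 0 ↔ (z : ℂ) = 0 := by
  rw [quo, pow_eq_zero_iff (by omega), hψ.map_zero hn]

theorem zero_notMem_factorDomain (hn : 2 ≤ n) : (0 : ℂ) ∉ factorDomain n p ψ := by
  intro h0
  obtain ⟨s, y, hy, hy0⟩ := hψ.mem_factorDomain_iff.1 h0
  rw [hψ.quo_eq_zero_iff hn] at hy0
  obtain ⟨θ, -, -, hpos⟩ := exists_angle_of_mem_piece h hy
  rw [hy0, norm_zero] at hpos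
  exact lt_irrefl _ hpos

end InducesTeichOmega

end

/-! ### Local branches of roots, and Möbius maps -/

/-- Away from `0` the branch comes from the principal logarithm of `w / x ^ n`, which is near `1`;
for `n = 1` the identity also serves at `0`. Differentiating `ρ ^ n = id` shows that the derivative
does not vanish. -/
theorem exists_local_root {n : ℕ} (hn : n ≠ 0) {x : ℂ} (hx : n = 1 ∨ x ≠ 0) :
    ∃ ρ : ℂ → ℂ, AnalyticAt ℂ ρ (x ^ n) ∧ ρ (x ^ n) = x ∧ (∀ᶠ w in 𝓝 (x ^ n), ρ w ^ n = w) ∧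
      deriv ρ (x ^ n) ≠ 0 := by
  suffices hsuff : ∃ ρ : ℂ → ℂ, AnalyticAt ℂ ρ (x ^ n) ∧ ρ (x ^ n) = x ∧
      ∀ᶠ w in 𝓝 (x ^ n), ρ w ^ n = w by
    obtain ⟨ρ, h1, h2, h3⟩ := hsuff
    refine ⟨ρ, h1, h2, h3, fun h0 => ?_⟩
    have h4 : deriv (fun w => ρ w ^ n) (x ^ n) = 1 := by
      have : (fun w => ρ w ^ n) =ᶠ[𝓝 (x ^ n)] id := h3
      rw [this.deriv_eq, deriv_id]
    rw [(h1.differentiableAt.hasDerivAt.fun_pow n).deriv, h0, mul_zero] at h4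
    exact zero_ne_one h4
  rcases hx with rfl | hx
  · exact ⟨id, analyticAt_id, by simp, by simp⟩
  · have hxn : x ^ n ≠ 0 := pow_ne_zero n hx
    have hn' : (n : ℂ) ≠ 0 := by exact_mod_cast hn
    refine ⟨fun w => x * Complex.exp (Complex.log (w / x ^ n) / n), ?_, ?_, ?_⟩
    · have h1 : AnalyticAt ℂ (fun w : ℂ => Complex.log (w / x ^ n)) (x ^ n) := by
        refine AnalyticAt.clog (by fun_prop) ?_
        rw [div_self hxn]
        exact Complex.one_mem_slitPlane
      exact analyticAt_const.mul (h1.div_const).cexp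
    · simp [div_self hxn]
    · have : ∀ᶠ w in 𝓝 (x ^ n), w ≠ 0 := eventually_ne_nhds hxn
      filter_upwards [this] with w hw
      rw [mul_pow, ← Complex.exp_nat_mul, mul_div_cancel₀ _ hn',
        Complex.exp_log (div_ne_zero hw hxn), mul_div_cancel₀ _ hxn]

theorem moebius_denominator_ne_zero {a b z : ℂ} (hab : ‖b‖ < ‖a‖) (hz : ‖z‖ ≤ 1) :
    (starRingEnd ℂ) b * z + (starRingEnd ℂ) a ≠ 0 := by
  intro h0
  have h1 : ‖a‖ = ‖b‖ * ‖z‖ := by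
    rw [← RCLike.norm_conj a, eq_neg_of_add_eq_zero_right h0, norm_neg, norm_mul, RCLike.norm_conj]
  nlinarith [norm_nonneg b]

theorem analyticAt_moebius {a b z : ℂ} (hab : ‖b‖ < ‖a‖) (hz : ‖z‖ ≤ 1) :
    AnalyticAt ℂ (fun z => (a * z + b) / ((starRingEnd ℂ) b * z + (starRingEnd ℂ) a)) z :=
  AnalyticAt.fun_div (by fun_prop) (by fun_prop) (moebius_denominator_ne_zero hab hz)

theorem deriv_moebius_ne_zero {a b z : ℂ} (hab : ‖b‖ < ‖a‖) (hz : ‖z‖ ≤ 1) :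
    deriv (fun z => (a * z + b) / ((starRingEnd ℂ) b * z + (starRingEnd ℂ) a)) z ≠ 0 := by
  have hden := moebius_denominator_ne_zero hab hz
  have h1 : HasDerivAt (fun z => a * z + b) a z := by
    simpa using ((hasDerivAt_id z).const_mul a).add_const b
  have h2 : HasDerivAt (fun z => (starRingEnd ℂ) b * z + (starRingEnd ℂ) a)
      ((starRingEnd ℂ) b) z := by
    simpa using ((hasDerivAt_id z).const_mul ((starRingEnd ℂ) b)).add_const ((starRingEnd ℂ) a)
  rw [(h1.fun_div h2 hden).deriv]
  refine div_ne_zero ?_ (pow_ne_zero 2 hden)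
  -- The numerator of the derivative is the determinant of the Möbius matrix.
  have h3 : a * ((starRingEnd ℂ) b * z + (starRingEnd ℂ) a) - (a * z + b) * (starRingEnd ℂ) b =
      ((‖a‖ ^ 2 - ‖b‖ ^ 2 : ℝ) : ℂ) := by
    push_cast
    rw [← Complex.mul_conj', ← Complex.mul_conj']
    ring
  rw [h3]
  have h4 : 0 < ‖a‖ ^ 2 - ‖b‖ ^ 2 := by nlinarith [norm_nonneg b]
  exact_mod_cast h4.ne'

/-! ### Orders of powers -/

section Order

variable {A B : ℂ → ℂ} {w : ℂ} {n : ℕ}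

theorem deriv_pow_ne_zero (hB : AnalyticAt ℂ B w) (hB' : deriv B w ≠ 0)
    (hA : A =ᶠ[𝓝 w] fun x => B x ^ n) (hn : n ≠ 0) (h0 : n = 1 ∨ B w ≠ 0) : deriv A w ≠ 0 := by
  rw [hA.deriv_eq, (hB.differentiableAt.hasDerivAt.fun_pow n).deriv]
  refine mul_ne_zero (mul_ne_zero (by exact_mod_cast hn) ?_) hB'
  rcases h0 with rfl | h0
  · simp
  · exact pow_ne_zero _ h0

theorem analyticOrderAt_pow_of_eq_zero (hB : AnalyticAt ℂ B w) (hB' : deriv B w ≠ 0)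
    (hA : A =ᶠ[𝓝 w] fun x => B x ^ n) (h0 : B w = 0) : analyticOrderAt A w = n := by
  rw [analyticOrderAt_congr hA]
  change analyticOrderAt (B ^ n) w = n
  rw [analyticOrderAt_pow hB, hB.analyticOrderAt_eq_one_of_zero_deriv_ne_zero h0 hB']
  simp

end Order

/-! ### Local form of the factor map, degrees and critical points -/

section

variable {n p : ℕ} {h : 3 ≤ n * p} {ψ : Disk ≃ₜ Disk}

theorem pairingOne_mem_baseGroup (h : 3 ≤ n * p) (s : Fin p) : pairingOne h s ∈ baseGroup h := by
  refine Subgroup.subset_closure ⟨zeroIndex h, s, ?_⟩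
  simp [pairing]

namespace InducesTeichOmega

variable (hψ : InducesTeichOmega h ψ)
include hψ

theorem exists_moebius (s : Fin p) : ∃ a b : ℂ, ‖b‖ < ‖a‖ ∧ ∀ z : Disk,
    (ψ (pairingOne h s z) : ℂ) =
      (a * ψ z + b) / ((starRingEnd ℂ) b * ψ z + (starRingEnd ℂ) a) := by
  obtain ⟨a, b, hab, hg⟩ := hψ.conj_mem _ (pairingOne_mem_baseGroup h s)
  refine ⟨a, b, hab, fun z => ?_⟩
  rw [← hg (ψ z), Homeomorph.mul_apply, Homeomorph.mul_apply]
  congr 3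
  exact (ψ.symm_apply_apply z).symm

/-- Near an interior point of its domain, the factor map is the `n`-th power of a local
biholomorphism. -/
theorem exists_local_form {s : Fin p} {y : Disk} (hy1 : ‖(y : ℂ)‖ < 1)
    (hlt : ‖(y : ℂ) - center n p (zeroIndex h) s‖ < orthRadius (center n p (zeroIndex h) s)) :
    ∃ B : ℂ → ℂ, AnalyticAt ℂ B (quo n ψ y) ∧ deriv B (quo n ψ y) ≠ 0 ∧
      B (quo n ψ y) = ψ (pairingOne h s y) ∧
      factorBowenSeries h ψ =ᶠ[𝓝 (quo n ψ y)] fun w => B w ^ n := by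
  have hn := ne_zero_of_three_le h
  -- For `n ≥ 2` the branch point `0` of the root lies outside the factor domain.
  have hx : n = 1 ∨ (ψ y : ℂ) ≠ 0 := by
    by_contra! hcon
    have hn2 : 2 ≤ n := by omega
    apply hψ.zero_notMem_factorDomain hn2
    refine hψ.mem_factorDomain_iff.2 ⟨s, y, mem_piece_of_norm_lt hlt.le hy1, ?_⟩
    rw [quo, hcon.2, zero_pow hn]
  obtain ⟨ρ, hρ, hρx, hρn, hρ'⟩ := exists_local_root hn hx
  obtain ⟨a, b, hab, hM⟩ := hψ.exists_moebius s
  set M : ℂ → ℂ := fun z => (a * z + b) / ((starRingEnd ℂ) b * z + (starRingEnd ℂ) a) with hMdef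
  have hMa : AnalyticAt ℂ M (ρ (quo n ψ y)) := by
    rw [quo, hρx]
    exact analyticAt_moebius hab (ψ y).norm_le
  have hMd : deriv M (ρ (quo n ψ y)) ≠ 0 := by
    rw [quo, hρx]
    exact deriv_moebius_ne_zero hab (ψ y).norm_le
  refine ⟨M ∘ ρ, hMa.comp hρ, ?_, ?_, ?_⟩
  · rw [deriv_comp _ hMa.differentiableAt hρ.differentiableAt]
    exact mul_ne_zero hMd hρ'
  · rw [Function.comp_apply, quo, hρx, hM]
  · set S : Set Disk := {z | ‖(z : ℂ) - center n p (zeroIndex h) s‖ <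
      orthRadius (center n p (zeroIndex h) s)} with hS
    have hSo : IsOpen S := isOpen_lt (by fun_prop) continuous_const
    obtain ⟨U, hU, hUS⟩ := isOpen_induced_iff.1 (ψ.isOpenMap S hSo)
    have hyU : ρ (quo n ψ y) ∈ U ∩ Metric.ball 0 1 := by
      rw [quo, hρx]
      refine ⟨?_, mem_ball_zero_iff.2 ((hψ.norm_lt_one_iff y).2 hy1)⟩
      have : ψ y ∈ Subtype.val ⁻¹' U := by
        rw [hUS]
        exact ⟨y, hlt, rfl⟩
      exact this
    have hev := hρ.continuousAt.eventually ((hU.inter Metric.isOpen_ball).mem_nhds hyU)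
    filter_upwards [hev, hρn] with w hw hwn
    have hmem : (⟨ρ w, Metric.ball_subset_closedBall hw.2⟩ : Disk) ∈ ψ '' S := by
      rw [← hUS]
      exact hw.1
    obtain ⟨z, hz, hzρ⟩ := hmem
    have hzρ' : (ψ z : ℂ) = ρ w := congrArg Subtype.val hzρ
    have hzw : quo n ψ z = w := by rw [quo, hzρ', hwn]
    have hz' : ‖(z : ℂ) - center n p (zeroIndex h) s‖ <
      orthRadius (center n p (zeroIndex h) s) := hz
    have hzh : z ∈ halfPlane n p (zeroIndex h) s := hz'.le
    rw [← hzw, hψ.factorBowenSeries_halfPlane hzh, quo, hM, hzρ', hzw]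
    rfl

theorem analyticOnNhd_factorBowenSeries :
    AnalyticOnNhd ℂ (factorBowenSeries h ψ) (interior (factorDomain n p ψ)) := by
  intro w hw
  obtain ⟨s, y, hy1, hlt, rfl⟩ := hψ.mem_interior_factorDomain_iff.1 hw
  obtain ⟨B, hB, -, -, hA⟩ := hψ.exists_local_form hy1 hlt
  exact (hB.pow n).congr hA.symm

theorem deriv_factorBowenSeries_ne_zero {w : ℂ} (hw : w ∈ interior (factorDomain n p ψ))
    (h0 : n = 1 ∨ factorBowenSeries h ψ w ≠ 0) : deriv (factorBowenSeries h ψ) w ≠ 0 := by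
  have hn := ne_zero_of_three_le h
  obtain ⟨s, y, hy1, hlt, rfl⟩ := hψ.mem_interior_factorDomain_iff.1 hw
  obtain ⟨B, hB, hB', -, hA⟩ := hψ.exists_local_form hy1 hlt
  refine deriv_pow_ne_zero hB hB' hA hn (h0.imp_right fun h1 h2 => h1 ?_)
  rw [hA.self_of_nhds]
  simp only [h2, zero_pow hn]

theorem analyticOrderAt_eq_one {w : ℂ} (hw : w ∈ interior (factorDomain n p ψ))
    (h0 : n = 1 ∨ factorBowenSeries h ψ w ≠ 0) :
    analyticOrderAt (fun x => factorBowenSeries h ψ x - factorBowenSeries h ψ w) w = 1 :=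
  (hψ.analyticOnNhd_factorBowenSeries w hw).analyticOrderAt_sub_eq_one_of_deriv_ne_zero
    (hψ.deriv_factorBowenSeries_ne_zero hw h0)

theorem analyticOrderAt_of_eq_zero {w : ℂ} (hw : w ∈ interior (factorDomain n p ψ))
    (h0 : factorBowenSeries h ψ w = 0) : analyticOrderAt (factorBowenSeries h ψ) w = n := by
  obtain ⟨s, y, hy1, hlt, rfl⟩ := hψ.mem_interior_factorDomain_iff.1 hw
  obtain ⟨B, hB, hB', -, hA⟩ := hψ.exists_local_form hy1 hlt
  refine analyticOrderAt_pow_of_eq_zero hB hB' hA ?_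
  rw [hA.self_of_nhds] at h0
  exact eq_zero_of_pow_eq_zero h0

/-! ### Counting preimages -/

theorem ncard_fiber {w : ℂ} (hw : ‖w‖ ≤ 1) (h0 : n = 1 ∨ w ≠ 0) :
    {y | quo n ψ y = w}.Finite ∧ {y | quo n ψ y = w}.ncard = n := by
  have hn := ne_zero_of_three_le h
  obtain ⟨z, rfl⟩ := exists_quo_eq (ψ := ψ) hn hw
  have hset : {y | quo n ψ y = quo n ψ z} =
      (fun j : ℕ => (rot (omega n) ^ j) z) '' (Finset.range n : Set ℕ) := by
    ext y
    simp only [mem_ofPred_eq, mem_image, Finset.coe_range, mem_Iio]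
    constructor
    · intro hy
      obtain ⟨j, hj, rfl⟩ := hψ.exists_rot_of_quo_eq hy.symm
      exact ⟨j, hj, rfl⟩
    · rintro ⟨j, -, rfl⟩
      exact hψ.quo_rot_pow j z
  have hinj : InjOn (fun j : ℕ => (rot (omega n) ^ j) z) (Finset.range n : Set ℕ) := by
    intro i hi j hj hij
    simp only [Finset.coe_range, mem_Iio] at hi hj
    by_cases hn1 : n = 1
    · omega
    · have hz : (z : ℂ) ≠ 0 := by
        rw [Ne, ← hψ.quo_eq_zero_iff (by omega)]
        exact h0.resolve_left hn1
      have h1 := congrArg (fun x : Disk => (x : ℂ)) hij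
      simp only [rot_pow_coe] at h1
      exact (isPrimitiveRoot_omega hn).pow_inj hi hj (mul_right_cancel₀ hz h1)
  rw [hset]
  exact ⟨(Finset.finite_toSet _).image _, by rw [hinj.ncard_image, ncard_coe_finset]; simp⟩

theorem ncard_fiber_zero (hn : 2 ≤ n) :
    {y | quo n ψ y = 0}.Finite ∧ {y | quo n ψ y = 0}.ncard = 1 := by
  have : {y | quo n ψ y = 0} = {⟨0, by simp⟩} := by
    ext y
    rw [mem_ofPred_eq, hψ.quo_eq_zero_iff hn, mem_singleton_iff, Subtype.ext_iff]
  rw [this]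
  exact ⟨finite_singleton _, ncard_singleton _⟩

/-- The preimages of a point off the boundary curves correspond to the pairs of a side and a point
of the fibre that does not belong to the piece of this side. -/
theorem preimage_eq_image (w : ℂ) :
    factorPreimage h ψ {w} \ boundaryCurves n p ψ =
      (fun q : Fin p × Disk => quo n ψ ((pairingOne h q.1.rev).symm q.2)) ''
        {q | quo n ψ q.2 = w ∧ q.2 ∉ piece n p (zeroIndex h) q.1} := by
  ext x
  constructor
  · rintro ⟨⟨hx, hxw⟩, hxb⟩
    obtain ⟨s, z, hz, rfl⟩ := hψ.mem_factorDomain_iff.1 hx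
    rw [mem_singleton_iff, hψ.factorBowenSeries_piece hz] at hxw
    rw [hψ.quo_mem_boundaryCurves_iff hz] at hxb
    refine ⟨(s.rev, pairingOne h s z), ⟨hxw, (pairingOne_notMem_piece_iff h s z).2 ⟨hz, hxb⟩⟩, ?_⟩
    simp only [Fin.rev_rev, Homeomorph.symm_apply_apply]
  · rintro ⟨⟨s, y⟩, ⟨hyw, hy⟩, rfl⟩
    simp only at hyw hy ⊢
    set z := (pairingOne h s.rev).symm y with hz
    have hzy : pairingOne h s.rev z = y := Homeomorph.apply_symm_apply _ y
    have h1 := pairingOne_notMem_piece_iff h s.rev z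
    rw [Fin.rev_rev, hzy] at h1
    obtain ⟨h2, h3⟩ := h1.1 hy
    refine ⟨⟨hψ.mem_factorDomain_iff.2 ⟨_, z, h2, rfl⟩, ?_⟩, ?_⟩
    · rw [mem_singleton_iff, hψ.factorBowenSeries_piece h2, hzy, hyw]
    · rwa [hψ.quo_mem_boundaryCurves_iff h2]

theorem injOn_preimage (w : ℂ) :
    InjOn (fun q : Fin p × Disk => quo n ψ ((pairingOne h q.1.rev).symm q.2))
      {q | quo n ψ q.2 = w ∧ q.2 ∉ piece n p (zeroIndex h) q.1} := by
  have key : ∀ (s : Fin p) (y : Disk), y ∉ piece n p (zeroIndex h) s →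
      (pairingOne h s.rev).symm y ∈ piece n p (zeroIndex h) s.rev := by
    intro s y hy
    have h1 := pairingOne_notMem_piece_iff h s.rev ((pairingOne h s.rev).symm y)
    rw [Fin.rev_rev, Homeomorph.apply_symm_apply] at h1
    exact (h1.1 hy).1
  rintro ⟨s, y⟩ ⟨-, hy⟩ ⟨s', y'⟩ ⟨-, hy'⟩ he
  obtain ⟨h1, h2⟩ := hψ.piece_quo_injective (key s y hy) (key s' y' hy') he
  obtain rfl := Fin.rev_injective h1
  rw [(pairingOne h s.rev).symm.injective h2]

/-- No point of the fibre lies in any piece, so all pairs of one of the `p` sides and one of the `d`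
fibre points contribute. -/
theorem ncard_preimage_of_notMem {w : ℂ} (hw : w ∉ factorDomain n p ψ) {d : ℕ}
    (hf : {y | quo n ψ y = w}.Finite ∧ {y | quo n ψ y = w}.ncard = d) :
    (factorPreimage h ψ {w} \ boundaryCurves n p ψ).Finite ∧
      (factorPreimage h ψ {w} \ boundaryCurves n p ψ).ncard = p * d := by
  have hset : {q : Fin p × Disk | quo n ψ q.2 = w ∧ q.2 ∉ piece n p (zeroIndex h) q.1} =
      univ ×ˢ {y | quo n ψ y = w} := by
    ext ⟨s, y⟩
    simp only [mem_ofPred_eq, mem_prod, mem_univ, true_and, and_iff_left_iff_imp]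
    intro hy hyp
    exact hw (hψ.mem_factorDomain_iff.2 ⟨s, y, hyp, hy⟩)
  have hinj := hψ.injOn_preimage w
  rw [hψ.preimage_eq_image w, hinj.ncard_image, hset]
  refine ⟨(finite_univ.prod hf.1).image _, ?_⟩
  rw [ncard_prod, hf.2, ncard_univ, Nat.card_eq_fintype_card, Fintype.card_fin]

/-- Exactly one of the `n * p` pairs is excluded, namely the unique representative of `w` with the
piece that contains it. -/
theorem ncard_preimage_of_mem {w : ℂ} (hw : w ∈ factorDomain n p ψ) :
    (factorPreimage h ψ {w} \ boundaryCurves n p ψ).Finite ∧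
      (factorPreimage h ψ {w} \ boundaryCurves n p ψ).ncard = n * p - 1 := by
  have h0 : n = 1 ∨ w ≠ 0 := by
    by_contra! hcon
    have := ne_zero_of_three_le h
    exact hψ.zero_notMem_factorDomain (by omega) (hcon.2 ▸ hw)
  have hf := hψ.ncard_fiber (mem_closedBall_zero_iff.1 (factorDomain_subset hw)) h0
  obtain ⟨s, y, hy, hyw⟩ := hψ.mem_factorDomain_iff.1 hw
  have hset : {q : Fin p × Disk | quo n ψ q.2 = w ∧ q.2 ∉ piece n p (zeroIndex h) q.1} =
      (univ ×ˢ {y | quo n ψ y = w}) \ {(s, y)} := by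
    ext ⟨s', y'⟩
    simp only [mem_ofPred_eq, Set.mem_sdiff, mem_prod, mem_univ, true_and, mem_singleton_iff,
      Prod.mk.injEq]
    refine and_congr_right fun hy' => not_congr ⟨fun hp => ?_, ?_⟩
    · exact hψ.piece_quo_injective hp hy (hy'.trans hyw.symm)
    · rintro ⟨rfl, rfl⟩
      exact hy
  have hinj := hψ.injOn_preimage w
  have hfin : ((univ : Set (Fin p)) ×ˢ {y | quo n ψ y = w}).Finite := finite_univ.prod hf.1
  rw [hψ.preimage_eq_image w, hinj.ncard_image, hset]
  refine ⟨(hfin.sdiff).image _, ?_⟩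
  rw [ncard_sdiff_singleton_of_mem (by exact ⟨mem_univ s, hyw⟩), ncard_prod, hf.2, ncard_univ,
    Nat.card_eq_fintype_card, Fintype.card_fin, mul_comm]

theorem setOf_preimage_eq {V : Set ℂ} (hV : Disjoint V (boundaryCurves n p ψ)) {w : ℂ}
    (hw : w ∈ V) :
    {z ∈ factorPreimage h ψ V | factorBowenSeries h ψ z = w} =
      factorPreimage h ψ {w} \ boundaryCurves n p ψ := by
  ext z
  constructor
  · rintro ⟨⟨hz, -⟩, hzw⟩
    refine ⟨⟨hz, hzw⟩, fun hzb => ?_⟩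
    have := hψ.bijOn_boundaryCurves.mapsTo hzb
    rw [hzw] at this
    exact disjoint_left.1 hV hw this
  · rintro ⟨⟨hz, hzw⟩, -⟩
    rw [mem_singleton_iff] at hzw
    exact ⟨⟨hz, by rw [hzw]; exact hw⟩, hzw⟩

theorem factorPreimage_subset_interior {V : Set ℂ} (hV : Disjoint V (boundaryCurves n p ψ))
    (hV1 : V ⊆ Metric.ball 0 1) : factorPreimage h ψ V ⊆ interior (factorDomain n p ψ) :=
  fun _ hz => hψ.mem_interior_of_factorBowenSeries hz.1 (mem_ball_zero_iff.1 (hV1 hz.2))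
    (disjoint_left.1 hV hz.2)

/-- Over a set that avoids the curves and the circle, all preimages are interior points off the
curves. The sum of the orders is then `k` points times a common order `e`. -/
theorem hasDegree_of_forall {V : Set ℂ} (hV : Disjoint V (boundaryCurves n p ψ))
    (hV1 : V ⊆ Metric.ball 0 1) {d : ℕ}
    (hd : ∀ w ∈ V, ∃ k e : ℕ, (factorPreimage h ψ {w} \ boundaryCurves n p ψ).Finite ∧
      (factorPreimage h ψ {w} \ boundaryCurves n p ψ).ncard = k ∧
      (∀ z ∈ interior (factorDomain n p ψ), factorBowenSeries h ψ z = w →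
        analyticOrderAt (fun x => factorBowenSeries h ψ x - w) z = e) ∧ k * e = d) :
    HasDegree (factorBowenSeries h ψ) (factorPreimage h ψ V) V d := by
  have hsub := hψ.factorPreimage_subset_interior hV hV1
  refine ⟨hψ.analyticOnNhd_factorBowenSeries.mono hsub, fun z hz => hz.2, fun w hw => ?_⟩
  obtain ⟨k, e, hfin, hk, he, hke⟩ := hd w hw
  have hord : ∀ z ∈ {z ∈ factorPreimage h ψ V | factorBowenSeries h ψ z = w},
      analyticOrderAt (fun x => factorBowenSeries h ψ x - w) z = (e : ℕ∞) :=
    fun z hz => he z (hsub hz.1) hz.2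
  rw [finsum_mem_congr rfl hord, hψ.setOf_preimage_eq hV hw]
  refine ⟨hfin, ?_⟩
  rw [finsum_mem_eq_finite_toFinset_sum _ hfin, Finset.sum_const,
    ← ncard_eq_toFinset_card _ hfin, hk, nsmul_eq_mul, ← hke]
  push_cast
  rfl

theorem hasDegree_interior :
    HasDegree (factorBowenSeries h ψ) (factorPreimage h ψ (interior (factorDomain n p ψ)))
      (interior (factorDomain n p ψ)) (n * p - 1) := by
  refine hψ.hasDegree_of_forall ?_ ?_ fun w hw => ?_
  · rw [disjoint_left, boundaryCurves]
    exact fun w hw hb => disjoint_left.1 disjoint_interior_frontier hw hb.1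
  · rw [← interior_closedBall _ one_ne_zero]
    exact interior_mono factorDomain_subset
  · obtain ⟨h1, h2⟩ := hψ.ncard_preimage_of_mem (interior_subset hw)
    refine ⟨n * p - 1, 1, h1, h2, ?_, mul_one _⟩
    rintro z hz rfl
    refine hψ.analyticOrderAt_eq_one hz ?_
    by_contra! hcon
    have := ne_zero_of_three_le h
    exact hψ.zero_notMem_factorDomain (by omega) (hcon.2 ▸ interior_subset hw)

theorem disjoint_compl_boundaryCurves :
    Disjoint (Metric.closedBall 0 1 \ factorDomain n p ψ) (boundaryCurves n p ψ) := by
  rw [disjoint_left, boundaryCurves, hψ.isCompact_factorDomain.isClosed.frontier_eq]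
  exact fun w hw hb => hw.2 hb.1.1

theorem compl_subset_ball : Metric.closedBall 0 1 \ factorDomain n p ψ ⊆ Metric.ball 0 1 := by
  intro w hw
  rw [mem_ball_zero_iff]
  refine lt_of_le_of_ne (mem_closedBall_zero_iff.1 hw.1) fun heq => hw.2 ?_
  exact hψ.sphere_subset_factorDomain (mem_sphere_zero_iff_norm.2 heq)

theorem hasDegree_compl :
    HasDegree (factorBowenSeries h ψ)
      (factorPreimage h ψ (Metric.closedBall 0 1 \ factorDomain n p ψ))
      (Metric.closedBall 0 1 \ factorDomain n p ψ) (n * p) := by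
  refine hψ.hasDegree_of_forall hψ.disjoint_compl_boundaryCurves hψ.compl_subset_ball
    fun w hw => ?_
  by_cases h0 : n = 1 ∨ w ≠ 0
  · obtain ⟨h1, h2⟩ := hψ.ncard_preimage_of_notMem hw.2
      (hψ.ncard_fiber (mem_closedBall_zero_iff.1 hw.1) h0)
    refine ⟨p * n, 1, h1, h2, ?_, by ring⟩
    rintro z hz rfl
    exact hψ.analyticOrderAt_eq_one hz h0
  · push Not at h0
    obtain ⟨hn1, rfl⟩ := h0
    have := ne_zero_of_three_le h
    obtain ⟨h1, h2⟩ := hψ.ncard_preimage_of_notMem hw.2 (hψ.ncard_fiber_zero (by omega))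
    -- Over the branch point the fibre shrinks from `n` points to one, and the order `n` at each of
    -- the `p` preimages makes up for it.
    refine ⟨p * 1, n, h1, h2, fun z hz hz0 => ?_, by ring⟩
    simp only [sub_zero]
    exact hψ.analyticOrderAt_of_eq_zero hz hz0

/-- At interior points with a nonzero value the map is locally injective to first order; at the
zeros its order is `n`, hence not `1`. -/
theorem criticalPoints_eq (hn : 2 ≤ n) :
    criticalPoints h ψ = factorPreimage h ψ {0} \ boundaryCurves n p ψ := by
  have h0 : (0 : ℂ) ∈ Metric.closedBall 0 1 \ factorDomain n p ψ :=
    ⟨by simp, hψ.zero_notMem_factorDomain hn⟩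
  rw [← hψ.setOf_preimage_eq hψ.disjoint_compl_boundaryCurves h0]
  ext z
  constructor
  · rintro ⟨hz, hz'⟩
    have hz0 : factorBowenSeries h ψ z = 0 := by
      by_contra hne
      exact hψ.deriv_factorBowenSeries_ne_zero hz (Or.inr hne) hz'
    exact ⟨⟨interior_subset hz, by rw [hz0]; exact h0⟩, hz0⟩
  · rintro ⟨hz, hz0⟩
    have hzi := hψ.factorPreimage_subset_interior hψ.disjoint_compl_boundaryCurves
      hψ.compl_subset_ball hz
    refine ⟨hzi, ?_⟩
    by_contra hne
    have h1 := (hψ.analyticOnNhd_factorBowenSeries z hzi).analyticOrderAt_eq_one_of_zero_deriv_ne_zero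
      hz0 hne
    rw [hψ.analyticOrderAt_of_eq_zero hzi hz0] at h1
    have : n = 1 := by exact_mod_cast h1
    omega

theorem criticalPoints_properties (hn : 2 ≤ n) :
    (criticalPoints h ψ).Finite ∧ (criticalPoints h ψ).ncard = p ∧
      criticalPoints h ψ ⊆ factorPreimage h ψ (Metric.closedBall 0 1 \ factorDomain n p ψ) ∧
      ∀ z ∈ criticalPoints h ψ, factorBowenSeries h ψ z = 0 ∧
        analyticOrderAt (deriv (factorBowenSeries h ψ)) z = ((n - 1 : ℕ) : ℕ∞) := by
  have h0 : (0 : ℂ) ∈ Metric.closedBall 0 1 \ factorDomain n p ψ :=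
    ⟨by simp, hψ.zero_notMem_factorDomain hn⟩
  obtain ⟨h1, h2⟩ := hψ.ncard_preimage_of_notMem h0.2 (hψ.ncard_fiber_zero hn)
  rw [← hψ.criticalPoints_eq hn] at h1 h2
  have hzero : ∀ z ∈ criticalPoints h ψ, factorBowenSeries h ψ z = 0 := by
    intro z hz
    rw [hψ.criticalPoints_eq hn] at hz
    exact hz.1.2
  refine ⟨h1, by rw [h2, mul_one], fun z hz => ?_, fun z hz => ⟨hzero z hz, ?_⟩⟩
  · exact ⟨interior_subset hz.1, by rw [hzero z hz]; exact h0⟩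
  · refine analyticOrderAt_deriv_of_pos (hψ.analyticOnNhd_factorBowenSeries z hz.1) ?_
    rw [hψ.analyticOrderAt_of_eq_zero hz.1 (hzero z hz)]
    exact_mod_cast (by omega : n = n - 1 + 1)

end InducesTeichOmega

end

/-! ### The action on the circle -/

section

variable {n p : ℕ} {h : 3 ≤ n * p} {ψ : Disk ≃ₜ Disk}

/-- The base lift, on the scale of the quotient circle. -/
def scaledLift (h : 3 ≤ n * p) (x : ℝ) : ℝ := n * baseLift h (x / n)

theorem continuous_scaledLift (h : 3 ≤ n * p) : Continuous (scaledLift h) :=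
  continuous_const.mul ((continuous_baseLift h).comp (continuous_id.div_const _))

theorem scaledLift_add (h : 3 ≤ n * p) (x : ℝ) :
    scaledLift h (x + 2 * Real.pi) = scaledLift h x + (n * p - 1 : ℕ) * (2 * Real.pi) := by
  have h1 : (x + 2 * Real.pi) / n = x / n + p * (2 * halfAngle n p) := by
    rw [add_div, two_pi_div_eq h]
    ring
  rw [scaledLift, scaledLift, h1, baseLift_add_nat_mul, Nat.cast_sub (by omega)]
  push_cast
  linear_combination (-2 : ℝ) * halfAngle_mul h

theorem scaledLift_expanding (h : 3 ≤ n * p) (x y : ℝ) (hxy : x < y) :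
    y - x < scaledLift h y - scaledLift h x := by
  have hn : (0 : ℝ) < n := by exact_mod_cast pos_of_three_le h
  have h1 := baseLift_expanding h (div_lt_div_of_pos_right hxy hn)
  rw [← sub_div, div_lt_iff₀ hn] at h1
  rw [scaledLift, scaledLift]
  linarith

/-- On an arc shorter than the circle there is an analytic branch of the `n`-th root. -/
theorem exists_root_on_arc (n : ℕ) {a b : ℝ} (hab : b - a < 2 * Real.pi) :
    ∃ ρ : ℂ → ℂ, ∀ x ∈ Icc a b, AnalyticAt ℂ ρ (Circle.exp x) ∧
      ρ (Circle.exp x) = Circle.exp (x / n) := by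
  -- Rotating the midpoint of the arc to `1` keeps the arc away from the cut of the principal
  -- logarithm.
  set c := (a + b) / 2 with hc
  refine ⟨fun w => Circle.exp (c / n) * Complex.exp (Complex.log (w * Circle.exp (-c)) / n),
    fun x hx => ?_⟩
  have h1 : ((Circle.exp x : Circle) : ℂ) * Circle.exp (-c) = Complex.exp ((x - c : ℝ) * I) := by
    rw [← Circle.coe_mul, ← Circle.exp_add, Circle.coe_exp, sub_eq_add_neg]
  have hlo : -Real.pi < x - c := by
    rw [hc]
    linarith [hx.1]
  have hhi : x - c < Real.pi := by
    rw [hc]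
    linarith [hx.2]
  constructor
  · have hslit : ((Circle.exp x : Circle) : ℂ) * Circle.exp (-c) ∈ Complex.slitPlane := by
      have harg : Complex.arg (Complex.exp ((x - c : ℝ) * I)) = x - c := by
        rw [← Circle.coe_exp, Circle.arg_exp hlo hhi.le]
      rw [h1, Complex.mem_slitPlane_iff_arg, harg]
      exact ⟨hhi.ne, Complex.exp_ne_zero _⟩
    exact analyticAt_const.mul (((by fun_prop : AnalyticAt ℂ (fun w : ℂ => w * Circle.exp (-c))
      (Circle.exp x)).clog hslit).div_const).cexp
  · simp only
    rw [h1, Complex.log_exp (by simpa using hlo) (by simpa using hhi.le)]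
    rw [show ((x - c : ℝ) : ℂ) * I / n = (((x - c) / n : ℝ) : ℂ) * I by push_cast; ring,
      ← Circle.coe_exp, ← Circle.coe_mul, ← Circle.exp_add]
    congr 2
    ring

namespace InducesTeichOmega

variable (hψ : InducesTeichOmega h ψ)
include hψ

/-- A lift of the boundary values of `ψ`. -/
theorem exists_boundary_lift : ∃ L : ℝ → ℝ, Continuous L ∧ StrictMono L ∧
    (∀ t, (ψ (bdry (Circle.exp t)) : ℂ) = Circle.exp (L t)) ∧
    ∀ t, L (t + 2 * Real.pi / n) = L t + 2 * Real.pi / n := by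
  obtain ⟨L, hLc, hLm, hL⟩ := hψ.quasiconformal.2.1
  replace hL : ∀ t, (ψ (bdry (Circle.exp t)) : ℂ) = Circle.exp (L t) := hL
  have hpi := Real.pi_pos
  have hn : (1 : ℝ) ≤ n := by exact_mod_cast pos_of_three_le h
  refine ⟨L, hLc, hLm, hL, fun t => ?_⟩
  -- If the lift gained more than one turn over a period, an earlier parameter would already return
  -- to the image of `t`, against the injectivity of `ψ`.
  have hle : L (t + 2 * Real.pi) ≤ L t + 2 * Real.pi := by
    by_contra! hcon
    obtain ⟨t', ht', he⟩ := intermediate_value_Ioo (by linarith : t ≤ t + 2 * Real.pi)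
      hLc.continuousOn (show L t + 2 * Real.pi ∈ _ from ⟨by linarith, hcon⟩)
    have h1 : ψ (bdry (Circle.exp t')) = ψ (bdry (Circle.exp t)) := by
      ext
      rw [hL, hL, he, Circle.exp_add_two_pi]
    obtain ⟨m, hm⟩ := Circle.exp_eq_exp.1 (bdry_injective (ψ.injective h1))
    have h2 : (0 : ℝ) < m := by nlinarith [ht'.1]
    have h3 : (m : ℝ) < 1 := by nlinarith [ht'.2]
    have h4 : 0 < m := by exact_mod_cast h2
    have h5 : m < 1 := by exact_mod_cast h3
    omega
  have hdiv : 0 < 2 * Real.pi / n := by positivity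
  have hdiv' : 2 * Real.pi / n ≤ 2 * Real.pi := div_le_self (by linarith) hn
  have hexp : Circle.exp (L (t + 2 * Real.pi / n)) = Circle.exp (L t + 2 * Real.pi / n) := by
    apply Circle.ext
    rw [← hL, Circle.exp_add (L t), Circle.coe_mul, ← hL]
    have h1 : bdry (Circle.exp (t + 2 * Real.pi / n)) = rot (omega n) (bdry (Circle.exp t)) := by
      ext
      change _ = (omega n : ℂ) * (Circle.exp t : ℂ)
      rw [bdry_coe, Circle.exp_add, Circle.coe_mul, mul_comm]
      rfl
    rw [h1, hψ.map_omega]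
    change (omega n : ℂ) * _ = _
    rw [mul_comm]
    rfl
  -- Commutation with `M_ω` gives the shift only up to `m` turns. Since the increment is positive
  -- and at most one turn, `m = 0`.
  obtain ⟨m, hm⟩ := Circle.exp_eq_exp.1 hexp
  have h1 : L t < L (t + 2 * Real.pi / n) := hLm (by linarith)
  have h2 : L (t + 2 * Real.pi / n) ≤ L t + 2 * Real.pi :=
    (hLm.monotone (by linarith)).trans hle
  have h3 : (-1 : ℝ) < m := by nlinarith
  have h4 : (m : ℝ) < 1 := by nlinarith
  have h5 : -1 < m := by exact_mod_cast h3
  have h6 : m < 1 := by exact_mod_cast h4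
  have h7 : m = 0 := by omega
  rw [hm, h7]
  simp

/-- The homeomorphism of the real line that lifts the map of the quotient circle induced by `ψ`. -/
theorem exists_quotient_lift : ∃ E : ℝ ≃o ℝ,
    (∀ x, E (x + 2 * Real.pi) = E x + 2 * Real.pi) ∧
    (∀ x, (ψ (bdry (Circle.exp (x / n))) : ℂ) = Circle.exp (E x / n)) ∧
    ∀ x, quo n ψ (bdry (Circle.exp (x / n))) = Circle.exp (E x) := by
  have hn : (0 : ℝ) < n := by exact_mod_cast pos_of_three_le h
  obtain ⟨L, hLc, hLm, hL, hLp⟩ := hψ.exists_boundary_lift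
  set g : ℝ → ℝ := fun x => n * L (x / n) with hg
  have hgc : Continuous g := by fun_prop
  have hgm : StrictMono g := fun x y hxy =>
    mul_lt_mul_of_pos_left (hLm (div_lt_div_of_pos_right hxy hn)) hn
  have hgp : ∀ x, g (x + 2 * Real.pi) = g x + 2 * Real.pi := by
    intro x
    simp only [hg, add_div, hLp]
    field_simp
  have hgs := surjective_of_lift Real.two_pi_pos hgc hgp
  have hE : ∀ x, (ψ (bdry (Circle.exp (x / n))) : ℂ) = Circle.exp (g x / n) := by
    intro x
    rw [hL]
    simp only [hg]
    rw [mul_div_cancel_left₀ _ hn.ne']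
  refine ⟨hgm.orderIsoOfSurjective g hgs, hgp, hE, fun x => ?_⟩
  change _ = ((Circle.exp (g x) : Circle) : ℂ)
  rw [quo, hE, ← Circle.coe_pow, ← Circle.exp_natCast_mul, mul_div_cancel₀ _ hn.ne']

theorem exists_circleMap :
    ∃ f : Circle → Circle, (∀ z : Circle, (f z : ℂ) = factorBowenSeries h ψ z) ∧
      PiecewiseAnalytic f ∧ OrientationPreserving (fun z => (f z : ℂ)) ∧ Expansive f ∧
      IsCoveringOfDegree f (n * p - 1) ∧ ConjugateToPower f (n * p - 1) := by
  have hn : (0 : ℝ) < n := by exact_mod_cast pos_of_three_le h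
  have hpi := Real.pi_pos
  obtain ⟨E, hEp, hEψ, hEq⟩ := hψ.exists_quotient_lift
  set f : Circle → Circle := fun z => ⟨factorBowenSeries h ψ z, mem_sphere_zero_iff_norm.2
    (hψ.norm_factorBowenSeries_eq_one (Circle.norm_coe z))⟩ with hf
  have hfcoe : ∀ z : Circle, (f z : ℂ) = factorBowenSeries h ψ z := fun z => rfl
  have hEc : Continuous E := E.continuous
  have hEsc : Continuous E.symm := E.symm.continuous
  have hfE : ∀ x, f (Circle.exp (E x)) = Circle.exp (E (scaledLift h x)) := by
    intro x
    apply Circle.ext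
    rw [hfcoe, ← hEq, hψ.factorBowenSeries_quo_bdry, ← hEq, scaledLift, mul_div_cancel_left₀ _ hn.ne']
  have hFm : StrictMono (scaledLift h) := fun x y hxy => by
    linarith [scaledLift_expanding h x y hxy]
  -- In the coordinate `E` the map is lifted by `scaledLift`, which `k` conjugates to multiplication
  -- by `n * p - 1`. So `k ∘ E.symm` lifts a conjugacy from `f` to the power map.
  have hconj : ConjugateToPower f (n * p - 1) := by
    obtain ⟨k, hkc, hkm, hkp, hk⟩ := exists_strictMono_semiconj Real.two_pi_pos
      (by omega : 2 ≤ n * p - 1) (continuous_scaledLift h) (scaledLift_add h)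
      (scaledLift_expanding h)
    have hEsp : ∀ x, E.symm (x + 2 * Real.pi) = E.symm x + 2 * Real.pi := by
      intro x
      rw [E.symm_apply_eq, hEp, E.apply_symm_apply]
    obtain ⟨K, hK⟩ := exists_circleHomeomorph_of_lift (h := fun x => k (E.symm x))
      (hkc.comp hEsc) (hkm.comp E.symm.strictMono) (fun x => by rw [hEsp, hkp])
    have hKf : ∀ z, K (f z) = K z ^ (n * p - 1) := by
      intro z
      obtain ⟨t, rfl⟩ := Circle.exp_surjective z
      obtain ⟨x, rfl⟩ := E.surjective t
      rw [hfE, hK, hK, ← Circle.exp_natCast_mul]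
      simp only [E.symm_apply_apply, hk]
    refine ⟨K.symm, fun z => ?_⟩
    rw [K.symm_apply_eq, hKf, K.apply_symm_apply]
  refine ⟨f, hfcoe, ?_, ?_, hconj.expansive (by omega), hconj.isCoveringOfDegree (by omega), hconj⟩
  · have hα := halfAngle_pos h
    have hp : 0 < p := Nat.pos_of_ne_zero (by rintro rfl; omega)
    -- Each side is cut at its midpoint into two arcs. For `p = 1` one side covers the whole
    -- quotient circle, which carries no branch of the `n`-th root when `n ≥ 2`; half sides are
    -- always short enough.
    set t : ℕ → ℝ := fun j => E (j * (n * halfAngle n p)) with ht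
    have htm : StrictMono t := fun i j hij =>
      E.strictMono (mul_lt_mul_of_pos_right (by exact_mod_cast hij) (by positivity))
    have htN : t (2 * p) = t 0 + 2 * Real.pi := by
      simp only [ht]
      rw [← hEp]
      congr 1
      push_cast
      linear_combination 2 * halfAngle_mul h
    refine ⟨2 * p, t, htm, htN, fun j hj => ?_⟩
    have harc : t (j + 1) - t j < 2 * Real.pi := by
      rcases Nat.eq_zero_or_pos j with rfl | hj0
      · have := htm (by omega : 0 + 1 < 2 * p)
        linarith
      · have h1 := htm hj0
        have h2 := htm.monotone (by omega : j + 1 ≤ 2 * p)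
        linarith
    obtain ⟨ρ, hρ⟩ := exists_root_on_arc n harc
    -- Two consecutive arcs belong to the same side.
    set s : Fin p := ⟨j / 2, by omega⟩ with hs
    obtain ⟨a, b, hab, hM⟩ := hψ.exists_moebius s
    refine ⟨fun w => ((a * ρ w + b) / ((starRingEnd ℂ) b * ρ w + (starRingEnd ℂ) a)) ^ n,
      fun y hy => ?_⟩
    obtain ⟨x, rfl⟩ := E.surjective y
    obtain ⟨h1, h2⟩ := hρ _ hy
    constructor
    · have h3 : AnalyticAt ℂ (fun z => (a * z + b) / ((starRingEnd ℂ) b * z + (starRingEnd ℂ) a))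
          (ρ (Circle.exp (E x))) := by
        rw [h2]
        exact analyticAt_moebius hab (Circle.norm_coe _).le
      exact (h3.comp h1).pow n
    · have hx1 : (j : ℝ) * (n * halfAngle n p) ≤ x := E.le_iff_le.1 hy.1
      have hx2 : x ≤ ((j + 1 : ℕ) : ℝ) * (n * halfAngle n p) := E.le_iff_le.1 hy.2
      have hj1 : 2 * ((j / 2 : ℕ) : ℝ) ≤ j := by exact_mod_cast Nat.mul_div_le j 2
      have hj2 : ((j + 1 : ℕ) : ℝ) ≤ 2 * (((j / 2 : ℕ) : ℝ) + 1) := by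
        exact_mod_cast (by omega : j + 1 ≤ 2 * (j / 2 + 1))
      have hmem : bdry (Circle.exp (x / n)) ∈ halfPlane n p (zeroIndex h) s := by
        apply bdry_mem_halfPlane h
        simp only [zero_mul, zero_add, hs]
        constructor
        · rw [le_div_iff₀ hn]
          have := mul_le_mul_of_nonneg_right hj1 (by positivity : 0 ≤ n * halfAngle n p)
          linarith
        · rw [div_le_iff₀ hn]
          have := mul_le_mul_of_nonneg_right hj2 (by positivity : 0 ≤ n * halfAngle n p)
          linarith
      have h4 : factorBowenSeries h ψ (Circle.exp (E x)) =
          ((a * Circle.exp (E x / n) + b) /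
            ((starRingEnd ℂ) b * Circle.exp (E x / n) + (starRingEnd ℂ) a)) ^ n := by
        rw [← hEq, hψ.factorBowenSeries_halfPlane hmem, quo, hM, hEψ]
      rw [hfcoe, h4, ← h2]
  · refine ⟨fun x => E (scaledLift h (E.symm x)), ?_, ?_, fun x => ?_⟩
    · exact hEc.comp ((continuous_scaledLift h).comp hEsc)
    · exact E.strictMono.comp (hFm.comp E.symm.strictMono)
    · have := hfE (E.symm x)
      rw [E.apply_symm_apply] at this
      exact congrArg (fun z : Circle => (z : ℂ)) this

end InducesTeichOmega

end

end

end FactorBS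

open FactorBS in
theorem mainTheorem5 (n p : ℕ) (h : 3 ≤ n * p) (ψ : Disk ≃ₜ Disk)
    (hψ : InducesTeichOmega h ψ) :
    -- the factor map is well defined and continuous, and holomorphic in the interior of `𝒟_Γ`
    ((∀ z ∈ bowenSeriesDomain n p ψ,
        factorBowenSeries h ψ ((z : ℂ) ^ n) = (bowenSeries h ψ z : ℂ) ^ n) ∧
      Set.MapsTo (factorBowenSeries h ψ) (factorDomain n p ψ) (Metric.closedBall 0 1) ∧
      ContinuousOn (factorBowenSeries h ψ) (factorDomain n p ψ) ∧
      AnalyticOnNhd ℂ (factorBowenSeries h ψ) (interior (factorDomain n p ψ))) ∧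
    -- the action on the circle
    (Metric.sphere 0 1 ⊆ factorDomain n p ψ ∧
      ∃ f : Circle → Circle, (∀ z : Circle, (f z : ℂ) = factorBowenSeries h ψ z) ∧
        PiecewiseAnalytic f ∧ OrientationPreserving (fun z => (f z : ℂ)) ∧ Expansive f ∧
        IsCoveringOfDegree f (n * p - 1) ∧ ConjugateToPower f (n * p - 1)) ∧
    -- the degree over `𝒟_Γ`: over its interior, and (the boundary curves in the open disk being
    -- mapped bijectively onto themselves) over all of it, off these curves
    (HasDegree (factorBowenSeries h ψ) (factorPreimage h ψ (interior (factorDomain n p ψ)))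
        (interior (factorDomain n p ψ)) (n * p - 1) ∧
      Set.BijOn (factorBowenSeries h ψ) (boundaryCurves n p ψ) (boundaryCurves n p ψ) ∧
      ∀ w ∈ factorDomain n p ψ,
        (factorPreimage h ψ {w} \ boundaryCurves n p ψ).Finite ∧
        (factorPreimage h ψ {w} \ boundaryCurves n p ψ).ncard = n * p - 1) ∧
    -- the degree over the complement of `𝒟_Γ`
    HasDegree (factorBowenSeries h ψ)
      (factorPreimage h ψ (Metric.closedBall 0 1 \ factorDomain n p ψ))
      (Metric.closedBall 0 1 \ factorDomain n p ψ) (n * p) ∧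
    -- the critical points
    (2 ≤ n →
      (criticalPoints h ψ).Finite ∧ (criticalPoints h ψ).ncard = p ∧
      criticalPoints h ψ ⊆ factorPreimage h ψ (Metric.closedBall 0 1 \ factorDomain n p ψ) ∧
      ∀ z ∈ criticalPoints h ψ, factorBowenSeries h ψ z = 0 ∧
        analyticOrderAt (deriv (factorBowenSeries h ψ)) z = ((n - 1 : ℕ) : ℕ∞)) := by
  refine ⟨⟨?_, hψ.mapsTo_factorBowenSeries, hψ.continuousOn_factorBowenSeries,
    hψ.analyticOnNhd_factorBowenSeries⟩, ⟨hψ.sphere_subset_factorDomain, hψ.exists_circleMap⟩,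
    ⟨hψ.hasDegree_interior, hψ.bijOn_boundaryCurves, fun w hw => hψ.ncard_preimage_of_mem hw⟩,
    hψ.hasDegree_compl, hψ.criticalPoints_properties⟩
  rintro _ ⟨z, hz, rfl⟩
  rw [bowenSeries, ψ.symm_apply_apply]
  exact hψ.factorBowenSeries_quo hz
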